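/- Let $k$ be a commutative ring and write $\otimes=\otimes_k$. Let $A$ be a $k$-algebra which is projective as a $k$-module, $\sigma$ a $k$-algebra automorphism of $A$, $\delta\colon A\to A$ a $\sigma$-derivation (a $k$-linear map with $\delta(ab)=\delta(a)b+\sigma(a)\delta(b)$), and $E=A[x;\sigma,\delta]$ the Ore extension: the $k$-algebra containing $A$ which is free as a left $A$-module on $1,x,x^2,\dots$, with $xa=\sigma(a)x+\delta(a)$ for $a\in A$. Conventions. For a $k$-algebra $S$ put $S^e=S\otimes S^{op}$; $S^e$-modules are $S$-$S$-bimodules on which $k$ acts centrally. For an $S^e$-module $M$, $H^n(S,M)$ is Hochschild cohomology, the cohomology of the Hochschild cochain complex $C^n(S,M)=\mathrm{Hom}_k(S^{\otimes n},M)$. For an endomorphism $\tau$ of $S$, $S\otimes S^{\tau}$ denotes $S\otimes S$ with the outer structure $a\cdot(u\otimes v)\cdot b=au\otimes v\tau(b)$; this structure is used to compute $H^n(S,S\otimes S^\tau)$ (for $\tau=\mathrm{id}$ we write $S\otimes S$). The inner structure $b\cdot(u\otimes v)\cdot a=ua\otimes bv$ commutes with it and makes $H^n(S,S\otimes S^{\tau})$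 an $S^e$-module. Suppose that (1) $A$ has a (possibly infinite) resolution by finitely generated projective $A^e$-modules; (2) for some $d\in\mathbb N$, $H^i(A,A\otimes A)=0$ for all $i\neq d$. Then $H^i(E,E\otimes E)=0$ for all $i\ne d+1$. Moreover, let $\omega'=H^d(A,A\otimes A^{\sigma^{-1}})$ and $\Omega=H^{d+1}(E,E\otimes E)$. Then there is an isomorphism of $E^e$-modules $\Omega\cong\omega'\otimes k[x]$, where the $E^e$-module structure on $\omega'\otimes k[x]$ is given, for $a\in A$, $n\in\mathbb N$ and $w\in\omega'$, by $$a\triangleright(w\otimes x^n)=\sum_{i=0}^n q^n_i(a)\,w\otimes x^i,\qquad x\triangleright(w\otimes x^n)=w\otimes x^{n+1},\qquad (w\otimes x^n)\triangleleft a=wa\otimes x^n,$$ and, for every $d$-cocycle $\tilde f\in C^d(A,A\otimes A^{\sigma^{-1}})$ with class $[\tilde f]\in\omega'$, by $$([\tilde f]\otimes x^n)\triangleleft x=[f_2]\otimes x^{n+1}-[f_3]\otimes x^n .$$ Here $q^n_i\colon A\to A$ is the sum of all compositions $\sigma_1\sigma_2\cdots\sigma_n$ with each $\sigma_j$ equal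 to $\sigma^{-1}$ or $-\delta\sigma^{-1}$ and with $\sigma^{-1}$ occurring exactly $i$ times ($q^0_0=\mathrm{id}$), and, with $f=(\sigma^{-1}\otimes\mathrm{id})\circ\tilde f\circ\sigma^{\otimes d}$, $$f_2=(\mathrm{id}\otimes\sigma^{-1})\circ f,$$ $$f_3=(\delta\otimes\mathrm{id})\circ f\circ(\sigma^{-1})^{\otimes d}+(\mathrm{id}\otimes\delta\sigma^{-1})\circ f-\sum_{j=1}^{d}f\circ\big(\mathrm{id}^{\otimes j-1}\otimes\delta\sigma^{-1}\otimes(\sigma^{-1})^{\otimes d-j}\big);$$ $f_2$ and $f_3$ are again cocycles in $C^d(A,A\otimes A^{\sigma^{-1}})$. -/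

import Mathlib

open scoped TensorProduct Polynomial

namespace OreHochschild

noncomputable section

/-! ### Bimodules over a `k`-algebra, that is, modules over the enveloping algebra -/

/-- An `S`-`S`-bimodule structure (with central action of `k`) on the `k`-module `M`, i.e. a module
structure over the enveloping algebra `Sᵉ = S ⊗ Sᵒᵖ`: a left action of `S` and a right action of `S`
(a left action of `Sᵒᵖ`) by `k`-linear maps which commute. -/
structure BimoduleStr (k S M : Type*) [CommRing k] [Ring S] [Algebra k S] [AddCommGroup M]
    [Module k M] where
  /-- the left action -/
  left : S →ₐ[k] Module.End k M
  /-- the right action -/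
  right : Sᵐᵒᵖ →ₐ[k] Module.End k M
  comm : ∀ (a : S) (b : Sᵐᵒᵖ), Commute (left a) (right b)

namespace BimoduleStr

/-- The regular bimodule `S`. -/
def regular (k S : Type*) [CommRing k] [Ring S] [Algebra k S] : BimoduleStr k S S where
  left := Algebra.lsmul k k S
  right := Algebra.lsmul k k S
  comm a b := by
    ext s
    simp [mul_assoc]

section

variable {k S T M N : Type*} [CommRing k] [Ring S] [Algebra k S] [Ring T] [Algebra k T]
  [AddCommGroup M] [Module k M] [AddCommGroup N] [Module k N]

/-- Pull-back of a bimodule along an algebra morphism `ν` on the left and `τ` on the right: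
`a · m · b = ν(a) m τ(b)`. For `S = T` it is the twisted bimodule `{}^ν M^τ`. -/
def twist (B : BimoduleStr k S M) (ν τ : T →ₐ[k] S) : BimoduleStr k T M where
  left := B.left.comp ν
  right := B.right.comp (AlgHom.op τ)
  comm _ _ := B.comm _ _

/-- The outer structure on `M ⊗ N`: `a · (m ⊗ n) · b = a m ⊗ n b`. -/
def outer (B : BimoduleStr k S M) (B' : BimoduleStr k S N) : BimoduleStr k S (M ⊗[k] N) where
  left := (Module.End.rTensorAlgHom k M N).comp B.left
  right := (Module.End.lTensorAlgHom k N M).comp B'.right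
  comm _ _ := TensorProduct.ext' fun _ _ => rfl

theorem outer_left_tmul (B : BimoduleStr k S M) (B' : BimoduleStr k S N) (s : S) (m : M) (n : N) :
    (B.outer B').left s (m ⊗ₜ n) = B.left s m ⊗ₜ n := rfl

theorem outer_right_tmul (B : BimoduleStr k S M) (B' : BimoduleStr k S N) (s : Sᵐᵒᵖ) (m : M) (n : N) :
    (B.outer B').right s (m ⊗ₜ n) = m ⊗ₜ B'.right s n := rfl

/-- The inner structure on `M ⊗ N`: `b · (m ⊗ n) · a = m a ⊗ b n`. -/
def inner (B : BimoduleStr k S M) (B' : BimoduleStr k S N) : BimoduleStr k S (M ⊗[k] N) where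
  left := (Module.End.lTensorAlgHom k N M).comp B'.left
  right := (Module.End.rTensorAlgHom k M N).comp B.right
  comm _ _ := TensorProduct.ext' fun _ _ => rfl

theorem inner_left_tmul (B : BimoduleStr k S M) (B' : BimoduleStr k S N) (s : S) (m : M) (n : N) :
    (B.inner B').left s (m ⊗ₜ n) = m ⊗ₜ B'.left s n := rfl

theorem inner_right_tmul (B : BimoduleStr k S M) (B' : BimoduleStr k S N) (s : Sᵐᵒᵖ) (m : M) (n : N) :
    (B.inner B').right s (m ⊗ₜ n) = B.right s m ⊗ₜ n := rfl

/-- A `k`-linear map is a morphism of bimodules if it respects both actions. -/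
def IsHom (B : BimoduleStr k S M) (B' : BimoduleStr k S N) (φ : M →ₗ[k] N) : Prop :=
  (∀ s m, φ (B.left s m) = B'.left s (φ m)) ∧ (∀ s m, φ (B.right s m) = B'.right s (φ m))

/-- The algebra of bimodule endomorphisms of `M`. -/
def endo (B : BimoduleStr k S M) : Subalgebra k (Module.End k M) :=
  Subalgebra.centralizer k (Set.range B.left ∪ Set.range B.right)

theorem mem_endo {B : BimoduleStr k S M} {φ : Module.End k M} :
    φ ∈ B.endo ↔ B.IsHom B φ := by
  simp only [endo, Subalgebra.mem_centralizer_iff, Set.mem_union, Set.mem_range, IsHom]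
  constructor
  · intro h
    exact ⟨fun s m => (LinearMap.congr_fun (h _ (Or.inl ⟨s, rfl⟩)) m).symm,
      fun s m => (LinearMap.congr_fun (h _ (Or.inr ⟨s, rfl⟩)) m).symm⟩
  · rintro ⟨h1, h2⟩ _ (⟨s, rfl⟩ | ⟨s, rfl⟩)
    · ext m; exact (h1 s m).symm
    · ext m; exact (h2 s m).symm

end

end BimoduleStr

/-! ### Hochschild cohomology through the Hochschild cochain complex -/

/-- Hochschild cochains `Cⁿ(A, M) = Hom_k(A^{⊗ n}, M)`, as `k`-multilinear maps. -/
abbrev Cochain (k A M : Type*) [CommRing k] [Ring A] [Algebra k A] [AddCommGroup M] [Module k M]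
    (n : ℕ) : Type _ :=
  MultilinearMap k (fun _ : Fin n => A) M

section Cohomology

variable {k A S M : Type*} [CommRing k] [Ring A] [Algebra k A] [Ring S] [Algebra k S]
  [AddCommGroup M] [Module k M]

/-- The term `a₀ · f(a₁, …, aₙ)`. -/
def leftTerm (B : BimoduleStr k A M) {n : ℕ} (f : Cochain k A M n) : Cochain k A M (n + 1) where
  toFun a := B.left (a 0) (f (fun i => a i.succ))
  map_update_add' := by
    intro inst a i x y
    obtain rfl : inst = instDecidableEqFin _ := Subsingleton.elim _ _
    refine Fin.cases ?_ (fun j => ?_) i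
    · simp
    · have h : ∀ z : A, (fun l : Fin n => Function.update a j.succ z l.succ)
          = Function.update (fun l => a l.succ) j z := fun z =>
        funext fun l => by simp [Function.update_apply]
      simp [h, Function.update_of_ne (Fin.succ_ne_zero j).symm]
  map_update_smul' := by
    intro inst a i c x
    obtain rfl : inst = instDecidableEqFin _ := Subsingleton.elim _ _
    refine Fin.cases ?_ (fun j => ?_) i
    · simp
    · have h : ∀ z : A, (fun l : Fin n => Function.update a j.succ z l.succ)
          = Function.update (fun l => a l.succ) j z := fun z =>
        funext fun l => by simp [Function.update_apply]
      simp [h, Function.update_of_ne (Fin.succ_ne_zero j).symm]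

/-- The term `f(a₀, …, aₙ₋₁) · aₙ`. -/
def rightTerm (B : BimoduleStr k A M) {n : ℕ} (f : Cochain k A M n) : Cochain k A M (n + 1) where
  toFun a := B.right (MulOpposite.op (a (Fin.last n))) (f (fun i => a i.castSucc))
  map_update_add' := by
    intro inst a i x y
    obtain rfl : inst = instDecidableEqFin _ := Subsingleton.elim _ _
    refine Fin.lastCases ?_ (fun j => ?_) i
    · simp [(Fin.castSucc_lt_last _).ne]
    · have h : ∀ z : A, (fun l : Fin n => Function.update a j.castSucc z l.castSucc)
          = Function.update (fun l => a l.castSucc) j z := fun z =>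
        funext fun l => by simp [Function.update_apply]
      simp [h, Function.update_of_ne (Fin.castSucc_lt_last j).ne']
  map_update_smul' := by
    intro inst a i c x
    obtain rfl : inst = instDecidableEqFin _ := Subsingleton.elim _ _
    refine Fin.lastCases ?_ (fun j => ?_) i
    · simp [(Fin.castSucc_lt_last _).ne]
    · have h : ∀ z : A, (fun l : Fin n => Function.update a j.castSucc z l.castSucc)
          = Function.update (fun l => a l.castSucc) j z := fun z =>
        funext fun l => by simp [Function.update_apply]
      simp [h, Function.update_of_ne (Fin.castSucc_lt_last j).ne']

theorem exists_contract_update {n : ℕ} (j : Fin n) (a : Fin (n + 1) → A) (i : Fin (n + 1)) :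
    ∃ (i' : Fin n) (g : A →ₗ[k] A), ∀ z : A,
      Fin.contractNth j.castSucc (· * ·) (Function.update a i z)
        = Function.update (Fin.contractNth j.castSucc (· * ·) a) i' (g z) := by
  rcases lt_trichotomy (i : ℕ) (j : ℕ) with h | h | h
  · refine ⟨⟨i, by omega⟩, LinearMap.id, fun z => ?_⟩
    funext l
    simp only [Fin.contractNth, Function.update_apply, Fin.ext_iff, Fin.val_castSucc, Fin.val_succ,
      LinearMap.id_apply]
    split_ifs <;> first | rfl | omega
  · refine ⟨j, LinearMap.mulRight k (a j.succ), fun z => ?_⟩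
    funext l
    simp only [Fin.contractNth, Function.update_apply, Fin.ext_iff, Fin.val_castSucc, Fin.val_succ,
      LinearMap.mulRight_apply]
    split_ifs with h1 h2 h3 <;> first | rfl | omega | skip
    all_goals (have : l = j := Fin.ext ‹_›; subst this; rfl)
  · by_cases h' : (i : ℕ) = j + 1
    · refine ⟨j, LinearMap.mulLeft k (a j.castSucc), fun z => ?_⟩
      funext l
      simp only [Fin.contractNth, Function.update_apply, Fin.ext_iff, Fin.val_castSucc,
        Fin.val_succ, LinearMap.mulLeft_apply]
      split_ifs with h1 h2 h3 <;> first | rfl | omega | skip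
      all_goals (have : l = j := Fin.ext ‹_›; subst this; rfl)
    · refine ⟨⟨i - 1, by omega⟩, LinearMap.id, fun z => ?_⟩
      funext l
      simp only [Fin.contractNth, Function.update_apply, Fin.ext_iff, Fin.val_castSucc,
        Fin.val_succ, LinearMap.id_apply]
      split_ifs <;> first | rfl | omega

/-- The term `f(a₀, …, a_j a_{j+1}, …, aₙ)`. -/
def contractTerm {n : ℕ} (j : Fin n) (f : Cochain k A M n) : Cochain k A M (n + 1) where
  toFun a := f (Fin.contractNth j.castSucc (· * ·) a)
  map_update_add' := by
    intro inst a i x y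
    obtain rfl : inst = instDecidableEqFin _ := Subsingleton.elim _ _
    obtain ⟨i', g, h⟩ := exists_contract_update (k := k) j a i
    simp [h]
  map_update_smul' := by
    intro inst a i c x
    obtain rfl : inst = instDecidableEqFin _ := Subsingleton.elim _ _
    obtain ⟨i', g, h⟩ := exists_contract_update (k := k) j a i
    simp [h]

/-- The Hochschild differential `Cⁿ(A, M) → Cⁿ⁺¹(A, M)`. -/
def differential (B : BimoduleStr k A M) (n : ℕ) : Cochain k A M n →ₗ[k] Cochain k A M (n + 1) where
  toFun f := leftTerm B f + ∑ j : Fin n, (-1 : k) ^ ((j : ℕ) + 1) • contractTerm j f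
    + (-1 : k) ^ (n + 1) • rightTerm B f
  map_add' f g := by
    ext a
    simp [leftTerm, rightTerm, contractTerm, Finset.sum_add_distrib]
    abel
  map_smul' c f := by
    ext a
    simp [leftTerm, rightTerm, contractTerm, Finset.smul_sum,
      smul_comm c]

theorem differential_apply (B : BimoduleStr k A M) (n : ℕ) (f : Cochain k A M n) (a : Fin (n + 1) → A) :
    differential B n f a = B.left (a 0) (f (fun i => a i.succ))
      + ∑ j : Fin n, (-1 : k) ^ ((j : ℕ) + 1) • f (Fin.contractNth j.castSucc (· * ·) a)
      + (-1 : k) ^ (n + 1) •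
        B.right (MulOpposite.op (a (Fin.last n))) (f (fun i => a i.castSucc)) := by
  simp [differential, leftTerm, rightTerm, contractTerm]

/-- Hochschild `n`-cocycles. -/
def cocycles (B : BimoduleStr k A M) (n : ℕ) : Submodule k (Cochain k A M n) :=
  LinearMap.ker (differential B n)

/-- Hochschild `n`-coboundaries. -/
def coboundaries (B : BimoduleStr k A M) : (n : ℕ) → Submodule k (Cochain k A M n)
  | 0 => ⊥
  | n + 1 => LinearMap.range (differential B n)

/-- Hochschild cohomology `Hⁿ(A, M)`: cocycles modulo coboundaries. -/
abbrev HH (B : BimoduleStr k A M) (n : ℕ) : Type _ :=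
  cocycles B n ⧸ (coboundaries B n).comap (cocycles B n).subtype

/-- The class of a cocycle. -/
def HH.mk (B : BimoduleStr k A M) (n : ℕ) : cocycles B n →ₗ[k] HH B n :=
  Submodule.mkQ _

/-- Composition of cochains with endomorphisms of the coefficients. -/
def postcomp (k A M : Type*) [CommRing k] [Ring A] [Algebra k A] [AddCommGroup M] [Module k M]
    (n : ℕ) : Module.End k M →ₐ[k] Module.End k (Cochain k A M n) :=
  AlgHom.ofLinearMap
    { toFun := fun φ =>
        { toFun := fun f => φ.compMultilinearMap f
          map_add' := fun f g => by ext; simp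
          map_smul' := fun c f => by ext; simp }
      map_add' := fun φ ψ => by ext; simp
      map_smul' := fun c φ => by ext; simp }
    (by ext; simp) (fun φ ψ => by ext; simp)

theorem postcomp_apply (n : ℕ) (φ : Module.End k M) (f : Cochain k A M n) (a : Fin n → A) :
    postcomp k A M n φ f a = φ (f a) := rfl

theorem differential_postcomp (B : BimoduleStr k A M) (n : ℕ) {φ : Module.End k M} (hφ : φ ∈ B.endo)
    (f : Cochain k A M n) :
    differential B n (postcomp k A M n φ f) = postcomp k A M (n + 1) φ (differential B n f) := by
  obtain ⟨h1, h2⟩ := BimoduleStr.mem_endo.1 hφ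
  ext a
  simp [differential_apply, postcomp_apply, h1, h2]

theorem postcomp_mem_cocycles (B : BimoduleStr k A M) (n : ℕ) {φ : Module.End k M} (hφ : φ ∈ B.endo)
    {f : Cochain k A M n} (hf : f ∈ cocycles B n) : postcomp k A M n φ f ∈ cocycles B n := by
  rw [cocycles, LinearMap.mem_ker] at hf ⊢
  rw [differential_postcomp B n hφ, hf, map_zero]

theorem postcomp_mem_coboundaries (B : BimoduleStr k A M) (n : ℕ) {φ : Module.End k M} (hφ : φ ∈ B.endo)
    {f : Cochain k A M n} (hf : f ∈ coboundaries B n) :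
    postcomp k A M n φ f ∈ coboundaries B n := by
  cases n with
  | zero =>
    simp only [coboundaries, Submodule.mem_bot] at hf ⊢
    rw [hf, map_zero]
  | succ n =>
    obtain ⟨g, rfl⟩ := hf
    exact ⟨postcomp k A M n φ g, differential_postcomp B n hφ g⟩

/-- The map `[f] ↦ [φ ∘ f]` on `Hⁿ(A, M)` induced by a bimodule endomorphism `φ` of `M`. -/
def cohomologyMap (B : BimoduleStr k A M) (n : ℕ) (φ : B.endo) : Module.End k (HH B n) :=
  Submodule.mapQ _ _
    (((postcomp k A M n φ.1).comp (cocycles B n).subtype).codRestrict (cocycles B n)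
      fun f => postcomp_mem_cocycles B n φ.2 f.2)
    (fun _ hf => postcomp_mem_coboundaries B n φ.2 (Submodule.mem_comap.1 hf))

theorem cohomologyMap_mk (B : BimoduleStr k A M) (n : ℕ) (φ : B.endo) (f : cocycles B n) :
    cohomologyMap B n φ (HH.mk B n f)
      = HH.mk B n ⟨postcomp k A M n φ.1 f.1, postcomp_mem_cocycles B n φ.2 f.2⟩ := rfl

theorem HH.ext_mk {B : BimoduleStr k A M} {n : ℕ} {φ ψ : Module.End k (HH B n)}
    (h : ∀ f, φ (HH.mk B n f) = ψ (HH.mk B n f)) : φ = ψ :=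
  Submodule.linearMap_qext _ (LinearMap.ext h)

/-- Functoriality of Hochschild cohomology in the coefficients: the algebra of bimodule
endomorphisms of `M` acts on `Hⁿ(A, M)`. -/
def cohomologyAction (B : BimoduleStr k A M) (n : ℕ) : B.endo →ₐ[k] Module.End k (HH B n) :=
  AlgHom.ofLinearMap
    { toFun := cohomologyMap B n
      map_add' := fun φ ψ => HH.ext_mk fun f => by
        rw [LinearMap.add_apply]
        simp only [cohomologyMap_mk]
        rw [← map_add]
        congr 1
      map_smul' := fun c φ => HH.ext_mk fun f => by
        rw [LinearMap.smul_apply]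
        simp only [cohomologyMap_mk, RingHom.id_apply]
        rw [← map_smul]
        congr 1 }
    (HH.ext_mk fun f => by
      change cohomologyMap B n 1 _ = _
      rw [cohomologyMap_mk, Module.End.one_apply]
      congr 1)
    (fun φ ψ => HH.ext_mk fun f => by
      rw [Module.End.mul_apply]
      exact cohomologyMap_mk B n (φ * ψ) f)

theorem cohomologyAction_mk (B : BimoduleStr k A M) (n : ℕ) (φ : B.endo) (f : cocycles B n) :
    cohomologyAction B n φ (HH.mk B n f)
      = HH.mk B n ⟨postcomp k A M n φ.1 f.1, postcomp_mem_cocycles B n φ.2 f.2⟩ := rfl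

/-- If `M` carries, besides the `A`-bimodule structure `B` used to compute the cohomology, an
`S`-bimodule structure `B'` commuting with `B`, then `Hⁿ(A, M)` is an `S`-bimodule, by
`s · [f] · t = [s · f(-) · t]`. -/
def inducedBimod (B : BimoduleStr k A M) (B' : BimoduleStr k S M)
    (hl : ∀ s, B'.left s ∈ B.endo) (hr : ∀ s, B'.right s ∈ B.endo) (n : ℕ) :
    BimoduleStr k S (HH B n) where
  left := (cohomologyAction B n).comp (B'.left.codRestrict B.endo hl)
  right := (cohomologyAction B n).comp (B'.right.codRestrict B.endo hr)
  comm s t := by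
    have h : Commute (B'.left.codRestrict B.endo hl s) (B'.right.codRestrict B.endo hr t) :=
      Subtype.ext (B'.comm s t)
    exact h.map (cohomologyAction B n)

end Cohomology

/-! ### The coefficient bimodules `A ⊗ A` and `A ⊗ A^τ` -/

section Coefficients

variable (k : Type*) {A : Type*} [CommRing k] [Ring A] [Algebra k A]

/-- The outer bimodule structure on `A ⊗ A^τ`: `a · (u ⊗ v) · b = a u ⊗ v τ(b)`. -/
def outerTwisted (τ : A →ₐ[k] A) : BimoduleStr k A (A ⊗[k] A) :=
  (BimoduleStr.regular k A).outer ((BimoduleStr.regular k A).twist (AlgHom.id k A) τ)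

/-- The inner bimodule structure on `A ⊗ A^τ` (which does not involve `τ`, as only the left action
on the second factor is used): `b · (u ⊗ v) · a = u a ⊗ b v`. -/
def innerTwisted (τ : A →ₐ[k] A) : BimoduleStr k A (A ⊗[k] A) :=
  (BimoduleStr.regular k A).inner ((BimoduleStr.regular k A).twist (AlgHom.id k A) τ)

theorem innerTwisted_left_mem (τ : A →ₐ[k] A) (s : A) :
    (innerTwisted k τ).left s ∈ (outerTwisted k τ).endo := by
  refine BimoduleStr.mem_endo.2 ⟨fun t m => ?_, fun t m => ?_⟩
  · induction m with
    | zero => simp only [map_zero]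
    | add x y hx hy => simp only [map_add, hx, hy]
    | tmul x y => rfl
  · induction m with
    | zero => simp only [map_zero]
    | add x y hx hy => simp only [map_add, hx, hy]
    | tmul x y =>
      exact congrArg (x ⊗ₜ[k] ·) (mul_assoc s y (τ t.unop)).symm

theorem innerTwisted_right_mem (τ : A →ₐ[k] A) (s : Aᵐᵒᵖ) :
    (innerTwisted k τ).right s ∈ (outerTwisted k τ).endo := by
  refine BimoduleStr.mem_endo.2 ⟨fun t m => ?_, fun t m => ?_⟩
  · induction m with
    | zero => simp only [map_zero]
    | add x y hx hy => simp only [map_add, hx, hy]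
    | tmul x y => exact congrArg (· ⊗ₜ[k] y) (mul_assoc t x s.unop)
  · induction m with
    | zero => simp only [map_zero]
    | add x y hx hy => simp only [map_add, hx, hy]
    | tmul x y => rfl

/-- `Hⁿ(A, A ⊗ A^τ)`, computed with the outer structure. -/
abbrev HHTwisted (τ : A →ₐ[k] A) (n : ℕ) : Type _ := HH (outerTwisted k τ) n

/-- The bimodule structure of `Hⁿ(A, A ⊗ A^τ)`, induced by the inner structure. -/
def bimodHHTwisted (τ : A →ₐ[k] A) (n : ℕ) : BimoduleStr k A (HHTwisted k τ n) :=
  inducedBimod (outerTwisted k τ) (innerTwisted k τ) (innerTwisted_left_mem k τ)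
    (innerTwisted_right_mem k τ) n

variable (A)

/-- `Hⁿ(A, A ⊗ A)`, computed with the outer structure. -/
abbrev HHEnv (n : ℕ) : Type _ := HHTwisted k (AlgHom.id k A) n

/-- The bimodule structure of `Hⁿ(A, A ⊗ A)`, induced by the inner structure. -/
def bimodHHEnv (n : ℕ) : BimoduleStr k A (HHEnv k A n) := bimodHHTwisted k (AlgHom.id k A) n

end Coefficients

/-! ### Finitely generated projective bimodule resolutions -/

section Resolution

universe u v

attribute [local instance] instModuleTensorProductMop

/-- `A` has a resolution (possibly of infinite length) by finitely generated projective modules over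
the enveloping algebra `Aᵉ = A ⊗ Aᵒᵖ`, where `(a ⊗ b) · m = a m b`. -/
def HasFGProjectiveResolution (k : Type u) (A : Type v) [CommRing k] [Ring A] [Algebra k A] :
    Prop :=
  ∃ P : CategoryTheory.ProjectiveResolution (ModuleCat.of.{v} (A ⊗[k] Aᵐᵒᵖ) A),
    ∀ n, Module.Finite (A ⊗[k] Aᵐᵒᵖ) (P.complex.X n)

end Resolution

/-! ### Ore extensions -/

/-- A `σ`-derivation of `A`: a `k`-linear map `δ` with `δ(ab) = δ(a) b + σ(a) δ(b)`. -/
structure SkewDerivation {k A : Type*} [CommRing k] [Ring A] [Algebra k A] (σ : A ≃ₐ[k] A) where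
  /-- the underlying linear map -/
  toLin : A →ₗ[k] A
  leibniz : ∀ a b, toLin (a * b) = toLin a * b + σ a * toLin b

/-- The Ore extension `A[x; σ, δ]`. An element `∑ aᵢ xⁱ` is its finitely supported family of
coefficients `aᵢ`, written on the left; the multiplication is defined below. -/
def OreExtension {k A : Type*} [CommRing k] [Ring A] [Algebra k A] (σ : A ≃ₐ[k] A)
    (_δ : SkewDerivation σ) : Type _ :=
  ℕ →₀ A

namespace OreExtension

variable {k A : Type*} [CommRing k] [Ring A] [Algebra k A] (σ : A ≃ₐ[k] A) (δ : SkewDerivation σ)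

/-- Left multiplication by `x`: `a xⁱ ↦ σ(a) xⁱ⁺¹ + δ(a) xⁱ`. -/
def mulX : Module.End k (ℕ →₀ A) :=
  Finsupp.lsum k fun i =>
    Finsupp.lsingle (i + 1) ∘ₗ σ.toLinearMap + Finsupp.lsingle i ∘ₗ δ.toLin

/-- Left multiplication by elements of `A`. -/
def mulC (k A : Type*) [CommRing k] [Ring A] [Algebra k A] :
    A →ₐ[k] Module.End k (ℕ →₀ A) :=
  Algebra.lsmul k k (ℕ →₀ A)

/-- Left multiplication: `∑ aᵢ xⁱ` acts by applying `x` repeatedly and then the coefficients. -/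
def mulLeftMap : (ℕ →₀ A) →ₗ[k] Module.End k (ℕ →₀ A) :=
  Finsupp.lsum k fun i => LinearMap.mulRight k (mulX σ δ ^ i) ∘ₗ (mulC k A).toLinearMap

theorem mulX_single (i : ℕ) (a : A) : mulX σ δ (Finsupp.single i a)
    = Finsupp.single (i + 1) (σ a) + Finsupp.single i (δ.toLin a) := by
  simp [mulX]

theorem mulLeftMap_single (i : ℕ) (a : A) : mulLeftMap σ δ (Finsupp.single i a)
    = mulC k A a * mulX σ δ ^ i := by
  simp [mulLeftMap]

theorem mulC_single (a b : A) (i : ℕ) :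
    mulC k A a (Finsupp.single i b) = Finsupp.single i (a * b) := by
  simp [mulC]

theorem toLin_one : δ.toLin 1 = 0 := by
  have h := δ.leibniz 1 1
  simpa using h

theorem mulX_pow_one (i : ℕ) :
    (mulX σ δ ^ i) (Finsupp.single 0 1) = Finsupp.single i 1 := by
  induction i with
  | zero => simp
  | succ i ih => rw [pow_succ', Module.End.mul_apply, ih, mulX_single]; simp [toLin_one]

theorem mulX_mulC (a : A) : mulX σ δ * mulC k A a
    = mulC k A (σ a) * mulX σ δ + mulC k A (δ.toLin a) := by
  refine Finsupp.lhom_ext fun i b => ?_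
  simp only [Module.End.mul_apply, LinearMap.add_apply, mulC_single, mulX_single, map_add,
    map_mul, δ.leibniz, Finsupp.single_add]
  abel

theorem mulLeftMap_mulC (a : A) (q : ℕ →₀ A) :
    mulLeftMap σ δ (mulC k A a q) = mulC k A a * mulLeftMap σ δ q := by
  induction q using Finsupp.induction_linear with
  | zero => simp
  | add p q hp hq => simp only [map_add, hp, hq, mul_add]
  | single i b => rw [mulC_single, mulLeftMap_single, mulLeftMap_single, map_mul, mul_assoc]

theorem mulLeftMap_mulX (q : ℕ →₀ A) :
    mulLeftMap σ δ (mulX σ δ q) = mulX σ δ * mulLeftMap σ δ q := by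
  induction q using Finsupp.induction_linear with
  | zero => simp
  | add p q hp hq => simp only [map_add, hp, hq, mul_add]
  | single i b =>
    rw [mulX_single, map_add, mulLeftMap_single, mulLeftMap_single, mulLeftMap_single, ← mul_assoc,
      mulX_mulC, add_mul, pow_succ', mul_assoc]

theorem mulLeftMap_mulX_pow (i : ℕ) (q : ℕ →₀ A) :
    mulLeftMap σ δ ((mulX σ δ ^ i) q) = mulX σ δ ^ i * mulLeftMap σ δ q := by
  induction i with
  | zero => simp
  | succ i ih => rw [pow_succ', Module.End.mul_apply, mulLeftMap_mulX, ih, mul_assoc]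

theorem mulLeftMap_mul (p q : ℕ →₀ A) :
    mulLeftMap σ δ (mulLeftMap σ δ p q) = mulLeftMap σ δ p * mulLeftMap σ δ q := by
  induction p using Finsupp.induction_linear with
  | zero => simp
  | add p q hp hq => simp only [map_add, LinearMap.add_apply, hp, hq, add_mul]
  | single i b =>
    rw [mulLeftMap_single, Module.End.mul_apply, mulLeftMap_mulC, mulLeftMap_mulX_pow, mul_assoc]

theorem mulLeftMap_one (p : ℕ →₀ A) : mulLeftMap σ δ (Finsupp.single 0 1) p = p := by
  rw [mulLeftMap_single, pow_zero, mul_one, map_one, Module.End.one_apply]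

theorem mulLeftMap_apply_one (p : ℕ →₀ A) : mulLeftMap σ δ p (Finsupp.single 0 1) = p := by
  induction p using Finsupp.induction_linear with
  | zero => rw [map_zero, LinearMap.zero_apply]
  | add p q hp hq => rw [map_add, LinearMap.add_apply, hp, hq]
  | single i b =>
    rw [mulLeftMap_single, Module.End.mul_apply, mulX_pow_one, mulC_single, mul_one]

instance : AddCommGroup (OreExtension σ δ) := inferInstanceAs (AddCommGroup (ℕ →₀ A))

instance : Module k (OreExtension σ δ) := inferInstanceAs (Module k (ℕ →₀ A))

instance : Ring (OreExtension σ δ) where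
  __ := (inferInstance : AddCommGroup (OreExtension σ δ))
  mul p q := (mulLeftMap σ δ p q : ℕ →₀ A)
  one := (Finsupp.single 0 1 : ℕ →₀ A)
  left_distrib p q r := (mulLeftMap σ δ p).map_add q r
  right_distrib p q r := LinearMap.congr_fun ((mulLeftMap σ δ).map_add p q) r
  zero_mul p := LinearMap.congr_fun (mulLeftMap σ δ).map_zero p
  mul_zero p := (mulLeftMap σ δ p).map_zero
  mul_assoc p q r := LinearMap.congr_fun (mulLeftMap_mul σ δ p q) r
  one_mul p := mulLeftMap_one σ δ p
  mul_one p := mulLeftMap_apply_one σ δ p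

instance : Algebra k (OreExtension σ δ) :=
  Algebra.ofModule
    (fun c p q => LinearMap.congr_fun ((mulLeftMap σ δ).map_smul c p) q)
    (fun c p q => (mulLeftMap σ δ p).map_smul c q)

/-- The element `x` of `A[x; σ, δ]`. -/
def X : OreExtension σ δ := (Finsupp.single 1 1 : ℕ →₀ A)

/-- The inclusion of `A` in `A[x; σ, δ]`. -/
def C : A →ₐ[k] OreExtension σ δ :=
  AlgHom.ofLinearMap (Finsupp.lsingle 0 : A →ₗ[k] (ℕ →₀ A)) rfl (fun a b => by
    change (Finsupp.single 0 (a * b) : ℕ →₀ A)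
      = mulLeftMap σ δ (Finsupp.single 0 a) (Finsupp.single 0 b)
    rw [mulLeftMap_single, Module.End.mul_apply, pow_zero, Module.End.one_apply, mulC_single])

theorem C_mul_X_pow (a : A) (i : ℕ) :
    C σ δ a * X σ δ ^ i = (Finsupp.single i a : ℕ →₀ A) := by
  have h : X σ δ ^ i = (Finsupp.single i 1 : ℕ →₀ A) := by
    induction i with
    | zero => rfl
    | succ i ih =>
      rw [pow_succ', ih]
      change mulLeftMap σ δ (Finsupp.single 1 1) (Finsupp.single i 1) = _
      simp [mulLeftMap_single, mulX_single, toLin_one]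
  rw [h]
  change mulLeftMap σ δ (Finsupp.single 0 a) (Finsupp.single i 1) = _
  rw [mulLeftMap_single, Module.End.mul_apply, pow_zero, Module.End.one_apply, mulC_single, mul_one]

/-- `A[x; σ, δ]` is a free left `A`-module with basis `1, x, x², …`. -/
theorem bijective_sum :
    Function.Bijective fun p : ℕ →₀ A => p.sum fun i a => C σ δ a * X σ δ ^ i := by
  have h : (fun p : ℕ →₀ A => p.sum fun i a => C σ δ a * X σ δ ^ i) = fun p => p := by
    funext p
    simp only [C_mul_X_pow]
    exact Finsupp.sum_single p
  rw [h]
  exact Function.bijective_id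

/-- The defining relation `x a = σ(a) x + δ(a)`. -/
theorem X_mul_C (a : A) :
    X σ δ * C σ δ a = C σ δ (σ a) * X σ δ + C σ δ (δ.toLin a) := by
  have h := C_mul_X_pow σ δ (σ a) 1
  rw [pow_one] at h
  rw [h]
  have key : mulLeftMap σ δ (Finsupp.single 1 1) (Finsupp.single 0 a)
      = Finsupp.single 1 (σ a) + Finsupp.single 0 (δ.toLin a) := by
    simp [mulLeftMap_single, mulX_single]
  exact key

end OreExtension

/-! ### The maps which describe the bimodule structure -/

section Formulas

variable {k A : Type*} [CommRing k] [Ring A] [Algebra k A] (σ : A ≃ₐ[k] A) (δ : SkewDerivation σ)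

/-- The automorphism `σ⁻¹` as an algebra morphism. -/
abbrev sigmaInv : A →ₐ[k] A := (σ.symm : A →ₐ[k] A)

/-- The linear map `δ ∘ σ⁻¹`. -/
def deltaSigmaInv : A →ₗ[k] A := δ.toLin ∘ₗ σ.symm.toLinearMap

/-- The map `qⁿᵢ : A → A`: the sum of all compositions `σ₁ σ₂ ⋯ σₙ` where each `σⱼ` is `σ⁻¹` or
`-δ σ⁻¹` and `σ⁻¹` occurs exactly `i` times (at the positions in the set `T`). -/
def qMap (n i : ℕ) : Module.End k A :=
  ∑ T ∈ Finset.powersetCard i (Finset.univ : Finset (Fin n)),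
    (List.ofFn fun j : Fin n =>
      if j ∈ T then (σ.symm.toLinearMap : Module.End k A) else -deltaSigmaInv σ δ).prod

/-- `(σ⁻¹ ⊗ id) ∘ g ∘ σ^{⊗ n}`. -/
def untwist {n : ℕ} (g : Cochain k A (A ⊗[k] A) n) : Cochain k A (A ⊗[k] A) n :=
  (LinearMap.rTensor A σ.symm.toLinearMap).compMultilinearMap
    (g.compLinearMap fun _ => σ.toLinearMap)

/-- `f₂ = (id ⊗ σ⁻¹) ∘ f`. -/
def f₂ {n : ℕ} (f : Cochain k A (A ⊗[k] A) n) : Cochain k A (A ⊗[k] A) n :=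
  (LinearMap.lTensor A σ.symm.toLinearMap).compMultilinearMap f

/-- `f₃ = (δ ⊗ id) ∘ f ∘ (σ⁻¹)^{⊗ n} + (id ⊗ δσ⁻¹) ∘ f
  - ∑_{j=1}^n f ∘ (id^{⊗ j-1} ⊗ δσ⁻¹ ⊗ (σ⁻¹)^{⊗ n-j})`. -/
def f₃ {n : ℕ} (f : Cochain k A (A ⊗[k] A) n) : Cochain k A (A ⊗[k] A) n :=
  (LinearMap.rTensor A δ.toLin).compMultilinearMap
      (f.compLinearMap fun _ => σ.symm.toLinearMap)
    + (LinearMap.lTensor A (deltaSigmaInv σ δ)).compMultilinearMap f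
    - ∑ j : Fin n, f.compLinearMap fun i =>
        if i < j then LinearMap.id
        else if i = j then deltaSigmaInv σ δ
        else σ.symm.toLinearMap

end Formulas

end

end OreHochschild

/-! Write E = A[x; σ, δ], and let ^σM denote M with its left A-action twisted by σ. For an
E-bimodule M there is a long exact sequence H^n(A,M) → H^n(A,^σM) → H^{n+1}(E,M) → H^{n+1}(A,M) →
H^{n+1}(A,^σM), whose outer maps are induced by the skew commutator `commX` with x. On cochains it
comes from restriction to A (`pullC`) and signed insertion of x (`insertC`): by
`insertX_differential`, insertion is a homotopy from zero to `commX` after restriction. The two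
parts of exactness that matter, `mem_coboundaries_of_insertC` and `exists_insertC`, follow by
dimension shifting: M embeds in the coinduced bimodule Hom_k(E,M), which is acyclic in positive
degrees over E and also over A, because E is free as a right A-module.

Take M = E ⊗ E, which over A is the direct sum of the bimodules A x^i ⊗ x^j A, all isomorphic to A ⊗
A. The finiteness hypothesis makes cohomology over A compatible with such sums: each class comes
from a universal cocycle with values in a finitely generated syzygy (`exists_isUniversalCocycle`),
hence is supported on finitely many summands (`Decomp.exists_sub_sum_mem`). So H^i(A, E ⊗ E) = 0 for
i ≠ d.

On A x^i ⊗ E the skew commutator is σ followed by the passage from i to i+1, plus a term that keeps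
i (`commX_incl`). Comparing terms of highest i shows that it is injective on cohomology and that its
cokernel is represented, without redundancy, by the summand i = 0 (`mem_coboundaries_of_sum_commX`,
`push_incl_mem_tensorRange`). Injectivity and the exact sequence give H^i(E, E ⊗ E) = 0 for i ≠ d+1,
and identify Ω with the cokernel in degree d (`cohomologyEquivCoker`). The summand i = 0 is the sum
over n of copies of H^d(A, ^σ(A ⊗ A)); precomposition with σ identifies each with ω', whence ω' ⊗
k[x] (`tensorEquivCoker`).

All these identifications are natural in the coefficients, so the inner actions can be computed on
cochains. Left multiplication by a moves a past x^n, which produces the q^n_i. Right multiplication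
by x moves the summand i = 0 to i = 1, and subtracting one skew commutator brings it back to i = 0;
the two terms that appear are f₂ and f₃ (`push_incl_one_sub_mem`). -/

namespace OreHochschild

noncomputable section

/-! ### The Hochschild differential by recursion on the first argument; functoriality of cochains.
-/

section General

set_option linter.unusedSectionVars false

variable {k A S T M N L : Type*} [CommRing k] [Ring A] [Algebra k A] [Ring S] [Algebra k S]
  [Ring T] [Algebra k T]
  [AddCommGroup M] [Module k M] [AddCommGroup N] [Module k N] [AddCommGroup L] [Module k L]

/-- The part of the Hochschild differential which does not involve the left action, up to sign. -/
def barSum (r : A → M → M) : (n : ℕ) → ((Fin n → A) → M) → (Fin (n + 1) → A) → M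
  | 0, f, v => r (v 0) (f Fin.elim0)
  | n + 1, f, v => f (Fin.cons (v 0 * v 1) (Fin.tail (Fin.tail v)))
      - barSum r n (fun w => f (Fin.cons (v 0) w)) (Fin.tail v)

theorem barSum_zero (r : A → M → M) (f : (Fin 0 → A) → M) (a : A) (w : Fin 0 → A) :
    barSum r 0 f (Fin.cons a w) = r a (f w) := by
  rw [Subsingleton.elim w Fin.elim0]; rfl

theorem barSum_succ (r : A → M → M) {n : ℕ} (f : (Fin (n + 1) → A) → M) (a b : A) (w : Fin n → A) :
    barSum r (n + 1) f (Fin.cons a (Fin.cons b w))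
      = f (Fin.cons (a * b) w) - barSum r n (fun w => f (Fin.cons a w)) (Fin.cons b w) := by
  rfl

theorem exists_eq_cons {n : ℕ} (v : Fin (n + 1) → A) : ∃ a w, v = Fin.cons a w :=
  ⟨v 0, Fin.tail v, (Fin.cons_self_tail v).symm⟩

theorem contractNth_zero_cons {n : ℕ} (a b : A) (w : Fin n → A) :
    Fin.contractNth (Fin.castSucc (0 : Fin (n + 1))) (· * ·) (Fin.cons a (Fin.cons b w))
      = (Fin.cons (a * b) w : Fin (n + 1) → A) := by
  funext i
  refine Fin.cases ?_ (fun i => ?_) i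
  · simp [Fin.contractNth]
  · simp [Fin.contractNth]

theorem contractNth_succ_cons {n : ℕ} (j : Fin n) (a : A) (w : Fin (n + 1) → A) :
    Fin.contractNth (Fin.castSucc j.succ) (· * ·) (Fin.cons a w)
      = (Fin.cons a (Fin.contractNth j.castSucc (· * ·) w) : Fin (n + 1) → A) := by
  funext i
  refine Fin.cases ?_ (fun i => ?_) i
  · simp [Fin.contractNth]
  · simp [Fin.contractNth, Fin.castSucc_succ]

/-- Contracting at position j+1 leaves the first argument alone and contracts the tail at j; the
minus sign of the recursion accounts for the alternating signs. The closed form gives additivity and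
naturality at once, while the recursive form serves the inductions. -/
theorem barSum_eq (r : A → M →ₗ[k] M) (n : ℕ) (f : (Fin n → A) → M) (v : Fin (n + 1) → A) :
    barSum (fun a => r a) n f v
      = ∑ j : Fin n, (-1 : k) ^ (j : ℕ) • f (Fin.contractNth j.castSucc (· * ·) v)
        + (-1 : k) ^ n • r (v (Fin.last n)) (f (fun i => v i.castSucc)) := by
  induction n with
  | zero => simp [barSum]; rw [Subsingleton.elim (fun i : Fin 0 => _) Fin.elim0]
  | succ n ih =>
    obtain ⟨a, v, rfl⟩ := exists_eq_cons v
    obtain ⟨b, w, rfl⟩ := exists_eq_cons v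
    rw [barSum_succ, ih, Fin.sum_univ_succ, contractNth_zero_cons]
    have h : (fun i : Fin (n + 1) => (Fin.cons a (Fin.cons b w) : Fin (n + 2) → A) i.castSucc)
        = Fin.cons a fun i : Fin n => (Fin.cons b w : Fin (n + 1) → A) i.castSucc := by
      funext i
      refine Fin.cases ?_ (fun i => ?_) i
      · simp
      · simp [Fin.castSucc_succ]
    have h2 : (Fin.cons a (Fin.cons b w) : Fin (n + 2) → A) (Fin.last (n + 1))
        = (Fin.cons b w : Fin (n + 1) → A) (Fin.last n) := rfl
    simp only [contractNth_succ_cons, h, h2, Fin.val_succ, Fin.val_zero, pow_succ, pow_zero,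
      mul_neg, mul_one, neg_smul, one_smul, Finset.sum_neg_distrib]
    abel

theorem barSum_sub (r : A → M →ₗ[k] M) (n : ℕ) (f g : (Fin n → A) → M) (v : Fin (n + 1) → A) :
    barSum (fun a => r a) n (fun w => f w - g w) v
      = barSum (fun a => r a) n f v - barSum (fun a => r a) n g v := by
  simp only [barSum_eq, map_sub, smul_sub, Finset.sum_sub_distrib]
  abel

theorem barSum_add (r : A → M →ₗ[k] M) (n : ℕ) (f g : (Fin n → A) → M) (v : Fin (n + 1) → A) :
    barSum (fun a => r a) n (fun w => f w + g w) v
      = barSum (fun a => r a) n f v + barSum (fun a => r a) n g v := by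
  simp only [barSum_eq, map_add, smul_add, Finset.sum_add_distrib]
  abel

theorem barSum_map (r : A → M →ₗ[k] M) (r' : A → N →ₗ[k] N) (φ : M →ₗ[k] N)
    (h : ∀ a m, φ (r a m) = r' a (φ m)) (n : ℕ) (f : (Fin n → A) → M) (v : Fin (n + 1) → A) :
    barSum (fun a => r' a) n (fun w => φ (f w)) v = φ (barSum (fun a => r a) n f v) := by
  simp only [barSum_eq, map_add, map_sum, map_smul, h]

/-- After two steps of the recursion the terms with abc in the first place cancel by associativity,
and what remains is the same statement for f(a, ·). -/
theorem barSum_barSum (B : BimoduleStr k A M) (n : ℕ) (f : (Fin n → A) → M)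
    (v : Fin (n + 2) → A) :
    barSum (fun a => B.right (MulOpposite.op a)) (n + 1)
      (barSum (fun a => B.right (MulOpposite.op a)) n f) v = 0 := by
  induction n with
  | zero =>
    obtain ⟨a, v, rfl⟩ := exists_eq_cons v
    obtain ⟨b, w, rfl⟩ := exists_eq_cons v
    simp [barSum_succ, barSum_zero]
  | succ n ih =>
    obtain ⟨a, v, rfl⟩ := exists_eq_cons v
    obtain ⟨b, v, rfl⟩ := exists_eq_cons v
    obtain ⟨c, w, rfl⟩ := exists_eq_cons v
    have h : (fun w => barSum (fun a => B.right (MulOpposite.op a)) (n + 1) f (Fin.cons a w))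
        = fun w => f (Fin.cons (a * w 0) (Fin.tail w))
          - barSum (fun a => B.right (MulOpposite.op a)) n (fun w => f (Fin.cons a w)) w := by
      funext w
      obtain ⟨b, w, rfl⟩ := exists_eq_cons w
      rw [barSum_succ]; rfl
    rw [barSum_succ, h, barSum_sub, ih, barSum_succ, barSum_succ]
    simp [mul_assoc]

/-- Isolates the only term that sees the left action. A twist of the left action by σ therefore does
not affect the rest. -/
theorem differential_cons (B : BimoduleStr k A M) (n : ℕ) (f : Cochain k A M n) (a : A)
    (w : Fin n → A) :
    differential B n f (Fin.cons a w) = B.left a (f w)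
      - barSum (fun a => B.right (MulOpposite.op a)) n f (Fin.cons a w) := by
  rw [differential_apply, barSum_eq]
  simp only [Fin.cons_zero, Fin.cons_succ, pow_succ, mul_neg, mul_one, neg_smul,
    Finset.sum_neg_distrib]
  abel

/-- The bar part squares to zero, and the mixed terms cancel because the left and right actions
commute. -/
theorem differential_differential (B : BimoduleStr k A M) (n : ℕ) (f : Cochain k A M n) :
    differential B (n + 1) (differential B n f) = 0 := by
  ext v
  obtain ⟨a, v, rfl⟩ := exists_eq_cons v
  obtain ⟨b, w, rfl⟩ := exists_eq_cons v
  have h : ⇑(differential B n f) = fun w => B.left (w 0) (f (Fin.tail w))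
      - barSum (fun a => B.right (MulOpposite.op a)) n f w := by
    funext w
    obtain ⟨b, w, rfl⟩ := exists_eq_cons w
    rw [differential_cons]; rfl
  rw [differential_cons, h, barSum_sub, barSum_barSum, barSum_succ]
  simp only [Fin.cons_zero, Fin.tail_cons]
  rw [barSum_map _ (fun a => B.right (MulOpposite.op a)) (B.left a)
    (fun b m => (LinearMap.congr_fun (B.comm a (MulOpposite.op b)) m))]
  simp

theorem coboundaries_le_cocycles (B : BimoduleStr k A M) (n : ℕ) :
    coboundaries B n ≤ cocycles B n := by
  cases n with
  | zero => exact bot_le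
  | succ n =>
    rintro _ ⟨g, rfl⟩
    exact differential_differential B n g

/-- Composition of cochains with a linear map of the coefficients. -/
def push (k A : Type*) {M N : Type*} [CommRing k] [Ring A] [Algebra k A] [AddCommGroup M]
    [Module k M] [AddCommGroup N] [Module k N] (φ : M →ₗ[k] N) (n : ℕ) :
    Cochain k A M n →ₗ[k] Cochain k A N n where
  toFun f := φ.compMultilinearMap f
  map_add' f g := by ext; simp
  map_smul' c f := by ext; simp

@[simp]
theorem push_apply (φ : M →ₗ[k] N) (n : ℕ) (f : Cochain k A M n) (v : Fin n → A) :
    push k A φ n f v = φ (f v) := rfl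

theorem push_push (φ : M →ₗ[k] N) (ψ : N →ₗ[k] L) (n : ℕ) (f : Cochain k A M n) :
    push k A ψ n (push k A φ n f) = push k A (ψ ∘ₗ φ) n f := rfl

theorem push_injective (φ : M →ₗ[k] N) (hφ : Function.Injective φ) (n : ℕ) :
    Function.Injective (push k A φ n) := fun _ _ h =>
  MultilinearMap.ext fun v => hφ (congrArg (fun F : Cochain k A N n => F v) h)

/-- Restriction of cochains along a linear map of algebras. -/
def pull {k T S : Type*} (M : Type*) [CommRing k] [Ring T] [Algebra k T] [Ring S] [Algebra k S]
    [AddCommGroup M] [Module k M] (τ : T →ₗ[k] S) (n : ℕ) :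
    Cochain k S M n →ₗ[k] Cochain k T M n where
  toFun f := f.compLinearMap fun _ => τ
  map_add' f g := by ext; simp
  map_smul' c f := by ext; simp

@[simp]
theorem pull_apply (τ : T →ₗ[k] S) (n : ℕ) (f : Cochain k S M n) (v : Fin n → T) :
    pull M τ n f v = f (fun i => τ (v i)) := rfl

theorem differential_push {B : BimoduleStr k A M} {B' : BimoduleStr k A N} {φ : M →ₗ[k] N}
    (hφ : B.IsHom B' φ) (n : ℕ) (f : Cochain k A M n) :
    differential B' n (push k A φ n f) = push k A φ (n + 1) (differential B n f) := by
  ext a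
  simp [differential_apply, hφ.1, hφ.2]

theorem push_mem_cocycles {B : BimoduleStr k A M} {B' : BimoduleStr k A N} {φ : M →ₗ[k] N}
    (hφ : B.IsHom B' φ) {n : ℕ} {f : Cochain k A M n} (hf : f ∈ cocycles B n) :
    push k A φ n f ∈ cocycles B' n := by
  rw [cocycles, LinearMap.mem_ker] at hf ⊢
  rw [differential_push hφ, hf, map_zero]

theorem push_mem_coboundaries {B : BimoduleStr k A M} {B' : BimoduleStr k A N} {φ : M →ₗ[k] N}
    (hφ : B.IsHom B' φ) {n : ℕ} {f : Cochain k A M n} (hf : f ∈ coboundaries B n) :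
    push k A φ n f ∈ coboundaries B' n := by
  cases n with
  | zero =>
    simp only [coboundaries, Submodule.mem_bot] at hf ⊢
    rw [hf, map_zero]
  | succ n =>
    obtain ⟨g, rfl⟩ := hf
    exact ⟨push k A φ n g, differential_push hφ n g⟩

/-- `B'` is the pull-back of `B` along `τ`. -/
def IsRestriction (B' : BimoduleStr k T M) (B : BimoduleStr k S M) (τ : T →ₐ[k] S) : Prop :=
  (∀ t, B'.left t = B.left (τ t)) ∧
    ∀ t : T, B'.right (MulOpposite.op t) = B.right (MulOpposite.op (τ t))

theorem contractNth_map (τ : T →ₐ[k] S) {n : ℕ} (j : Fin (n + 1)) (v : Fin (n + 1) → T) :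
    (fun i => τ (Fin.contractNth j (· * ·) v i))
      = Fin.contractNth j (· * ·) (fun i => τ (v i)) := by
  funext i
  simp only [Fin.contractNth]
  split_ifs <;> simp

theorem differential_pull {B' : BimoduleStr k T M} {B : BimoduleStr k S M} {τ : T →ₐ[k] S}
    (h : IsRestriction B' B τ) (n : ℕ) (f : Cochain k S M n) :
    differential B' n (pull M τ.toLinearMap n f)
      = pull M τ.toLinearMap (n + 1) (differential B n f) := by
  ext a
  simp [differential_apply, h.1, h.2, contractNth_map]

theorem pull_mem_cocycles {B' : BimoduleStr k T M} {B : BimoduleStr k S M} {τ : T →ₐ[k] S}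
    (h : IsRestriction B' B τ) {n : ℕ} {f : Cochain k S M n} (hf : f ∈ cocycles B n) :
    pull M τ.toLinearMap n f ∈ cocycles B' n := by
  rw [cocycles, LinearMap.mem_ker] at hf ⊢
  rw [differential_pull h, hf, map_zero]

theorem pull_mem_coboundaries {B' : BimoduleStr k T M} {B : BimoduleStr k S M} {τ : T →ₐ[k] S}
    (h : IsRestriction B' B τ) {n : ℕ} {f : Cochain k S M n} (hf : f ∈ coboundaries B n) :
    pull M τ.toLinearMap n f ∈ coboundaries B' n := by
  cases n with
  | zero =>
    simp only [coboundaries, Submodule.mem_bot] at hf ⊢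
    rw [hf, map_zero]
  | succ n =>
    obtain ⟨g, rfl⟩ := hf
    exact ⟨pull M τ.toLinearMap n g, differential_pull h n g⟩

theorem mem_cocycles {B : BimoduleStr k A M} {n : ℕ} {f : Cochain k A M n} :
    f ∈ cocycles B n ↔ differential B n f = 0 := Iff.rfl

theorem differential_mem_coboundaries (B : BimoduleStr k A M) (n : ℕ) (f : Cochain k A M n) :
    differential B n f ∈ coboundaries B (n + 1) := ⟨f, rfl⟩

theorem subsingleton_HH_iff (B : BimoduleStr k A M) (n : ℕ) :
    Subsingleton (HH B n) ↔ cocycles B n ≤ coboundaries B n := by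
  rw [Submodule.Quotient.subsingleton_iff, Submodule.eq_top_iff']
  exact ⟨fun h f hf => h ⟨f, hf⟩, fun h f => h f.2⟩

theorem HH.mk_eq_zero_iff (B : BimoduleStr k A M) (n : ℕ) (f : cocycles B n) :
    HH.mk B n f = 0 ↔ f.1 ∈ coboundaries B n :=
  (Submodule.Quotient.mk_eq_zero _).trans Iff.rfl

theorem BimoduleStr.IsHom.twist {B : BimoduleStr k S M} {B' : BimoduleStr k S N} {φ : M →ₗ[k] N}
    (h : B.IsHom B' φ) (ν τ : T →ₐ[k] S) : (B.twist ν τ).IsHom (B'.twist ν τ) φ :=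
  ⟨fun _ _ => h.1 _ _, fun _ _ => h.2 _ _⟩

theorem BimoduleStr.IsHom.comp {B : BimoduleStr k S M} {B' : BimoduleStr k S N}
    {B'' : BimoduleStr k S L} {φ : M →ₗ[k] N} {ψ : N →ₗ[k] L}
    (h' : B'.IsHom B'' ψ) (h : B.IsHom B' φ) : B.IsHom B'' (ψ ∘ₗ φ) :=
  ⟨fun s m => by simp [h.1, h'.1], fun s m => by simp [h.2, h'.2]⟩

end General

end

end OreHochschild

namespace OreHochschild

noncomputable section

/-! ### The skew commutator with x and the insertion homotopy. -/

section Skew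

set_option linter.unusedSectionVars false

variable {k A S M N : Type*} [CommRing k] [Ring A] [Algebra k A] [Ring S] [Algebra k S]
  [AddCommGroup M] [Module k M] [AddCommGroup N] [Module k N]

/-- The cochain underlying `barSum`. -/
def barCochain (B : BimoduleStr k A M) {n : ℕ} (f : Cochain k A M n) : Cochain k A M (n + 1) :=
  leftTerm B f - differential B n f

theorem leftTerm_cons (B : BimoduleStr k A M) {n : ℕ} (f : Cochain k A M n) (a : A)
    (w : Fin n → A) : leftTerm B f (Fin.cons a w) = B.left a (f w) := rfl

theorem barCochain_cons (B : BimoduleStr k A M) {n : ℕ} (f : Cochain k A M n) (a : A)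
    (w : Fin n → A) : barCochain B f (Fin.cons a w)
      = barSum (fun a => B.right (MulOpposite.op a)) n f (Fin.cons a w) := by
  rw [barCochain, sub_apply, leftTerm_cons, differential_cons]
  abel

theorem barCochain_apply (B : BimoduleStr k A M) {n : ℕ} (f : Cochain k A M n)
    (v : Fin (n + 1) → A) :
    barCochain B f v = barSum (fun a => B.right (MulOpposite.op a)) n f v := by
  obtain ⟨a, w, rfl⟩ := exists_eq_cons v
  exact barCochain_cons B f a w

theorem barCochain_zero_cons (B : BimoduleStr k A M) (f : Cochain k A M 0) (a : A)
    (w : Fin 0 → A) : barCochain B f (Fin.cons a w) = B.right (MulOpposite.op a) (f w) := by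
  rw [barCochain_cons, barSum_zero]

theorem barCochain_cons_cons (B : BimoduleStr k A M) {n : ℕ} (f : Cochain k A M (n + 1)) (a b : A)
    (w : Fin n → A) : barCochain B f (Fin.cons a (Fin.cons b w))
      = f (Fin.cons (a * b) w) - barCochain B (f.curryLeft a) (Fin.cons b w) := by
  rw [barCochain_cons, barSum_succ, barCochain_cons]
  rfl

/-- The cochain `(b, …) ↦ f(ab, …)`. -/
def mulFirst {n : ℕ} (a : A) (f : Cochain k A M (n + 1)) : Cochain k A M (n + 1) :=
  LinearMap.uncurryLeft (M := fun _ : Fin (n + 1) => A)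
    (f.curryLeft ∘ₗ LinearMap.mulLeft k a)

theorem mulFirst_cons {n : ℕ} (a b : A) (f : Cochain k A M (n + 1)) (w : Fin n → A) :
    mulFirst a f (Fin.cons b w) = f (Fin.cons (a * b) w) := rfl

/-- The recursion in curried form, suited to `skewRight` and `insertX`, which are themselves defined
by recursion through `curryLeft`. -/
theorem curryLeft_barCochain (B : BimoduleStr k A M) {n : ℕ} (f : Cochain k A M (n + 1)) (a : A) :
    (barCochain B f).curryLeft a = mulFirst a f - barCochain B (f.curryLeft a) := by
  ext v
  obtain ⟨b, w, rfl⟩ := exists_eq_cons v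
  exact barCochain_cons_cons B f a b w

theorem curryLeft_leftTerm (B : BimoduleStr k A M) {n : ℕ} (f : Cochain k A M n) (a : A) :
    (leftTerm B f).curryLeft a = push k A (B.left a) n f := rfl

theorem differential_eq (B : BimoduleStr k A M) (n : ℕ) (f : Cochain k A M n) :
    differential B n f = leftTerm B f - barCochain B f := by
  rw [barCochain, sub_sub_cancel]

theorem barCochain_sub (B : BimoduleStr k A M) {n : ℕ} (f g : Cochain k A M n) :
    barCochain B (f - g) = barCochain B f - barCochain B g := by
  ext v
  obtain ⟨a, w, rfl⟩ := exists_eq_cons v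
  simp only [sub_apply, barCochain_cons]
  exact barSum_sub _ n f g _

theorem barCochain_add (B : BimoduleStr k A M) {n : ℕ} (f g : Cochain k A M n) :
    barCochain B (f + g) = barCochain B f + barCochain B g := by
  ext v
  obtain ⟨a, w, rfl⟩ := exists_eq_cons v
  simp only [add_apply, barCochain_cons]
  exact barSum_add _ n f g _

variable (σ : A ≃ₐ[k] A) (δ : SkewDerivation σ)

/-- The map `f ↦ (f ∘ σ^{⊗ n}) · x + ∑ⱼ f ∘ (σ^{⊗ j-1} ⊗ δ ⊗ id^{⊗ n-j})` on cochains, where `rx` is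
the right action of `x`. -/
def skewRight (rx : Module.End k M) : (n : ℕ) → Cochain k A M n →ₗ[k] Cochain k A M n
  | 0 => push k A rx 0
  | n + 1 =>
    { toFun f := LinearMap.uncurryLeft (M := fun _ : Fin (n + 1) => A)
        (f.curryLeft ∘ₗ δ.toLin + skewRight rx n ∘ₗ f.curryLeft ∘ₗ σ.toLinearMap)
      map_add' f g := by
        ext v
        have h : (f + g).curryLeft = f.curryLeft + g.curryLeft := rfl
        simp only [h, LinearMap.uncurryLeft_apply, LinearMap.add_apply, LinearMap.comp_apply,
          map_add, add_apply]
        abel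
      map_smul' s f := by
        ext v
        have h : (s • f).curryLeft = s • f.curryLeft := rfl
        simp only [h, LinearMap.uncurryLeft_apply, LinearMap.add_apply, LinearMap.smul_apply,
          LinearMap.comp_apply,
          map_smul, add_apply, smul_apply,
          smul_add, RingHom.id_apply] }

theorem skewRight_zero (rx : Module.End k M) (f : Cochain k A M 0) (w : Fin 0 → A) :
    skewRight σ δ rx 0 f w = rx (f w) := rfl

theorem skewRight_succ (rx : Module.End k M) {n : ℕ} (f : Cochain k A M (n + 1)) (a : A)
    (w : Fin n → A) : skewRight σ δ rx (n + 1) f (Fin.cons a w)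
      = f (Fin.cons (δ.toLin a) w) + skewRight σ δ rx n (f.curryLeft (σ a)) w := rfl

theorem curryLeft_skewRight (rx : Module.End k M) {n : ℕ} (f : Cochain k A M (n + 1)) (a : A) :
    (skewRight σ δ rx (n + 1) f).curryLeft a
      = f.curryLeft (δ.toLin a) + skewRight σ δ rx n (f.curryLeft (σ a)) := rfl

theorem skewRight_push {rx : Module.End k M} {rx' : Module.End k N} {φ : M →ₗ[k] N}
    (h : ∀ m, φ (rx m) = rx' (φ m)) (n : ℕ) (f : Cochain k A M n) :
    skewRight σ δ rx' n (push k A φ n f) = push k A φ n (skewRight σ δ rx n f) := by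
  induction n with
  | zero => ext w; exact (h _).symm
  | succ n ih =>
    ext v
    obtain ⟨a, w, rfl⟩ := exists_eq_cons v
    rw [push_apply, skewRight_succ, skewRight_succ, map_add]
    have h2 := congrArg (fun F : Cochain k A N n => F w) (ih (f.curryLeft (σ a)))
    exact congrArg₂ (· + ·) rfl h2

/-- Multiplying two neighbouring arguments is compatible with the operator by the Leibniz rule δ(ab)
= δ(a)b + σ(a)δ(b); at the right end, the relation xa = σ(a)x + δ(a) in the form `hr` plays the same
role. -/
theorem skewRight_barCochain (B : BimoduleStr k A M) {rx : Module.End k M}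
    (hr : ∀ a m, B.right (MulOpposite.op a) (rx m) = rx (B.right (MulOpposite.op (σ a)) m)
      + B.right (MulOpposite.op (δ.toLin a)) m) (n : ℕ) (f : Cochain k A M n) :
    skewRight σ δ rx (n + 1) (barCochain B f) = barCochain B (skewRight σ δ rx n f) := by
  induction n with
  | zero =>
    ext v
    obtain ⟨a, w, rfl⟩ := exists_eq_cons v
    rw [skewRight_succ, skewRight_zero, MultilinearMap.curryLeft_apply, barCochain_zero_cons,
      barCochain_zero_cons, barCochain_zero_cons, skewRight_zero, hr, add_comm]
  | succ n ih =>
    ext v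
    obtain ⟨a, v, rfl⟩ := exists_eq_cons v
    obtain ⟨b, w, rfl⟩ := exists_eq_cons v
    have h : (mulFirst (σ a) f).curryLeft (σ b) = f.curryLeft (σ (a * b)) := by
      rw [map_mul]; rfl
    rw [skewRight_succ, curryLeft_barCochain, map_sub, ih, sub_apply,
      barCochain_cons_cons, barCochain_cons_cons, curryLeft_skewRight, skewRight_succ,
      skewRight_succ, mulFirst_cons, h, δ.leibniz, barCochain_add, add_apply]
    have h2 : f (Fin.cons (δ.toLin a * b + σ a * δ.toLin b) w)
        = f (Fin.cons (δ.toLin a * b) w) + f (Fin.cons (σ a * δ.toLin b) w) :=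
      MultilinearMap.cons_add f w _ _
    rw [h2]
    abel

/-- The cochain map `f ↦ x f - skewRight f`. -/
def skewCommutator (lx rx : Module.End k M) (n : ℕ) : Cochain k A M n →ₗ[k] Cochain k A M n :=
  push k A lx n - skewRight σ δ rx n

theorem skewCommutator_apply (lx rx : Module.End k M) (n : ℕ) (f : Cochain k A M n) :
    skewCommutator σ δ lx rx n f = push k A lx n f - skewRight σ δ rx n f := rfl

theorem skewRight_leftTerm (B : BimoduleStr k A M) {rx : Module.End k M}
    (hrl : ∀ a m, B.left a (rx m) = rx (B.left a m)) (n : ℕ) (f : Cochain k A M n) (a : A)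
    (w : Fin n → A) :
    skewRight σ δ rx (n + 1) (leftTerm B f) (Fin.cons a w)
      = B.left (δ.toLin a) (f w) + B.left (σ a) (skewRight σ δ rx n f w) := by
  rw [skewRight_succ, curryLeft_leftTerm, skewRight_push σ δ (hrl (σ a))]
  rfl

/-- The bar parts commute with both halves of the commutator. In the left part, x·(a m) and the
operator `skewRight` each produce the same term δ(a) f(w); these cancel, and σ(a) is left acting on
the value, hence the twisted structure on the target. -/
theorem differential_skewCommutator (B B' : BimoduleStr k A M) {lx rx : Module.End k M}
    (hl : ∀ a m, lx (B.left a m) = B.left (σ a) (lx m) + B.left (δ.toLin a) m)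
    (hr : ∀ a m, B.right (MulOpposite.op a) (rx m) = rx (B.right (MulOpposite.op (σ a)) m)
      + B.right (MulOpposite.op (δ.toLin a)) m)
    (hlr : ∀ a m, lx (B.right (MulOpposite.op a) m) = B.right (MulOpposite.op a) (lx m))
    (hrl : ∀ a m, B.left a (rx m) = rx (B.left a m))
    (hB'l : ∀ a, B'.left a = B.left (σ a)) (hB'r : B'.right = B.right)
    (n : ℕ) (f : Cochain k A M n) :
    differential B' n (skewCommutator σ δ lx rx n f)
      = skewCommutator σ δ lx rx (n + 1) (differential B n f) := by
  have h1 : ∀ g : Cochain k A M n, barCochain B' g = barCochain B g := by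
    intro g
    ext v
    obtain ⟨a, w, rfl⟩ := exists_eq_cons v
    rw [barCochain_cons, barCochain_cons, hB'r]
  have h2 : push k A lx (n + 1) (barCochain B f) = barCochain B (push k A lx n f) := by
    ext v
    obtain ⟨a, w, rfl⟩ := exists_eq_cons v
    rw [push_apply, barCochain_cons, barCochain_cons]
    exact (barSum_map _ _ lx hlr n f _).symm
  rw [differential_eq, differential_eq, h1, map_sub, skewCommutator_apply, skewCommutator_apply,
    skewCommutator_apply, skewRight_barCochain σ δ B hr, barCochain_sub, h2]
  have h3 : leftTerm B' (push k A lx n f - skewRight σ δ rx n f)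
      = push k A lx (n + 1) (leftTerm B f) - skewRight σ δ rx (n + 1) (leftTerm B f) := by
    ext v
    obtain ⟨a, w, rfl⟩ := exists_eq_cons v
    rw [sub_apply, skewRight_leftTerm σ δ B hrl]
    simp only [leftTerm_cons, push_apply, hB'l, hl, sub_apply, map_sub]
    abel
  rw [h3]

/-- `skewRight` in closed form. -/
theorem skewRight_eq (rx : Module.End k M) (n : ℕ) (f : Cochain k A M n) (v : Fin n → A) :
    skewRight σ δ rx n f v = rx (f fun i => σ (v i))
      + ∑ j : Fin n, f fun i => if i < j then σ (v i) else if i = j then δ.toLin (v i) else v i := by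
  induction n with
  | zero =>
    rw [skewRight_zero, Finset.univ_eq_empty, Finset.sum_empty, add_zero]
    congr 2
    exact Subsingleton.elim _ _
  | succ n ih =>
    obtain ⟨a, w, rfl⟩ := exists_eq_cons v
    rw [skewRight_succ, ih, Fin.sum_univ_succ]
    have h1 : (fun i => σ ((Fin.cons a w : Fin (n + 1) → A) i))
        = Fin.cons (σ a) fun i => σ (w i) := by
      funext i; refine Fin.cases rfl (fun i => rfl) i
    have h2 : (fun i : Fin (n + 1) => if i < 0 then σ ((Fin.cons a w : Fin (n + 1) → A) i)
        else if i = 0 then δ.toLin ((Fin.cons a w : Fin (n + 1) → A) i)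
        else (Fin.cons a w : Fin (n + 1) → A) i) = Fin.cons (δ.toLin a) w := by
      funext i; refine Fin.cases (by simp) (fun i => by simp) i
    have h3 : ∀ j : Fin n, (fun i : Fin (n + 1) => if i < j.succ then
          σ ((Fin.cons a w : Fin (n + 1) → A) i)
        else if i = j.succ then δ.toLin ((Fin.cons a w : Fin (n + 1) → A) i)
        else (Fin.cons a w : Fin (n + 1) → A) i) = Fin.cons (σ a)
          fun i => if i < j then σ (w i) else if i = j then δ.toLin (w i) else w i := by
      intro j
      funext i; refine Fin.cases (by simp) (fun i => by simp) i
    simp only [h1, h2, h3, MultilinearMap.curryLeft_apply]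
    abel

section Insert

variable (c : A →ₐ[k] S) (x : S)

/-- Insertion of `x` with signs at all places of a cochain; the arguments to the left of `x` are
twisted by `σ`. -/
def insertX (M : Type*) [AddCommGroup M] [Module k M] :
    (n : ℕ) → Cochain k S M (n + 1) →ₗ[k] Cochain k A M n
  | 0 =>
    { toFun f := pull M c.toLinearMap 0 (f.curryLeft x)
      map_add' _ _ := rfl
      map_smul' _ _ := rfl }
  | n + 1 =>
    { toFun f := pull M c.toLinearMap (n + 1) (f.curryLeft x)
        - LinearMap.uncurryLeft (M := fun _ : Fin (n + 1) => A)
          (insertX M n ∘ₗ f.curryLeft ∘ₗ c.toLinearMap ∘ₗ σ.toLinearMap)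
      map_add' f g := by
        ext v
        have h : (f + g).curryLeft = f.curryLeft + g.curryLeft := rfl
        simp only [h, LinearMap.uncurryLeft_apply, LinearMap.add_apply, LinearMap.comp_apply,
          map_add, add_apply, sub_apply]
        abel
      map_smul' s f := by
        ext v
        have h : (s • f).curryLeft = s • f.curryLeft := rfl
        simp only [h, LinearMap.uncurryLeft_apply, LinearMap.smul_apply,
          LinearMap.comp_apply,
          map_smul, smul_apply,
          sub_apply, smul_sub, RingHom.id_apply] }

theorem insertX_zero (f : Cochain k S M 1) (w : Fin 0 → A) :
    insertX σ c x M 0 f w = f (Fin.cons x fun i => c (w i)) := rfl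

theorem insertX_succ {n : ℕ} (f : Cochain k S M (n + 2)) (a : A) (w : Fin n → A) :
    insertX σ c x M (n + 1) f (Fin.cons a w) = f (Fin.cons x (Fin.cons (c a) fun i => c (w i)))
      - insertX σ c x M n (f.curryLeft (c (σ a))) w := by
  have h : (Fin.cons (c a) fun i => c (w i))
      = fun i => c ((Fin.cons a w : Fin (n + 1) → A) i) := by
    funext i; refine Fin.cases rfl (fun i => rfl) i
  rw [h]
  rfl

theorem curryLeft_insertX {n : ℕ} (f : Cochain k S M (n + 2)) (a : A) :
    (insertX σ c x M (n + 1) f).curryLeft a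
      = pull M c.toLinearMap n ((f.curryLeft x).curryLeft (c a))
        - insertX σ c x M n (f.curryLeft (c (σ a))) := by
  ext w
  exact insertX_succ σ c x f a w

theorem insertX_push (φ : M →ₗ[k] N) (n : ℕ) (f : Cochain k S M (n + 1)) :
    insertX σ c x N n (push k S φ (n + 1) f) = push k A φ n (insertX σ c x M n f) := by
  induction n with
  | zero => rfl
  | succ n ih =>
    ext v
    obtain ⟨a, w, rfl⟩ := exists_eq_cons v
    rw [push_apply, insertX_succ, insertX_succ, map_sub]
    have h2 := congrArg (fun F : Cochain k A N n => F w) (ih (f.curryLeft (c (σ a))))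
    exact congrArg₂ (· - ·) rfl h2

variable {c x}

theorem barCochain_pull {B' : BimoduleStr k A M} {B : BimoduleStr k S M}
    (h : ∀ a : A, B'.right (MulOpposite.op a) = B.right (MulOpposite.op (c a)))
    {n : ℕ} (f : Cochain k S M n) :
    barCochain B' (pull M c.toLinearMap n f) = pull M c.toLinearMap (n + 1) (barCochain B f) := by
  ext v
  rw [pull_apply, barCochain_apply, barCochain_apply, barSum_eq, barSum_eq]
  simp only [pull_apply, AlgHom.toLinearMap_apply, contractNth_map, h]

theorem insertX_leftTerm_zero (B : BimoduleStr k S M) (f : Cochain k S M 0) :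
    insertX σ c x M 0 (leftTerm B f) = push k A (B.left x) 0 (pull M c.toLinearMap 0 f) := rfl

/-- Only insertion in the first place lets x act on the value; every other insertion leaves σ(a) in
front. The second term is what the differential for the σ-twisted left action will cancel. -/
theorem insertX_leftTerm (B : BimoduleStr k S M) (n : ℕ) (f : Cochain k S M (n + 1)) (a : A)
    (w : Fin n → A) :
    insertX σ c x M (n + 1) (leftTerm B f) (Fin.cons a w)
      = B.left x (f (Fin.cons (c a) fun i => c (w i)))
        - B.left (c (σ a)) (insertX σ c x M n f w) := by
  rw [insertX_succ, curryLeft_leftTerm, insertX_push]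
  rfl

theorem insertX_barCochain_zero (B : BimoduleStr k S M) (f : Cochain k S M 0) :
    insertX σ c x M 0 (barCochain B f)
      = skewRight σ δ (B.right (MulOpposite.op x)) 0 (pull M c.toLinearMap 0 f) := by
  ext w
  rw [insertX_zero, barCochain_zero_cons]
  rfl

/-- Products of x with its right and left neighbours occur with opposite signs as xa and σ(a)x;
their difference is δ(a). What survives is the sum of the δ-terms and the final right multiplication
by x, while products not involving x cancel between the two summands. -/
theorem insertX_barCochain (hx : ∀ a, x * c a = c (σ a) * x + c (δ.toLin a))
    {B' : BimoduleStr k A M} {B : BimoduleStr k S M}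
    (hB : ∀ a : A, B'.right (MulOpposite.op a) = B.right (MulOpposite.op (c a)))
    (n : ℕ) (f : Cochain k S M (n + 1)) :
    insertX σ c x M (n + 1) (barCochain B f) + barCochain B' (insertX σ c x M n f)
      = skewRight σ δ (B.right (MulOpposite.op x)) (n + 1) (pull M c.toLinearMap (n + 1) f) := by
  have hadd : ∀ (m : ℕ) (g : Cochain k S M (m + 1)) (a : A) (w : Fin m → S),
      g (Fin.cons (x * c a) w) = g (Fin.cons (c (σ a) * x) w) + g (Fin.cons (c (δ.toLin a)) w) := by
    intro m g a w
    rw [hx]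
    exact MultilinearMap.cons_add g w _ _
  have hpull : ∀ (m : ℕ) (g : Cochain k S M (m + 1)) (a : A) (w : Fin m → A),
      pull M c.toLinearMap (m + 1) g (Fin.cons a w) = g (Fin.cons (c a) fun i => c (w i)) := by
    intro m g a w
    rw [pull_apply]
    congr 1
    funext i
    refine Fin.cases rfl (fun i => rfl) i
  induction n with
  | zero =>
    ext v
    obtain ⟨a, w, rfl⟩ := exists_eq_cons v
    rw [add_apply, insertX_succ, barCochain_cons_cons, curryLeft_barCochain, map_sub,
      sub_apply, insertX_barCochain_zero σ δ B (f.curryLeft (c (σ a))), insertX_zero,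
      barCochain_zero_cons, barCochain_zero_cons, insertX_zero, mulFirst_cons, hadd, skewRight_succ,
      hpull, hB]
    simp only [MultilinearMap.curryLeft_apply]
    have h : pull M c.toLinearMap 0 (f.curryLeft (c (σ a)))
        = (pull M c.toLinearMap 1 f).curryLeft (σ a) := by
      ext w
      exact (hpull 0 f (σ a) w).symm
    rw [h]
    abel
  | succ n ih =>
    ext v
    obtain ⟨a, v, rfl⟩ := exists_eq_cons v
    obtain ⟨b, w, rfl⟩ := exists_eq_cons v
    have hc : (fun i => c ((Fin.cons b w : Fin (n + 1) → A) i))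
        = Fin.cons (c b) fun i => c (w i) := by
      funext i; refine Fin.cases rfl (fun i => rfl) i
    have h1 : (mulFirst (c (σ a)) f).curryLeft (c (σ b)) = f.curryLeft (c (σ (a * b))) := by
      rw [map_mul, map_mul]; rfl
    have h2 : (pull M c.toLinearMap (n + 2) f).curryLeft (σ a)
        = pull M c.toLinearMap (n + 1) (f.curryLeft (c (σ a))) := by
      ext w
      exact hpull _ f (σ a) w
    rw [add_apply, insertX_succ, hc, barCochain_cons_cons, curryLeft_barCochain,
      map_sub, sub_apply, barCochain_cons_cons, barCochain_cons_cons, curryLeft_insertX, barCochain_sub,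
      sub_apply, skewRight_succ, hpull, h2, ← ih, hc, hadd,
      insertX_succ σ c x (mulFirst (c (σ a)) f), mulFirst_cons, h1, insertX_succ σ c x f, add_apply,
      barCochain_pull hB, hpull]
    simp only [MultilinearMap.curryLeft_apply, map_mul]
    abel

variable (B : BimoduleStr k S M) (B₁ B₂ : BimoduleStr k A M)

theorem insertX_differential_zero (f : Cochain k S M 0) :
    insertX σ c x M 0 (differential B 0 f)
      = skewCommutator σ δ (B.left x) (B.right (MulOpposite.op x)) 0
        (pull M c.toLinearMap 0 f) := by
  rw [differential_eq, map_sub, insertX_barCochain_zero σ δ, insertX_leftTerm_zero,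
    skewCommutator_apply]

/-- Insertion of x is a null-homotopy of restriction followed by the skew commutator. The pair of
restriction and insertion is thus a cochain map to the homotopy fibre of the commutator, the source
of the long exact sequence. -/
theorem insertX_differential (hx : ∀ a, x * c a = c (σ a) * x + c (δ.toLin a))
    (hl : ∀ a, B₂.left a = B.left (c (σ a)))
    (hr : ∀ a : A, B₂.right (MulOpposite.op a) = B.right (MulOpposite.op (c a)))
    (n : ℕ) (f : Cochain k S M (n + 1)) :
    insertX σ c x M (n + 1) (differential B (n + 1) f) + differential B₂ n (insertX σ c x M n f)
      = skewCommutator σ δ (B.left x) (B.right (MulOpposite.op x)) (n + 1)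
        (pull M c.toLinearMap (n + 1) f) := by
  have h : insertX σ c x M (n + 1) (leftTerm B f) + leftTerm B₂ (insertX σ c x M n f)
      = push k A (B.left x) (n + 1) (pull M c.toLinearMap (n + 1) f) := by
    ext v
    obtain ⟨a, w, rfl⟩ := exists_eq_cons v
    rw [add_apply, insertX_leftTerm, leftTerm_cons, hl, sub_add_cancel, push_apply,
      pull_apply]
    congr 2
    funext i
    refine Fin.cases rfl (fun i => rfl) i
  rw [differential_eq, map_sub, differential_eq, skewCommutator_apply,
    ← insertX_barCochain σ δ hx hr, ← h]
  abel

end Insert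

end Skew

end

end OreHochschild

namespace OreHochschild

noncomputable section

/-! ### Coinduced bimodules: embedding, cokernel and acyclicity. -/

section Coinduced

set_option linter.unusedSectionVars false

variable {k A S M N : Type*} [CommRing k] [Ring A] [Algebra k A] [Ring S] [Algebra k S]
  [AddCommGroup M] [Module k M] [AddCommGroup N] [Module k N]

/-- The quotient of a bimodule by a stable submodule. -/
def BimoduleStr.quot (B : BimoduleStr k S M) (U : Submodule k M)
    (hl : ∀ s, U ≤ U.comap (B.left s)) (hr : ∀ s, U ≤ U.comap (B.right s)) :
    BimoduleStr k S (M ⧸ U) where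
  left := AlgHom.ofLinearMap
    { toFun s := U.mapQ U (B.left s) (hl s)
      map_add' s t := Submodule.linearMap_qext _ (LinearMap.ext fun m => by simp)
      map_smul' c t := Submodule.linearMap_qext _ (LinearMap.ext fun m => by simp) }
    (Submodule.linearMap_qext _ (LinearMap.ext fun m => by simp))
    (fun s t => Submodule.linearMap_qext _ (LinearMap.ext fun m => by simp))
  right := AlgHom.ofLinearMap
    { toFun s := U.mapQ U (B.right s) (hr s)
      map_add' s t := Submodule.linearMap_qext _ (LinearMap.ext fun m => by simp)
      map_smul' c t := Submodule.linearMap_qext _ (LinearMap.ext fun m => by simp) }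
    (Submodule.linearMap_qext _ (LinearMap.ext fun m => by simp))
    (fun s t => Submodule.linearMap_qext _ (LinearMap.ext fun m => by simp))
  comm s t := Submodule.linearMap_qext _ (LinearMap.ext fun m =>
    congrArg U.mkQ (LinearMap.congr_fun (B.comm s t) m))

/-- The coinduced bimodule `Hom_k(S, M)`, with `(s · g · t)(u) = g(us) t`. -/
def coind (B : BimoduleStr k S M) : BimoduleStr k S (S →ₗ[k] M) where
  left := AlgHom.ofLinearMap
    { toFun s := LinearMap.lcomp k M (LinearMap.mulRight k s)
      map_add' s t := by ext; simp [mul_add]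
      map_smul' c t := by ext; simp }
    (by ext; simp) (fun s t => by ext; simp [mul_assoc])
  right := AlgHom.ofLinearMap
    { toFun s := LinearMap.llcomp k S M M (B.right s)
      map_add' s t := by ext; simp
      map_smul' c t := by ext; simp }
    (by ext; simp) (fun s t => by ext; simp)
  comm s t := by ext; simp [LinearMap.lcomp_apply]

theorem coind_left (B : BimoduleStr k S M) (s : S) (g : S →ₗ[k] M) (u : S) :
    (coind B).left s g u = g (u * s) := rfl

/-- The embedding `m ↦ (u ↦ u m)` of `M` in the coinduced bimodule. -/
def coindIncl (B : BimoduleStr k S M) : M →ₗ[k] (S →ₗ[k] M) := B.left.toLinearMap.flip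

theorem coindIncl_apply (B : BimoduleStr k S M) (m : M) (u : S) :
    coindIncl B m u = B.left u m := rfl

theorem coindIncl_isHom (B : BimoduleStr k S M) : B.IsHom (coind B) (coindIncl B) := by
  refine ⟨fun s m => ?_, fun s m => ?_⟩
  · ext u; simp [coindIncl_apply, coind_left]
  · ext u; exact LinearMap.congr_fun (B.comm u s) m

theorem coindIncl_injective (B : BimoduleStr k S M) : Function.Injective (coindIncl B) := by
  intro m m' h
  simpa [coindIncl_apply] using LinearMap.congr_fun h 1

/-- The cokernel of the embedding of `M` in the coinduced bimodule. -/
abbrev CoindQuot (B : BimoduleStr k S M) : Type _ :=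
  (S →ₗ[k] M) ⧸ LinearMap.range (coindIncl B)

/-- The bimodule structure of the cokernel. -/
def coindQuot (B : BimoduleStr k S M) : BimoduleStr k S (CoindQuot B) :=
  (coind B).quot (LinearMap.range (coindIncl B))
    (by rintro s _ ⟨m, rfl⟩; exact ⟨B.left s m, (coindIncl_isHom B).1 s m⟩)
    (by rintro s _ ⟨m, rfl⟩; exact ⟨B.right s m, (coindIncl_isHom B).2 s m⟩)

/-- The projection to the cokernel. -/
def coindProj (B : BimoduleStr k S M) : (S →ₗ[k] M) →ₗ[k] CoindQuot B := Submodule.mkQ _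

theorem coindProj_isHom (B : BimoduleStr k S M) :
    (coind B).IsHom (coindQuot B) (coindProj B) := ⟨fun _ _ => rfl, fun _ _ => rfl⟩

theorem push_coindProj_incl (B : BimoduleStr k S M) (n : ℕ) (f : Cochain k A M n) :
    push k A (coindProj B) n (push k A (coindIncl B) n f) = 0 := by
  ext v
  exact (Submodule.Quotient.mk_eq_zero _).2 ⟨f v, rfl⟩

/-- Evaluation at 1 is a k-linear retraction of the embedding, so the preimage can be chosen
multilinear. -/
theorem exists_push_coindIncl_eq (B : BimoduleStr k S M) (n : ℕ)
    (f : Cochain k A (S →ₗ[k] M) n) (hf : push k A (coindProj B) n f = 0) :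
    ∃ u, push k A (coindIncl B) n u = f := by
  refine ⟨push k A (LinearMap.applyₗ 1) n f, ?_⟩
  ext v : 1
  obtain ⟨m, hm⟩ := (Submodule.Quotient.mk_eq_zero _).1
    (congrArg (fun F : Cochain k A (CoindQuot B) n => F v) hf)
  change coindIncl B (f v 1) = f v
  rw [← hm, coindIncl_apply, map_one, Module.End.one_apply]

theorem push_coindProj_surjective (B : BimoduleStr k S M) (n : ℕ) :
    Function.Surjective (push k A (coindProj B) n) := by
  intro f
  -- A k-linear section of the projection: g ↦ g − (u ↦ u·g(1)) kills the image of M and does not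
  -- change the class of g.
  refine ⟨push k A (Submodule.liftQ _ (LinearMap.id - coindIncl B ∘ₗ LinearMap.applyₗ 1) ?_) n f, ?_⟩
  · rintro _ ⟨m, rfl⟩
    ext u
    simp [coindIncl_apply]
  · ext v
    simp only [push_apply]
    obtain ⟨g, hg⟩ := Submodule.mkQ_surjective _ (f v)
    rw [← hg, Submodule.mkQ_apply, Submodule.liftQ_apply]
    refine (Submodule.Quotient.eq _).2 ⟨-g 1, ?_⟩
    ext u
    simp

theorem exists_lift_coboundary (B : BimoduleStr k S M) (ν τ : A →ₐ[k] S) (n : ℕ)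
    {f : Cochain k A (CoindQuot B) n} (hf : f ∈ coboundaries ((coindQuot B).twist ν τ) n) :
    ∃ g ∈ coboundaries ((coind B).twist ν τ) n, push k A (coindProj B) n g = f := by
  cases n with
  | zero =>
    refine ⟨0, Submodule.zero_mem _, ?_⟩
    rw [map_zero]; exact hf.symm
  | succ n =>
    obtain ⟨h, rfl⟩ := hf
    obtain ⟨h, rfl⟩ := push_coindProj_surjective (A := A) B n h
    exact ⟨_, ⟨h, rfl⟩, (differential_push ((coindProj_isHom B).twist ν τ) n h).symm⟩

/-- Evaluation at `w`, with values in linear maps: the flip of a family of cochains. -/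
def flipCochain {n : ℕ} (θ : S →ₗ[k] Cochain k A M n) : Cochain k A (S →ₗ[k] M) n where
  toFun w :=
    { toFun s := θ s w
      map_add' s t := by rw [map_add]; rfl
      map_smul' c t := by rw [map_smul]; rfl }
  map_update_add' w i a b := by ext s; exact (θ s).map_update_add w i a b
  map_update_smul' w i a b := by ext s; exact (θ s).map_update_smul w i a b

theorem push_barCochain {B : BimoduleStr k A M} {B' : BimoduleStr k A N} {φ : M →ₗ[k] N}
    (h : ∀ (a : A) m, φ (B.right (MulOpposite.op a) m) = B'.right (MulOpposite.op a) (φ m))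
    {n : ℕ} (f : Cochain k A M n) :
    barCochain B' (push k A φ n f) = push k A φ (n + 1) (barCochain B f) := by
  ext v
  rw [push_apply, barCochain_apply, barCochain_apply]
  exact barSum_map _ _ φ h n f v

/-- The coinduced bimodule is acyclic if `S` is a free right `A`-module. -/
theorem coind_cocycles_le (B : BimoduleStr k S M) (ν τ : A →ₐ[k] S) (ρ : S →ₗ[k] (ℕ →₀ A))
    (b : ℕ → S) (hρ : ∀ s, ((ρ s).sum fun i a => b i * ν a) = s)
    (hρm : ∀ s a, ρ (s * ν a) = Finsupp.mapRange.linearMap (LinearMap.mulRight k a) (ρ s)) (n : ℕ) :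
    cocycles ((coind B).twist ν τ) (n + 1) ≤ coboundaries ((coind B).twist ν τ) (n + 1) := by
  intro G hG
  let ev : S → ((S →ₗ[k] M) →ₗ[k] M) := fun s => LinearMap.applyₗ s
  -- The contracting homotopy: for s = ∑ bᵢ ν(aᵢ), the primitive of G has value ∑ G(aᵢ, w)(bᵢ) at w
  -- and s.
  let Θ : (ℕ →₀ A) →ₗ[k] Cochain k A M n :=
    Finsupp.lsum k fun i => push k A (ev (b i)) n ∘ₗ
      (G.curryLeft : A →ₗ[k] Cochain k A (S →ₗ[k] M) n)
  have hev : ∀ (m : ℕ) (s : S) (g : Cochain k A (S →ₗ[k] M) m),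
      barCochain (B.twist ν τ) (push k A (ev s) m g)
        = push k A (ev s) (m + 1) (barCochain ((coind B).twist ν τ) g) := fun m s g =>
    push_barCochain (fun a m => rfl) g
  have key : ∀ (p : ℕ →₀ A) (a : A) (w : Fin n → A),
      Θ (Finsupp.mapRange.linearMap (LinearMap.mulRight k a) p) w
        - barCochain (B.twist ν τ) (Θ p) (Fin.cons a w)
      = G (Fin.cons a w) (p.sum fun i a => b i * ν a) := by
    intro p a w
    induction p using Finsupp.induction_linear with
    | zero =>
      have : barCochain (B.twist ν τ) (0 : Cochain k A M n) = 0 := by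
        simpa using barCochain_sub (B.twist ν τ) (0 : Cochain k A M n) 0
      simp [this]
    | add p q hp hq =>
      rw [map_add, map_add, map_add, barCochain_add, add_apply,
        add_apply, add_sub_add_comm, hp, hq,
        Finsupp.sum_add_index' (by simp) (by simp [mul_add]), map_add]
    | single i c =>
      have h1 : ∀ c, Θ (Finsupp.single i c) = push k A (ev (b i)) n (G.curryLeft c) := fun c => by
        simp [Θ]
      have h3 : Finsupp.mapRange.linearMap (LinearMap.mulRight k a) (Finsupp.single i c)
          = Finsupp.single i (c * a) := by simp
      -- The cocycle condition at (c, a, w), evaluated at bᵢ: the left action of c turns bᵢ into bᵢ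
      -- ν(c).
      have h4 := congrArg (fun F : Cochain k A (S →ₗ[k] M) (n + 2) =>
        F (Fin.cons c (Fin.cons a w))) (mem_cocycles.1 hG)
      have h5 := LinearMap.congr_fun h4 (b i)
      rw [differential_eq] at h5
      simp only [sub_apply, leftTerm_cons, barCochain_cons_cons] at h5
      rw [h3, h1, h1, hev, Finsupp.sum_single_index (by simp)]
      change G (Fin.cons (c * a) w) (b i)
        - barCochain ((coind B).twist ν τ) (G.curryLeft c) (Fin.cons a w) (b i) = _
      exact (sub_eq_zero.1 h5).symm
  refine ⟨flipCochain (Θ ∘ₗ ρ), ?_⟩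
  ext v s
  obtain ⟨a, w, rfl⟩ := exists_eq_cons v
  have h1 : push k A (ev s) n (flipCochain (Θ ∘ₗ ρ)) = Θ (ρ s) := rfl
  have h2 := hev n s (flipCochain (Θ ∘ₗ ρ))
  rw [h1] at h2
  have h3 := key (ρ s) a w
  rw [hρ, ← hρm, h2] at h3
  rw [← h3, differential_eq]
  rfl

theorem coind_cocycles_le_self (B : BimoduleStr k S M) (n : ℕ) :
    cocycles (coind B) (n + 1) ≤ coboundaries (coind B) (n + 1) :=
  coind_cocycles_le B (AlgHom.id k S) (AlgHom.id k S) (Finsupp.lsingle 0) (fun _ => 1)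
    (fun s => by simp) (fun s a => by simp) n

end Coinduced

/-! ### Ore extensions with coefficients written on the right. -/

namespace OreExtension

universe u v

variable {k : Type u} {A : Type v} [CommRing k] [Ring A] [Algebra k A] (σ : A ≃ₐ[k] A)
  (δ : SkewDerivation σ)

theorem induction_left {p : OreExtension σ δ → Prop} (hadd : ∀ e e', p e → p e' → p (e + e'))
    (h : ∀ a i, p (C σ δ a * X σ δ ^ i)) (e : OreExtension σ δ) : p e := by
  refine Finsupp.induction_linear (motive := p) e ?_ hadd fun i a => ?_
  · have := h 0 0
    rwa [map_zero, zero_mul] at this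
  · have := h a i
    rwa [C_mul_X_pow] at this

/-- Right multiplication by `x` in terms of the coefficients on the right. -/
def rightMulX : Module.End k (ℕ →₀ A) :=
  Finsupp.lsum k fun j =>
    Finsupp.lsingle (j + 1) ∘ₗ σ.symm.toLinearMap - Finsupp.lsingle j ∘ₗ deltaSigmaInv σ δ

theorem rightMulX_single (j : ℕ) (b : A) : rightMulX σ δ (Finsupp.single j b)
    = Finsupp.single (j + 1) (σ.symm b) - Finsupp.single j (δ.toLin (σ.symm b)) := by
  simp [rightMulX, deltaSigmaInv]

/-- The coefficients `bⱼ` of `∑ xʲ bⱼ`. -/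
def rightCoeff : OreExtension σ δ →ₗ[k] (ℕ →₀ A) :=
  (Finsupp.lsum k fun n => (rightMulX σ δ ^ n) ∘ₗ Finsupp.lsingle 0 :
    (ℕ →₀ A) →ₗ[k] (ℕ →₀ A))

/-- The element `∑ xʲ bⱼ`. -/
def ofRightCoeff : (ℕ →₀ A) →ₗ[k] OreExtension σ δ :=
  Finsupp.lsum k fun j => LinearMap.mulLeft k (X σ δ ^ j) ∘ₗ (C σ δ).toLinearMap

theorem ofRightCoeff_single (j : ℕ) (b : A) :
    ofRightCoeff σ δ (Finsupp.single j b) = X σ δ ^ j * C σ δ b := by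
  simp [ofRightCoeff]

theorem C_mul_X (a : A) : C σ δ a * X σ δ
    = X σ δ * C σ δ (σ.symm a) - C σ δ (δ.toLin (σ.symm a)) := by
  rw [X_mul_C, add_sub_cancel_right, AlgEquiv.apply_symm_apply]

theorem ofRightCoeff_rightMulX (q : ℕ →₀ A) :
    ofRightCoeff σ δ (rightMulX σ δ q) = ofRightCoeff σ δ q * X σ δ := by
  induction q using Finsupp.induction_linear with
  | zero => simp
  | add p q hp hq => rw [map_add, map_add, map_add, hp, hq, add_mul]
  | single j b =>
    rw [rightMulX_single, map_sub, ofRightCoeff_single, ofRightCoeff_single, ofRightCoeff_single,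
      mul_assoc, C_mul_X, mul_sub, pow_succ, mul_assoc]

theorem rightCoeff_C_mul_X_pow (a : A) (i : ℕ) :
    rightCoeff σ δ (C σ δ a * X σ δ ^ i) = (rightMulX σ δ ^ i) (Finsupp.single 0 a) := by
  rw [C_mul_X_pow]
  exact Finsupp.lsum_single k (fun n => (rightMulX σ δ ^ n) ∘ₗ Finsupp.lsingle 0) i a

theorem ofRightCoeff_rightCoeff (e : OreExtension σ δ) :
    ofRightCoeff σ δ (rightCoeff σ δ e) = e := by
  induction e using induction_left with
  | hadd e e' h h' => rw [map_add, map_add, h, h']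
  | h a i =>
    rw [rightCoeff_C_mul_X_pow]
    induction i with
    | zero => simp [ofRightCoeff_single]
    | succ i ih => rw [pow_succ', Module.End.mul_apply, ofRightCoeff_rightMulX, ih, mul_assoc,
        ← pow_succ]

theorem induction_right {p : OreExtension σ δ → Prop} (hadd : ∀ e e', p e → p e' → p (e + e'))
    (h : ∀ b j, p (X σ δ ^ j * C σ δ b)) (e : OreExtension σ δ) : p e := by
  rw [← ofRightCoeff_rightCoeff σ δ e]
  induction rightCoeff σ δ e using Finsupp.induction_linear with
  | zero =>
    have := h 0 0
    rwa [map_zero, mul_zero] at this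
  | add q q' hq hq' => rw [map_add]; exact hadd _ _ hq hq'
  | single j b => rw [ofRightCoeff_single]; exact h b j

theorem rightCoeff_mul_X (e : OreExtension σ δ) :
    rightCoeff σ δ (e * X σ δ) = rightMulX σ δ (rightCoeff σ δ e) := by
  induction e using induction_left with
  | hadd e e' h h' => rw [add_mul, map_add, map_add, map_add, h, h']
  | h a i =>
    rw [mul_assoc, ← pow_succ, rightCoeff_C_mul_X_pow, rightCoeff_C_mul_X_pow, pow_succ',
      Module.End.mul_apply]

theorem rightCoeff_C (a : A) : rightCoeff σ δ (C σ δ a) = Finsupp.single 0 a := by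
  simpa using rightCoeff_C_mul_X_pow σ δ a 0

/-- Left multiplication by x should shift right coefficients. The shift commutes with the operator
of right multiplication by x, so it is enough to check this on A, where it is the relation xa =
σ(a)x + δ(a). -/
theorem rightCoeff_X_mul (e : OreExtension σ δ) :
    rightCoeff σ δ (X σ δ * e) = Finsupp.lmapDomain A k Nat.succ (rightCoeff σ δ e) := by
  have hcomm : ∀ q, Finsupp.lmapDomain A k Nat.succ (rightMulX σ δ q)
      = rightMulX σ δ (Finsupp.lmapDomain A k Nat.succ q) := by
    intro q
    induction q using Finsupp.induction_linear with
    | zero => simp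
    | add p q hp hq => simp only [map_add, hp, hq]
    | single j b =>
      rw [rightMulX_single, map_sub]
      simp only [Finsupp.lmapDomain_apply, Finsupp.mapDomain_single, rightMulX_single]
  induction e using induction_left with
  | hadd e e' h h' => rw [mul_add, map_add, map_add, map_add, h, h']
  | h a i =>
    induction i with
    | zero =>
      rw [pow_zero, mul_one, X_mul_C, map_add, rightCoeff_mul_X, rightCoeff_C, rightCoeff_C,
        rightCoeff_C, rightMulX_single]
      simp
    | succ i ih =>
      rw [pow_succ, ← mul_assoc, ← mul_assoc, mul_assoc (X σ δ), rightCoeff_mul_X, ih, ← hcomm,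
        ← rightCoeff_mul_X, mul_assoc]

/-- Together with `ofRightCoeff_rightCoeff` this shows that the powers of x are also a basis of E as
a right A-module. -/
theorem rightCoeff_X_pow_mul_C (j : ℕ) (b : A) :
    rightCoeff σ δ (X σ δ ^ j * C σ δ b) = Finsupp.single j b := by
  induction j with
  | zero => rw [pow_zero, one_mul, rightCoeff_C]
  | succ j ih =>
    rw [pow_succ', mul_assoc, rightCoeff_X_mul, ih, Finsupp.lmapDomain_apply,
      Finsupp.mapDomain_single]

theorem rightCoeff_mul_C (e : OreExtension σ δ) (a : A) :
    rightCoeff σ δ (e * C σ δ a)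
      = Finsupp.mapRange.linearMap (LinearMap.mulRight k a) (rightCoeff σ δ e) := by
  induction e using induction_right with
  | hadd e e' h h' => rw [add_mul, map_add, map_add, map_add, h, h']
  | h b j =>
    rw [mul_assoc, ← map_mul, rightCoeff_X_pow_mul_C, rightCoeff_X_pow_mul_C]
    simp

end OreExtension

end

end OreHochschild

namespace OreHochschild

noncomputable section

namespace OreExtension

/-! ### The long exact sequence comparing E with A, by dimension shifting. -/

section Comparison

set_option linter.unusedSectionVars false

universe u v

variable {k : Type u} {A : Type v} [CommRing k] [Ring A] [Algebra k A] {σ : A ≃ₐ[k] A}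
  {δ : SkewDerivation σ}
  {M N : Type*} [AddCommGroup M] [Module k M] [AddCommGroup N] [Module k N]

/-- The restriction of an `A[x; σ, δ]`-bimodule to `A`. -/
def res (B : BimoduleStr k (OreExtension σ δ) M) : BimoduleStr k A M :=
  B.twist (C σ δ) (C σ δ)

/-- The restriction of an `A[x; σ, δ]`-bimodule to `A`, with the left action twisted by `σ`. -/
def resTwist (B : BimoduleStr k (OreExtension σ δ) M) : BimoduleStr k A M :=
  B.twist ((C σ δ).comp (σ : A →ₐ[k] A)) (C σ δ)

theorem isHom_res {B : BimoduleStr k (OreExtension σ δ) M}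
    {B' : BimoduleStr k (OreExtension σ δ) N} {φ : M →ₗ[k] N} (h : B.IsHom B' φ) :
    (res B).IsHom (res B') φ := h.twist _ _

theorem isHom_resTwist {B : BimoduleStr k (OreExtension σ δ) M}
    {B' : BimoduleStr k (OreExtension σ δ) N} {φ : M →ₗ[k] N} (h : B.IsHom B' φ) :
    (resTwist B).IsHom (resTwist B') φ := h.twist _ _

/-- Restriction of cochains to `A`. -/
abbrev pullC (σ : A ≃ₐ[k] A) (δ : SkewDerivation σ) (M : Type*) [AddCommGroup M] [Module k M]
    (n : ℕ) : Cochain k (OreExtension σ δ) M n →ₗ[k] Cochain k A M n :=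
  pull M (C σ δ).toLinearMap n

/-- Insertion of `x` in a cochain of `A[x; σ, δ]`, followed by restriction to `A`. -/
abbrev insertC (σ : A ≃ₐ[k] A) (δ : SkewDerivation σ) (M : Type*) [AddCommGroup M] [Module k M]
    (n : ℕ) : Cochain k (OreExtension σ δ) M (n + 1) →ₗ[k] Cochain k A M n :=
  insertX σ (C σ δ) (X σ δ) M n

/-- The skew commutator with `x`, for coefficients in an `A[x; σ, δ]`-bimodule. -/
def commX (B : BimoduleStr k (OreExtension σ δ) M) (n : ℕ) :
    Cochain k A M n →ₗ[k] Cochain k A M n :=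
  skewCommutator σ δ (B.left (X σ δ)) (B.right (MulOpposite.op (X σ δ))) n

/-- All hypotheses of the general statement reduce to the relation xa = σ(a)x + δ(a), read through
the left and the right action, and to the commutation of the two actions. -/
theorem differential_commX (B : BimoduleStr k (OreExtension σ δ) M) (n : ℕ)
    (f : Cochain k A M n) :
    differential (resTwist B) n (commX B n f) = commX B (n + 1) (differential (res B) n f) := by
  refine differential_skewCommutator σ δ (res B) (resTwist B) (fun a m => ?_) (fun a m => ?_)
    (fun a m => ?_) (fun a m => ?_) (fun a => rfl) rfl n f
  · change B.left _ (B.left (C σ δ a) m)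
      = B.left (C σ δ (σ a)) (B.left _ m) + B.left (C σ δ (δ.toLin a)) m
    rw [← Module.End.mul_apply, ← map_mul, X_mul_C, map_add, map_mul]
    rfl
  · change B.right (MulOpposite.op (C σ δ a)) (B.right _ m)
      = B.right _ (B.right (MulOpposite.op (C σ δ (σ a))) m)
        + B.right (MulOpposite.op (C σ δ (δ.toLin a))) m
    rw [← Module.End.mul_apply, ← map_mul, ← MulOpposite.op_mul, X_mul_C, MulOpposite.op_add,
      map_add, MulOpposite.op_mul, map_mul]
    rfl
  · exact LinearMap.congr_fun (B.comm _ _) m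
  · exact LinearMap.congr_fun (B.comm _ _) m

theorem commX_mem_cocycles (B : BimoduleStr k (OreExtension σ δ) M) {n : ℕ}
    {f : Cochain k A M n} (hf : f ∈ cocycles (res B) n) :
    commX B n f ∈ cocycles (resTwist B) n := by
  rw [mem_cocycles, differential_commX, mem_cocycles.1 hf, map_zero]

theorem commX_mem_coboundaries (B : BimoduleStr k (OreExtension σ δ) M) {n : ℕ}
    {f : Cochain k A M n} (hf : f ∈ coboundaries (res B) n) :
    commX B n f ∈ coboundaries (resTwist B) n := by
  cases n with
  | zero =>
    rw [coboundaries, Submodule.mem_bot] at hf ⊢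
    rw [hf, map_zero]
  | succ n =>
    obtain ⟨g, rfl⟩ := hf
    exact ⟨_, differential_commX B n g⟩

theorem commX_push {B : BimoduleStr k (OreExtension σ δ) M}
    {B' : BimoduleStr k (OreExtension σ δ) N} {φ : M →ₗ[k] N} (h : B.IsHom B' φ) (n : ℕ)
    (f : Cochain k A M n) : commX B' n (push k A φ n f) = push k A φ n (commX B n f) := by
  rw [commX, commX, skewCommutator_apply, skewCommutator_apply, map_sub,
    skewRight_push σ δ (h.2 _)]
  congr 1
  ext v
  exact (h.1 _ _).symm

theorem insertC_differential_zero (B : BimoduleStr k (OreExtension σ δ) M)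
    (f : Cochain k (OreExtension σ δ) M 0) :
    insertC σ δ M 0 (differential B 0 f) = commX B 0 (pullC σ δ M 0 f) :=
  insertX_differential_zero σ δ B f

theorem insertC_differential (B : BimoduleStr k (OreExtension σ δ) M) (n : ℕ)
    (f : Cochain k (OreExtension σ δ) M (n + 1)) :
    insertC σ δ M (n + 1) (differential B (n + 1) f)
      + differential (resTwist B) n (insertC σ δ M n f) = commX B (n + 1) (pullC σ δ M (n + 1) f) :=
  insertX_differential σ δ B (resTwist B) (X_mul_C σ δ) (fun _ => rfl) (fun _ => rfl) n f

theorem differential_pullC (B : BimoduleStr k (OreExtension σ δ) M) (n : ℕ)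
    (f : Cochain k (OreExtension σ δ) M n) :
    differential (res B) n (pullC σ δ M n f) = pullC σ δ M (n + 1) (differential B n f) :=
  differential_pull (B := B) ⟨fun _ => rfl, fun _ => rfl⟩ n f

theorem pullC_push (φ : M →ₗ[k] N) (n : ℕ) (f : Cochain k (OreExtension σ δ) M n) :
    pullC σ δ N n (push k _ φ n f) = push k A φ n (pullC σ δ M n f) := rfl

theorem pullC_zero_surjective : Function.Surjective (pullC σ δ M 0) := by
  intro f
  refine ⟨MultilinearMap.constOfIsEmpty k (fun _ : Fin 0 => OreExtension σ δ) (f Fin.elim0), ?_⟩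
  ext w
  rw [Subsingleton.elim w Fin.elim0]
  rfl

theorem mem_cocycles_zero {S : Type*} [Ring S] [Algebra k S] {B : BimoduleStr k S M}
    {f : Cochain k S M 0} : f ∈ cocycles B 0 ↔
      ∀ a, B.left a (f Fin.elim0) = B.right (MulOpposite.op a) (f Fin.elim0) := by
  have h : ∀ (a : S) (w : Fin 0 → S), differential B 0 f (Fin.cons a w)
      = B.left a (f Fin.elim0) - B.right (MulOpposite.op a) (f Fin.elim0) := by
    intro a w
    rw [Subsingleton.elim w Fin.elim0, differential_cons, barSum_zero]
  rw [mem_cocycles]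
  constructor
  · intro hf a
    rw [← sub_eq_zero, ← h a Fin.elim0, hf, zero_apply]
  · intro hf
    ext v
    obtain ⟨a, w, rfl⟩ := exists_eq_cons v
    rw [h, hf, sub_self, zero_apply]

/-- An element which commutes with `A` and with `x` is central. -/
theorem mem_cocycles_zero_of_pullC (B : BimoduleStr k (OreExtension σ δ) M)
    {f : Cochain k (OreExtension σ δ) M 0} (h1 : pullC σ δ M 0 f ∈ cocycles (res B) 0)
    (h2 : commX B 0 (pullC σ δ M 0 f) = 0) : f ∈ cocycles B 0 := by
  rw [mem_cocycles_zero] at h1 ⊢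
  set m := f Fin.elim0 with hm
  have hpull : pullC σ δ M 0 f Fin.elim0 = m := by
    rw [pull_apply]; congr 1; exact Subsingleton.elim _ _
  rw [hpull] at h1
  have hX : B.left (X σ δ) m = B.right (MulOpposite.op (X σ δ)) m := by
    have := congrArg (fun F : Cochain k A M 0 => F Fin.elim0) h2
    simpa [commX, skewCommutator_apply, skewRight_zero, hpull, sub_eq_zero] using this
  have hmul : ∀ s t, B.left s m = B.right (MulOpposite.op s) m →
      B.left t m = B.right (MulOpposite.op t) m →
      B.left (s * t) m = B.right (MulOpposite.op (s * t)) m := by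
    intro s t hs ht
    have := LinearMap.congr_fun (B.comm s (MulOpposite.op t)) m
    rw [map_mul, Module.End.mul_apply, ht, MulOpposite.op_mul, map_mul, Module.End.mul_apply, ← hs]
    exact this
  intro e
  induction e using induction_left with
  | hadd e e' h h' =>
    rw [map_add, MulOpposite.op_add, map_add, LinearMap.add_apply, LinearMap.add_apply, h, h']
  | h a i =>
    refine hmul _ _ (h1 a) ?_
    induction i with
    | zero => rw [pow_zero, MulOpposite.op_one, map_one, map_one]
    | succ i ih => exact hmul _ _ ih hX

theorem rightCoeff_sum (e : OreExtension σ δ) :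
    ((rightCoeff σ δ e).sum fun i a => X σ δ ^ i * C σ δ a) = e := by
  conv_rhs => rw [← ofRightCoeff_rightCoeff σ δ e]
  rw [ofRightCoeff, Finsupp.lsum_apply]
  rfl

theorem res_coind_cocycles_le (B : BimoduleStr k (OreExtension σ δ) M) (n : ℕ) :
    cocycles (res (coind B)) (n + 1) ≤ coboundaries (res (coind B)) (n + 1) :=
  coind_cocycles_le B (C σ δ) (C σ δ) (rightCoeff σ δ) (fun i => X σ δ ^ i) rightCoeff_sum
    (rightCoeff_mul_C σ δ) n

/-- E is also free over A when a acts by right multiplication by σ(a); the coefficients are the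
right coefficients corrected by σ⁻¹. -/
theorem resTwist_coind_cocycles_le (B : BimoduleStr k (OreExtension σ δ) M) (n : ℕ) :
    cocycles (resTwist (coind B)) (n + 1) ≤ coboundaries (resTwist (coind B)) (n + 1) := by
  refine coind_cocycles_le B ((C σ δ).comp (σ : A →ₐ[k] A)) (C σ δ)
    (Finsupp.mapRange.linearMap σ.symm.toLinearMap ∘ₗ rightCoeff σ δ) (fun i => X σ δ ^ i)
    (fun e => ?_) (fun e a => ?_) n
  · conv_rhs => rw [← rightCoeff_sum e]
    rw [LinearMap.comp_apply, Finsupp.mapRange.linearMap_apply, Finsupp.sum_mapRange_index]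
    · simp
    · simp
  · rw [LinearMap.comp_apply, AlgHom.comp_apply, rightCoeff_mul_C]
    ext i
    simp

/-- Up to coboundaries, the skew commutator is surjective on cocycles with coefficients in a
coinduced bimodule. -/
theorem exists_commX_coind (B : BimoduleStr k (OreExtension σ δ) M) (n : ℕ)
    {y : Cochain k A (OreExtension σ δ →ₗ[k] M) n} (hy : y ∈ cocycles (resTwist (coind B)) n) :
    ∃ z ∈ cocycles (res (coind B)) n,
      y - commX (coind B) n z ∈ coboundaries (resTwist (coind B)) n := by
  cases n with
  | succ n =>
    -- In positive degrees acyclicity already makes y a coboundary; only degree 0 has content.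
    exact ⟨0, Submodule.zero_mem _, by
      rw [map_zero, sub_zero]; exact resTwist_coind_cocycles_le B n hy⟩
  | zero =>
    rw [mem_cocycles_zero] at hy
    have hy' : ∀ (a : A) (e : OreExtension σ δ), y Fin.elim0 (e * C σ δ (σ a))
        = B.right (MulOpposite.op (C σ δ a)) (y Fin.elim0 e) := fun a e =>
      LinearMap.congr_fun (hy a) e
    -- The equation z(ex) − z(e)x = y(e) is to be solved with z right A-linear. Such a z is
    -- determined by mⱼ = z(x^j), and taking e = x^j forces this recursion; m₀ = 0 is a free choice.
    let m : ℕ → M := Nat.rec 0 fun j mj =>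
      B.right (MulOpposite.op (X σ δ)) mj + y Fin.elim0 (X σ δ ^ j)
    have hm : ∀ j, m (j + 1) = B.right (MulOpposite.op (X σ δ)) (m j)
      + y Fin.elim0 (X σ δ ^ j) := fun _ => rfl
    let r : A → Module.End k M := fun a => B.right (MulOpposite.op (C σ δ a))
    let z : OreExtension σ δ →ₗ[k] M := (Finsupp.lsum k fun j =>
      { toFun a := r a (m j)
        map_add' a b := by simp [r]
        map_smul' c a := by simp [r] }) ∘ₗ rightCoeff σ δ
    have hz : ∀ j b, z (X σ δ ^ j * C σ δ b) = r b (m j) := by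
      intro j b
      change Finsupp.lsum k _ (rightCoeff σ δ _) = _
      rw [rightCoeff_X_pow_mul_C, Finsupp.lsum_single]
      rfl
    refine ⟨MultilinearMap.constOfIsEmpty k (fun _ : Fin 0 => A) z, ?_, ?_⟩
    · rw [mem_cocycles_zero]
      intro a
      ext e
      change z (e * C σ δ a) = r a (z e)
      induction e using induction_right with
      | hadd e e' h h' => rw [add_mul, map_add, map_add, map_add, h, h']
      | h b j =>
        rw [mul_assoc, ← map_mul, hz, hz]
        simp [r]
    · rw [coboundaries, Submodule.mem_bot, sub_eq_zero]
      ext w e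
      rw [Subsingleton.elim w Fin.elim0]
      change y Fin.elim0 e = z (e * X σ δ) - B.right (MulOpposite.op (X σ δ)) (z e)
      induction e using induction_right with
      | hadd e e' h h' =>
        rw [add_mul, map_add, map_add, map_add, map_add, h, h', add_sub_add_comm]
      | h b j =>
        have h1 := hy' (σ.symm b) (X σ δ ^ j)
        rw [AlgEquiv.apply_symm_apply] at h1
        have h2 : B.right (MulOpposite.op (C σ δ (σ.symm b)))
              (B.right (MulOpposite.op (X σ δ)) (m j))
            = B.right (MulOpposite.op (X σ δ)) (r b (m j)) + r (δ.toLin (σ.symm b)) (m j) := by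
          rw [← Module.End.mul_apply, ← map_mul, ← MulOpposite.op_mul, X_mul_C,
            AlgEquiv.apply_symm_apply, MulOpposite.op_add, MulOpposite.op_mul, map_add, map_mul]
          rfl
        rw [h1, mul_assoc, C_mul_X, mul_sub, ← mul_assoc, ← pow_succ, map_sub, hz, hz, hz, hm]
        simp only [r] at h2 ⊢
        rw [map_add, h2]
        abel

/-- Injectivity in the long exact sequence which relates the Hochschild cohomology of `A[x; σ, δ]`
to that of `A`. -/
theorem mem_coboundaries_of_insertC (n : ℕ) : ∀ (M : Type v) [AddCommGroup M] [Module k M]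
    (B : BimoduleStr k (OreExtension σ δ) M) (F : Cochain k (OreExtension σ δ) M (n + 1))
    (_ : F ∈ cocycles B (n + 1)) (g : Cochain k A M n)
    (_ : pullC σ δ M (n + 1) F = differential (res B) n g)
    (_ : insertC σ δ M n F - commX B n g ∈ coboundaries (resTwist B) n),
    F ∈ coboundaries B (n + 1) := by
  induction n with
  | zero =>
    intro M _ _ B F hF g h1 h2
    rw [coboundaries, Submodule.mem_bot, sub_eq_zero] at h2
    obtain ⟨g, rfl⟩ := pullC_zero_surjective (σ := σ) (δ := δ) g
    obtain ⟨G, hG⟩ := coind_cocycles_le_self B 0 (push_mem_cocycles (coindIncl_isHom B) hF)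
    -- The two hypotheses say that G and g have the same commutators with A and with x, and these
    -- generate E.
    have hGg : G - push k _ (coindIncl B) 0 g ∈ cocycles (coind B) 0 := by
      refine mem_cocycles_zero_of_pullC _ ?_ ?_
      · rw [mem_cocycles, differential_pullC, map_sub, hG, differential_push (coindIncl_isHom B),
          map_sub, pullC_push, pullC_push, h1, differential_pullC, sub_self]
      · rw [← insertC_differential_zero, map_sub, hG, differential_push (coindIncl_isHom B),
          map_sub, insertX_push, insertX_push, h2, insertC_differential_zero, sub_self]
    refine ⟨g, push_injective _ (coindIncl_injective B) _ ?_⟩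
    rw [← differential_push (coindIncl_isHom B), ← hG]
    rw [mem_cocycles, map_sub, sub_eq_zero] at hGg
    exact hGg.symm
  | succ n ih =>
    intro M _ _ B F hF g h1 ⟨h, h2⟩
    have hι := coindIncl_isHom B
    have hπ := coindProj_isHom B
    obtain ⟨G, hG⟩ := coind_cocycles_le_self B (n + 1) (push_mem_cocycles hι hF)
    have e1 : pullC σ δ _ (n + 1) G - push k A (coindIncl B) (n + 1) g
        ∈ cocycles (res (coind B)) (n + 1) := by
      rw [mem_cocycles, map_sub, differential_pullC, hG, pullC_push, h1,
        differential_push (isHom_res hι), sub_self]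
    -- The restriction of G has two trivialisations to compare: their difference is the differential
    -- of p, which serves as trivialisation in the cokernel, one degree lower.
    obtain ⟨p, hp⟩ := res_coind_cocycles_le B n e1
    have e2 := insertC_differential (coind B) n G
    rw [hG, insertX_push] at e2
    have e3 : push k A (coindIncl B) n h + insertC σ δ _ n G - commX (coind B) n p
        ∈ cocycles (resTwist (coind B)) n := by
      rw [mem_cocycles, map_sub, map_add, differential_commX, hp, differential_push (isHom_resTwist hι),
        map_sub, commX_push hι, ← e2, h2, map_sub]
      abel
    -- The remaining obstruction is a twisted cocycle; replacing p by p + z removes it up to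
    -- coboundaries.
    obtain ⟨z, hz, hz2⟩ := exists_commX_coind B n e3
    have e4 : push k _ (coindProj B) (n + 1) G ∈ coboundaries (coindQuot B) (n + 1) := by
      refine ih _ (coindQuot B) _ ?_ (push k A (coindProj B) n (p + z)) ?_ ?_
      · rw [mem_cocycles, differential_push hπ, hG, push_coindProj_incl]
      · have := congrArg (push k A (coindProj B) (n + 1)) hp
        rw [map_sub, push_coindProj_incl, sub_zero] at this
        rw [pullC_push, ← this]
        rw [differential_push (isHom_res hπ), map_add, mem_cocycles.1 hz, add_zero]
      · have := push_mem_coboundaries (isHom_resTwist hπ) hz2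
        rw [map_sub, map_sub, map_add, push_coindProj_incl, zero_add] at this
        rw [insertX_push, commX_push hπ, map_add, map_add, ← sub_sub]
        exact this
    obtain ⟨H, hH⟩ := e4
    obtain ⟨H, rfl⟩ := push_coindProj_surjective B _ H
    -- G is corrected by a coboundary so as to take values in M itself; the differential is
    -- unchanged, so the result is a primitive of F.
    have e5 : push k _ (coindProj B) (n + 1) (G - differential (coind B) n H) = 0 := by
      rw [map_sub, ← hH, differential_push hπ, sub_self]
    obtain ⟨u, hu⟩ := exists_push_coindIncl_eq B _ _ e5
    refine ⟨u, push_injective _ (coindIncl_injective B) _ ?_⟩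
    rw [← differential_push hι, hu, map_sub, hG, differential_differential, sub_zero]

/-- Surjectivity in the long exact sequence which relates the Hochschild cohomology of
`A[x; σ, δ]` to that of `A`. -/
theorem exists_insertC (n : ℕ) : ∀ (M : Type v) [AddCommGroup M] [Module k M]
    (B : BimoduleStr k (OreExtension σ δ) M) (y : Cochain k A M n)
    (_ : y ∈ cocycles (resTwist B) n),
    ∃ F ∈ cocycles B (n + 1), ∃ g : Cochain k A M n,
      pullC σ δ M (n + 1) F = differential (res B) n g ∧
      insertC σ δ M n F - commX B n g - y ∈ coboundaries (resTwist B) n := by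
  induction n with
  | zero =>
    intro M _ _ B y hy
    have hι := coindIncl_isHom B
    have hπ := coindProj_isHom B
    obtain ⟨z, hz, hz2⟩ := exists_commX_coind B 0 (push_mem_cocycles (isHom_resTwist hι) hy)
    rw [coboundaries, Submodule.mem_bot, sub_eq_zero] at hz2
    obtain ⟨z, rfl⟩ := pullC_zero_surjective (σ := σ) (δ := δ) z
    -- In the cokernel z commutes with A and, as its commutator with x comes from M, with x. So it
    -- is central for E and its differential takes values in M.
    have e1 : push k _ (coindProj B) 0 z ∈ cocycles (coindQuot B) 0 := by
      refine mem_cocycles_zero_of_pullC _ ?_ ?_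
      · rw [pullC_push]
        exact push_mem_cocycles (isHom_res hπ) hz
      · rw [pullC_push, commX_push hπ, ← hz2, push_coindProj_incl]
    have e2 : push k _ (coindProj B) 1 (differential (coind B) 0 z) = 0 := by
      rw [← differential_push hπ]; exact e1
    obtain ⟨F, hF⟩ := exists_push_coindIncl_eq B _ _ e2
    -- Since z itself commutes with A, the restriction of F to A is zero and the trivialisation can
    -- be taken to be 0.
    refine ⟨F, ?_, 0, ?_, ?_⟩
    · refine push_injective _ (coindIncl_injective B) _ ?_
      rw [← differential_push hι, hF, differential_differential, map_zero]
    · refine push_injective _ (coindIncl_injective B) _ ?_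
      rw [← pullC_push, hF, ← differential_pullC, map_zero, map_zero]
      exact hz
    · rw [coboundaries, Submodule.mem_bot, map_zero, sub_zero, sub_eq_zero]
      refine push_injective _ (coindIncl_injective B) _ ?_
      rw [← insertX_push, hF, insertC_differential_zero, hz2]
  | succ n ih =>
    intro M _ _ B y hy
    have hι := coindIncl_isHom B
    have hπ := coindProj_isHom B
    obtain ⟨Y, hY⟩ := resTwist_coind_cocycles_le B n (push_mem_cocycles (isHom_resTwist hι) hy)
    -- The sign compensates for the one in the homotopy formula, in which `insertC` anticommutes
    -- with the differentials up to the commutator term.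
    have e1 : push k A (coindProj B) n (-Y) ∈ cocycles (resTwist (coindQuot B)) n := by
      rw [mem_cocycles, differential_push (isHom_resTwist hπ), map_neg, hY, map_neg,
        push_coindProj_incl, neg_zero]
    obtain ⟨F, hF, g, h1, h2⟩ := ih _ (coindQuot B) _ e1
    obtain ⟨F, rfl⟩ := push_coindProj_surjective B _ F
    obtain ⟨g, rfl⟩ := push_coindProj_surjective (A := A) B _ g
    obtain ⟨b, hb, hb2⟩ := exists_lift_coboundary B _ _ n h2
    have hb' := coboundaries_le_cocycles (resTwist (coind B)) _ hb
    have e2 : push k A (coindProj B) (n + 1)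
        (pullC σ δ _ (n + 1) F - differential (res (coind B)) n g) = 0 := by
      rw [map_sub, ← pullC_push, h1, differential_push (isHom_res hπ), sub_self]
    obtain ⟨u, hu⟩ := exists_push_coindIncl_eq B _ _ e2
    have e3 : push k A (coindProj B) n
        (insertC σ δ _ n F - commX (coind B) n g + Y - b) = 0 := by
      rw [map_sub, hb2, map_add, map_sub, ← insertX_push, ← commX_push hπ, map_neg]
      abel
    obtain ⟨w, hw⟩ := exists_push_coindIncl_eq B _ _ e3
    have e4 : push k _ (coindProj B) (n + 2) (differential (coind B) (n + 1) F) = 0 := by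
      rw [← differential_push hπ]; exact hF
    -- The connecting homomorphism: the differential of a lift of the cocycle found in the cokernel
    -- has values in M. The cochains u and w record the same for the trivialisation and for the
    -- comparison with y.
    obtain ⟨F', hF'⟩ := exists_push_coindIncl_eq B _ _ e4
    refine ⟨F', ?_, u, ?_, ?_⟩
    · refine push_injective _ (coindIncl_injective B) _ ?_
      rw [← differential_push hι, hF', differential_differential, map_zero]
    · refine push_injective _ (coindIncl_injective B) _ ?_
      rw [← pullC_push, hF', ← differential_pullC, ← differential_push (isHom_res hι), hu, map_sub,
        differential_differential, sub_zero]
    · refine ⟨-w, push_injective _ (coindIncl_injective B) _ ?_⟩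
      rw [← differential_push (isHom_resTwist hι)]
      have e5 := insertC_differential (coind B) n F
      rw [← eq_sub_iff_add_eq, ← hF', insertX_push] at e5
      have e6 := congrArg (commX (coind B) (n + 1)) hu
      rw [commX_push hι, map_sub] at e6
      have e7 := congrArg (differential (resTwist (coind B)) n) hw
      rw [map_sub, mem_cocycles.1 hb', map_add, map_sub, hY, differential_commX, sub_zero] at e7
      rw [map_neg, map_neg, e7, map_sub, map_sub, e5, e6]
      abel

end Comparison

end OreExtension

end

end OreHochschild

namespace OreHochschild

noncomputable section

/-! ### Universal cocycles with values in syzygies of A. -/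

section Universal

set_option linter.unusedSectionVars false

universe u v

variable {k : Type u} {A : Type v} [CommRing k] [Ring A] [Algebra k A]

section Env

variable {M N : Type*} [AddCommGroup M] [Module k M] [AddCommGroup N] [Module k N]

/-- The action of the enveloping algebra on a bimodule. -/
def BimoduleStr.env (B : BimoduleStr k A M) : A ⊗[k] Aᵐᵒᵖ →ₐ[k] Module.End k M :=
  Algebra.TensorProduct.lift B.left B.right B.comm

theorem BimoduleStr.env_tmul (B : BimoduleStr k A M) (a : A) (b : Aᵐᵒᵖ) (m : M) :
    B.env (a ⊗ₜ b) m = B.left a (B.right b m) := by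
  simp [BimoduleStr.env]

theorem BimoduleStr.IsHom.map_env {B : BimoduleStr k A M} {B' : BimoduleStr k A N}
    {φ : M →ₗ[k] N} (h : B.IsHom B' φ) (r : A ⊗[k] Aᵐᵒᵖ) (m : M) :
    φ (B.env r m) = B'.env r (φ m) := by
  induction r with
  | zero => simp
  | add r s hr hs => simp only [map_add, LinearMap.add_apply, hr, hs]
  | tmul a b => rw [env_tmul, env_tmul, h.1, h.2]

variable (k A M) [Module (A ⊗[k] Aᵐᵒᵖ) M] [IsScalarTower k (A ⊗[k] Aᵐᵒᵖ) M]

/-- The bimodule structure of a module over the enveloping algebra. -/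
def BimoduleStr.ofEnv : BimoduleStr k A M where
  left := (Algebra.lsmul k k M).comp Algebra.TensorProduct.includeLeft
  right := (Algebra.lsmul k k M).comp Algebra.TensorProduct.includeRight
  comm a b := by
    refine Commute.map (f := Algebra.lsmul k k M) ?_
    change (a ⊗ₜ[k] (1 : Aᵐᵒᵖ)) * ((1 : A) ⊗ₜ[k] b) = ((1 : A) ⊗ₜ[k] b) * (a ⊗ₜ[k] (1 : Aᵐᵒᵖ))
    simp

variable {k A M}

theorem BimoduleStr.ofEnv_left (a : A) (m : M) :
    (BimoduleStr.ofEnv k A M).left a m = (a ⊗ₜ[k] (1 : Aᵐᵒᵖ)) • m := rfl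

theorem BimoduleStr.ofEnv_right (b : Aᵐᵒᵖ) (m : M) :
    (BimoduleStr.ofEnv k A M).right b m = ((1 : A) ⊗ₜ[k] b) • m := rfl

theorem BimoduleStr.ofEnv_env (r : A ⊗[k] Aᵐᵒᵖ) (m : M) :
    (BimoduleStr.ofEnv k A M).env r m = r • m := by
  induction r with
  | zero =>
    rw [map_zero]
    exact (zero_smul (A ⊗[k] Aᵐᵒᵖ) m).symm
  | add r s hr hs => simp only [map_add, LinearMap.add_apply, hr, hs, add_smul]
  | tmul a b => rw [env_tmul, ofEnv_left, ofEnv_right, smul_smul]; simp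

theorem BimoduleStr.ofEnv_isHom [Module (A ⊗[k] Aᵐᵒᵖ) N] [IsScalarTower k (A ⊗[k] Aᵐᵒᵖ) N]
    (φ : M →ₗ[A ⊗[k] Aᵐᵒᵖ] N) :
    (BimoduleStr.ofEnv k A M).IsHom (BimoduleStr.ofEnv k A N) (φ.restrictScalars k) :=
  ⟨fun _ _ => φ.map_smul _ _, fun _ _ => φ.map_smul _ _⟩

/-- Through `BimoduleStr.env` the two bimodules become modules over the enveloping algebra and π, φ
become linear, so projectivity of X applies. -/
theorem exists_lift_of_projective {X : Type*} [AddCommGroup X] [Module k X]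
    [Module (A ⊗[k] Aᵐᵒᵖ) X] [IsScalarTower k (A ⊗[k] Aᵐᵒᵖ) X]
    [Module.Projective (A ⊗[k] Aᵐᵒᵖ) X] {J Q : Type*} [AddCommGroup J] [Module k J]
    [AddCommGroup Q] [Module k Q] {B : BimoduleStr k A J} {B' : BimoduleStr k A Q}
    {π : J →ₗ[k] Q} (hπ : B.IsHom B' π) (hs : Function.Surjective π) {φ : X →ₗ[k] Q}
    (hφ : (BimoduleStr.ofEnv k A X).IsHom B' φ) :
    ∃ θ : X →ₗ[k] J, (BimoduleStr.ofEnv k A X).IsHom B θ ∧ π ∘ₗ θ = φ := by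
  let _ : Module (A ⊗[k] Aᵐᵒᵖ) J := Module.compHom J B.env.toRingHom
  let _ : Module (A ⊗[k] Aᵐᵒᵖ) Q := Module.compHom Q B'.env.toRingHom
  have hJ : ∀ (r : A ⊗[k] Aᵐᵒᵖ) (j : J), r • j = B.env r j := fun _ _ => rfl
  have : IsScalarTower k (A ⊗[k] Aᵐᵒᵖ) J := ⟨fun c r j => by
    rw [hJ, hJ, map_smul, LinearMap.smul_apply]⟩
  let π' : J →ₗ[A ⊗[k] Aᵐᵒᵖ] Q := { π with map_smul' := fun r j => hπ.map_env r j }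
  have hφ' : ∀ (r : A ⊗[k] Aᵐᵒᵖ) (x : X), φ (r • x) = r • φ x := fun r x => by
    rw [← BimoduleStr.ofEnv_env]
    exact hφ.map_env r x
  let φ' : X →ₗ[A ⊗[k] Aᵐᵒᵖ] Q := { φ with map_smul' := hφ' }
  obtain ⟨θ, hθ⟩ := Module.projective_lifting_property π' φ' hs
  refine ⟨θ.restrictScalars k, ⟨fun a x => ?_, fun b x => ?_⟩, ?_⟩
  · refine (θ.map_smul (a ⊗ₜ[k] (1 : Aᵐᵒᵖ)) x).trans ?_
    rw [hJ, BimoduleStr.env_tmul, map_one, Module.End.one_apply]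
    rfl
  · refine (θ.map_smul ((1 : A) ⊗ₜ[k] b) x).trans ?_
    rw [hJ, BimoduleStr.env_tmul, map_one, Module.End.one_apply]
    rfl
  · ext x
    exact LinearMap.congr_fun hθ x

end Env

/-- A cocycle such that every cocycle of the same degree is cohomologous to its image under a
morphism of bimodules. -/
def IsUniversalCocycle {Z : Type v} [AddCommGroup Z] [Module k Z] (B : BimoduleStr k A Z) {n : ℕ}
    (c : Cochain k A Z n) : Prop :=
  c ∈ cocycles B n ∧ ∀ (N : Type v) [AddCommGroup N] [Module k N] (B' : BimoduleStr k A N),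
    ∀ f ∈ cocycles B' n, ∃ φ : Z →ₗ[k] N, B.IsHom B' φ ∧ f - push k A φ n c ∈ coboundaries B' n

/-- X is a direct summand of a free R-module, which is a direct sum of copies of the k-projective
module R. It gives the k-linear sections used to lift cochains along resolutions. -/
theorem projective_of_projective {R X : Type*} [Ring R] [Algebra k R] [AddCommGroup X] [Module k X]
    [Module R X] [IsScalarTower k R X] [Module.Projective k R] [Module.Projective R X] :
    Module.Projective k X := by
  obtain ⟨s, hs⟩ := Module.projective_def'.1 (inferInstance : Module.Projective R X)
  have : Module.Projective k (X →₀ R) := by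
    classical
    exact Module.Projective.of_equiv' (finsuppLequivDFinsupp (ι := X) (M := R) k).symm
  refine Module.Projective.of_split (s.restrictScalars k)
    ((Finsupp.linearCombination R (id : X → X)).restrictScalars k) ?_
  ext x
  exact LinearMap.congr_fun hs x

/-- Dimension shifting for universal cocycles. -/
theorem IsUniversalCocycle.exists_succ {Z : Type v} [AddCommGroup Z] [Module k Z]
    [Module (A ⊗[k] Aᵐᵒᵖ) Z] [IsScalarTower k (A ⊗[k] Aᵐᵒᵖ) Z] [Module.Projective k Z] {n : ℕ}
    {c : Cochain k A Z n} (hc : IsUniversalCocycle (BimoduleStr.ofEnv k A Z) c)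
    {X : Type v} [AddCommGroup X] [Module k X]
    [Module (A ⊗[k] Aᵐᵒᵖ) X] [IsScalarTower k (A ⊗[k] Aᵐᵒᵖ) X]
    [Module.Projective (A ⊗[k] Aᵐᵒᵖ) X] (π : X →ₗ[A ⊗[k] Aᵐᵒᵖ] Z) (hπ : Function.Surjective π) :
    ∃ c' : Cochain k A (LinearMap.ker π) (n + 1),
      IsUniversalCocycle (BimoduleStr.ofEnv k A (LinearMap.ker π)) c' := by
  obtain ⟨s, hs⟩ := LinearMap.exists_rightInverse_of_surjective (π.restrictScalars k)
    (LinearMap.range_eq_top.2 hπ)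
  have hπ' := BimoduleStr.ofEnv_isHom (k := k) (A := A) π
  let i : LinearMap.ker π →ₗ[k] X := (LinearMap.ker π).subtype.restrictScalars k
  have hi : (BimoduleStr.ofEnv k A (LinearMap.ker π)).IsHom (BimoduleStr.ofEnv k A X) i :=
    BimoduleStr.ofEnv_isHom (k := k) (A := A) (M := LinearMap.ker π) (N := X)
      (LinearMap.ker π).subtype
  have hinj : Function.Injective i := Subtype.val_injective
  -- The new cocycle is the image of c under the connecting homomorphism, computed with the k-linear
  -- section s.
  let e := differential (BimoduleStr.ofEnv k A X) n (push k A s n c)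
  have he : push k A (π.restrictScalars k) (n + 1) e = 0 := by
    rw [← differential_push hπ', push_push, hs]
    exact hc.1
  have hmem : ∀ v, e v ∈ LinearMap.ker π := fun v =>
    congrArg (fun F : Cochain k A Z (n + 1) => F v) he
  let c' : Cochain k A (LinearMap.ker π) (n + 1) :=
    { toFun v := ⟨e v, hmem v⟩
      map_update_add' v j a b := Subtype.ext (e.map_update_add v j a b)
      map_update_smul' v j a b := Subtype.ext (e.map_update_smul v j a b) }
  have hc' : push k A i (n + 1) c' = e := rfl
  refine ⟨c', ?_, fun N _ _ B f hf => ?_⟩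
  · refine push_injective i hinj _ ?_
    rw [← differential_push hi, hc', differential_differential, map_zero]
  · have hι := coindIncl_isHom B
    have hρ := coindProj_isHom B
    obtain ⟨g, hg⟩ := coind_cocycles_le_self B n (push_mem_cocycles hι hf)
    have hgc : push k A (coindProj B) n g ∈ cocycles (coindQuot B) n := by
      rw [mem_cocycles, differential_push hρ, hg, push_coindProj_incl]
    -- Shift f one degree down to the cokernel of the coinduced bimodule, use the universality of c
    -- there, and lift ψ ∘ π along the projection by projectivity of X. Restricted to ker π, the
    -- lift θ lands in N and is the required morphism.
    obtain ⟨ψ, hψ, hψ2⟩ := hc.2 _ _ _ hgc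
    obtain ⟨θ, hθ, hθ2⟩ := exists_lift_of_projective hρ
      (Submodule.mkQ_surjective _) (hψ.comp hπ')
    have hker : ∀ z : LinearMap.ker π, θ (i z) ∈ LinearMap.range (coindIncl B) := by
      intro z
      refine (Submodule.Quotient.mk_eq_zero _).1 ?_
      have h1 := LinearMap.congr_fun hθ2 (i z)
      refine h1.trans ?_
      change ψ (π z.1) = 0
      rw [z.2, map_zero]
    have hι2 : ∀ z : LinearMap.ker π, coindIncl B (θ (i z) 1) = θ (i z) := by
      intro z
      obtain ⟨m, hm⟩ := hker z
      rw [← hm, coindIncl_apply, map_one, Module.End.one_apply]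
    let φ : LinearMap.ker π →ₗ[k] N := LinearMap.applyₗ 1 ∘ₗ θ ∘ₗ i
    have hφ : ∀ z, coindIncl B (φ z) = θ (i z) := hι2
    obtain ⟨b, hb, hb2⟩ := exists_lift_coboundary B (AlgHom.id k A) (AlgHom.id k A) n hψ2
    have hb3 : differential (coind B) n b = 0 := coboundaries_le_cocycles (coind B) n hb
    have hθs : (coindProj B ∘ₗ θ) ∘ₗ s = ψ := by
      ext z
      exact (LinearMap.congr_fun hθ2 (s z)).trans (congrArg ψ (LinearMap.congr_fun hs z))
    have hz : push k A (coindProj B) n (g - push k A θ n (push k A s n c) - b) = 0 := by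
      rw [map_sub, hb2, map_sub, push_push, push_push, hθs, sub_self]
    obtain ⟨w, hw⟩ := exists_push_coindIncl_eq B n _ hz
    -- The cochain w is g − θ s c corrected by the coboundary b, which lies in N; its differential
    -- is f − φ c'.
    refine ⟨φ, ⟨fun a z => ?_, fun a z => ?_⟩, w, ?_⟩
    · refine coindIncl_injective B ?_
      rw [hφ, hi.1, hθ.1, hι.1, hφ]
    · refine coindIncl_injective B ?_
      rw [hφ, hi.2, hθ.2, hι.2, hφ]
    · refine push_injective _ (coindIncl_injective B) _ ?_
      have h1 : push k A (coindIncl B) (n + 1) (push k A φ (n + 1) c') = push k A θ (n + 1) e := by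
        ext v : 1
        exact hφ _
      rw [← differential_push hι, hw, map_sub, map_sub, map_sub, hg, hb3, h1, sub_zero,
        differential_push hθ]

/-- Iteration of the dimension shift along a resolution. The module Z and the degree m are arbitrary
so that the induction can replace Z by its first syzygy and drop the first term of the resolution; Y
is the n-th syzygy, finitely generated as a quotient of the n-th term. -/
theorem exists_isUniversalCocycle_of_exact [Module.Projective k A] (n : ℕ) :
    ∀ (Z : Type v) [AddCommGroup Z] [Module k Z]
    [Module (A ⊗[k] Aᵐᵒᵖ) Z] [IsScalarTower k (A ⊗[k] Aᵐᵒᵖ) Z] [Module.Projective k Z] (m : ℕ)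
    (c : Cochain k A Z m) (_ : IsUniversalCocycle (BimoduleStr.ofEnv k A Z) c)
    (X : ℕ → Type v) [∀ i, AddCommGroup (X i)] [∀ i, Module k (X i)]
    [∀ i, Module (A ⊗[k] Aᵐᵒᵖ) (X i)] [∀ i, IsScalarTower k (A ⊗[k] Aᵐᵒᵖ) (X i)]
    [∀ i, Module.Projective (A ⊗[k] Aᵐᵒᵖ) (X i)] [∀ i, Module.Finite (A ⊗[k] Aᵐᵒᵖ) (X i)]
    (π : X 0 →ₗ[A ⊗[k] Aᵐᵒᵖ] Z) (_ : Function.Surjective π)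
    (d : ∀ i, X (i + 1) →ₗ[A ⊗[k] Aᵐᵒᵖ] X i) (_ : Function.Exact (d 0) π)
    (_ : ∀ i, Function.Exact (d (i + 1)) (d i)),
    ∃ (Y : Type v) (_ : AddCommGroup Y) (_ : Module k Y) (_ : Module (A ⊗[k] Aᵐᵒᵖ) Y)
      (_ : IsScalarTower k (A ⊗[k] Aᵐᵒᵖ) Y) (_ : Module.Finite (A ⊗[k] Aᵐᵒᵖ) Y)
      (c' : Cochain k A Y (m + n)), IsUniversalCocycle (BimoduleStr.ofEnv k A Y) c' := by
  have : Module.Projective k Aᵐᵒᵖ := Module.Projective.of_equiv' (MulOpposite.opLinearEquiv k)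
  induction n with
  | zero =>
    intro Z _ _ _ _ _ m c hc X _ _ _ _ _ _ π hπ d h0 h
    exact ⟨Z, _, _, _, inferInstance, Module.Finite.of_surjective π hπ, c, hc⟩
  | succ n ih =>
    intro Z _ _ _ _ _ m c hc X _ _ _ _ _ _ π hπ d h0 h
    obtain ⟨c', hc'⟩ := hc.exists_succ π hπ
    obtain ⟨s, hs⟩ := LinearMap.exists_rightInverse_of_surjective (π.restrictScalars k)
      (LinearMap.range_eq_top.2 hπ)
    have hs' : ∀ z, π (s z) = z := fun z => LinearMap.congr_fun hs z
    have : Module.Projective k (X 0) := projective_of_projective (R := A ⊗[k] Aᵐᵒᵖ)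
    -- The kernel is a k-direct summand of the projective module X 0, with retraction x ↦ x − s(π
    -- x).
    have : Module.Projective k (LinearMap.ker π) := by
      refine Module.Projective.of_split ((LinearMap.ker π).subtype.restrictScalars k)
        { toFun x := ⟨x - s (π x), by rw [LinearMap.mem_ker, map_sub, hs', sub_self]⟩
          map_add' x y := Subtype.ext (by simp only [map_add, Submodule.coe_add]; abel)
          map_smul' t x := Subtype.ext ?_ } ?_
      · have : π (t • x) = t • π x := (π.restrictScalars k).map_smul t x
        simp only [this, map_smul, RingHom.id_apply, SetLike.val_smul_of_tower, smul_sub]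
      · ext z
        simp
    have hd : ∀ x, d 0 x ∈ LinearMap.ker π := fun x => h0.apply_apply_eq_zero x
    have := ih (LinearMap.ker π) (m + 1) c' hc' (fun i => X (i + 1))
      ((d 0).codRestrict (LinearMap.ker π) hd) (fun z => ?_) (fun i => d (i + 1)) ?_
      (fun i => h (i + 1))
    · obtain ⟨Y, i1, i2, i3, i4, i5, c'', hc''⟩ := this
      have e : m + 1 + n = m + (n + 1) := by omega
      rw [← e]
      exact ⟨Y, i1, i2, i3, i4, i5, c'', hc''⟩
    · obtain ⟨x, hx⟩ := (h0 z.1).1 z.2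
      exact ⟨x, Subtype.ext hx⟩
    · intro x
      rw [← h 0 x]
      exact Subtype.ext_iff

section Regular

attribute [local instance] instModuleTensorProductMop

theorem isScalarTower_env : IsScalarTower k (A ⊗[k] Aᵐᵒᵖ) A :=
  ⟨fun r ab a => by
    change TensorProduct.Algebra.moduleAux _ _ = _ • TensorProduct.Algebra.moduleAux _ _
    simp⟩

theorem exists_isUniversalCocycle (hproj : Module.Projective k A)
    (hres : HasFGProjectiveResolution k A) (n : ℕ) :
    ∃ (Y : Type v) (_ : AddCommGroup Y) (_ : Module k Y) (_ : Module (A ⊗[k] Aᵐᵒᵖ) Y)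
      (_ : IsScalarTower k (A ⊗[k] Aᵐᵒᵖ) Y) (_ : Module.Finite (A ⊗[k] Aᵐᵒᵖ) Y)
      (c : Cochain k A Y n), IsUniversalCocycle (BimoduleStr.ofEnv k A Y) c := by
  have : IsScalarTower k (A ⊗[k] Aᵐᵒᵖ) A := isScalarTower_env
  obtain ⟨P, hP⟩ := hres
  have hl : ∀ a b : A, (BimoduleStr.ofEnv k A A).left a b = a * b := by
    intro a b
    rw [BimoduleStr.ofEnv_left, TensorProduct.Algebra.smul_def]
    simp
  have hr : ∀ a b : A, (BimoduleStr.ofEnv k A A).right (MulOpposite.op a) b = b * a := by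
    intro a b
    rw [BimoduleStr.ofEnv_right, TensorProduct.Algebra.smul_def]
    simp
  -- In degree 0 the unit of A is universal: a central element m of N is the image of 1 under the
  -- bimodule morphism a ↦ a m.
  have hc : IsUniversalCocycle (BimoduleStr.ofEnv k A A)
      (MultilinearMap.constOfIsEmpty k (fun _ : Fin 0 => A) (1 : A)) := by
    refine ⟨?_, fun N _ _ B f hf => ?_⟩
    · rw [OreExtension.mem_cocycles_zero]
      intro a
      rw [hl, hr, MultilinearMap.constOfIsEmpty_apply]
      simp
    · rw [OreExtension.mem_cocycles_zero] at hf
      refine ⟨B.left.toLinearMap.flip (f Fin.elim0), ⟨fun a b => ?_, fun a b => ?_⟩, ?_⟩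
      · rw [hl]
        simp
      · have := hr a.unop b
        rw [MulOpposite.op_unop] at this
        rw [this]
        simp only [LinearMap.flip_apply, AlgHom.toLinearMap_apply, map_mul, Module.End.mul_apply]
        rw [hf]
        exact LinearMap.congr_fun (B.comm b a) _
      · rw [coboundaries, Submodule.mem_bot, sub_eq_zero]
        ext w
        rw [Subsingleton.elim w Fin.elim0]
        change _ = B.left 1 _
        rw [map_one]
        rfl
  let _ : ∀ i, Module k (P.complex.X i) := fun i => Module.compHom _ (algebraMap k (A ⊗[k] Aᵐᵒᵖ))
  have : ∀ i, IsScalarTower k (A ⊗[k] Aᵐᵒᵖ) (P.complex.X i) := fun i =>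
    ⟨fun c r x => (congrArg (· • x) (Algebra.smul_def c r)).trans (mul_smul _ r x)⟩
  have : ∀ i, Module.Projective (A ⊗[k] Aᵐᵒᵖ) (P.complex.X i) := fun i =>
    (IsProjective.iff_projective (P.complex.X i)).2 (P.projective i)
  have key := exists_isUniversalCocycle_of_exact n A 0 _ hc (fun i => P.complex.X i)
    (P.π.f 0).hom ((ModuleCat.epi_iff_surjective _).1 inferInstance)
    (fun i => (P.complex.d (i + 1) i).hom)
    ((CategoryTheory.ShortComplex.ShortExact.moduleCat_exact_iff_function_exact _).1 P.exact₀)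
    (fun i => (CategoryTheory.ShortComplex.ShortExact.moduleCat_exact_iff_function_exact _).1
      (P.exact_succ i))
  rwa [Nat.zero_add] at key

end Regular

/-- If `A` has a resolution by finitely generated projective bimodules, then Hochschild classes
with coefficients in a bimodule exhausted by endomorphisms `P n` are supported at a finite stage. -/
theorem exists_sub_push_mem_coboundaries (hproj : Module.Projective k A)
    (hres : HasFGProjectiveResolution k A) {N : Type v} [AddCommGroup N] [Module k N]
    {B : BimoduleStr k A N} (P : ℕ → N →ₗ[k] N) (hP : ∀ n, B.IsHom B (P n))
    (hfin : ∀ m, ∃ n₀, ∀ n, n₀ ≤ n → P n m = m) {d : ℕ} {f : Cochain k A N d}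
    (hf : f ∈ cocycles B d) : ∃ n, f - push k A (P n) d f ∈ coboundaries B d := by
  obtain ⟨Y, _, _, _, _, hfg, c, hc⟩ := exists_isUniversalCocycle hproj hres d
  obtain ⟨φ, hφ, h⟩ := hc.2 N B f hf
  obtain ⟨T, hT⟩ := hfg.fg_top
  choose n₀ hn₀ using hfin
  -- From this stage on P fixes the images of the finitely many generators of Y, hence by
  -- bilinearity the whole image of φ.
  refine ⟨T.sup fun y => n₀ (φ y), ?_⟩
  set n := T.sup fun y => n₀ (φ y) with hn
  have h1 : ∀ y : Y, P n (φ y) = φ y := by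
    intro y
    have hy : y ∈ Submodule.span (A ⊗[k] Aᵐᵒᵖ) (T : Set Y) := hT ▸ Submodule.mem_top
    induction hy using Submodule.span_induction with
    | mem y hy => exact hn₀ _ _ (Finset.le_sup (f := fun y => n₀ (φ y)) hy)
    | zero => rw [map_zero, map_zero]
    | add x y _ _ hx hy => rw [map_add, map_add, hx, hy]
    | smul r y _ hy =>
      rw [← BimoduleStr.ofEnv_env, hφ.map_env, (hP n).map_env, hy]
  have h2 : push k A (P n) d (push k A φ d c) = push k A φ d c := by
    ext v
    exact h1 _
  -- Both f and its image under P n are cohomologous to φ c.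
  have h3 := push_mem_coboundaries (hP n) h
  have h4 := Submodule.sub_mem _ h h3
  rw [map_sub, h2, sub_sub_sub_cancel_right] at h4
  exact h4

end Universal

end

end OreHochschild

namespace OreHochschild

noncomputable section

/-! ### Infinite direct sums of bimodules and their cohomology. -/

section Decomposition

set_option linter.unusedSectionVars false

universe u v

variable {k : Type u} {A : Type v} [CommRing k] [Ring A] [Algebra k A]
  {N₀ N : Type v} [AddCommGroup N₀] [Module k N₀] [AddCommGroup N] [Module k N]

/-- A decomposition of a bimodule as a direct sum of copies of another one, indexed by `ℕ`. -/
structure Decomp (B₀ : BimoduleStr k A N₀) (B : BimoduleStr k A N) where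
  /-- the inclusions of the summands -/
  incl : ℕ → N₀ →ₗ[k] N
  /-- the projections to the summands -/
  proj : ℕ → N →ₗ[k] N₀
  incl_isHom : ∀ i, B₀.IsHom B (incl i)
  proj_isHom : ∀ i, B.IsHom B₀ (proj i)
  proj_incl_self : ∀ i m, proj i (incl i m) = m
  proj_incl_of_ne : ∀ i j m, i ≠ j → proj j (incl i m) = 0
  exhaustive : ∀ m, ∃ n₀, ∀ n, n₀ ≤ n → ∑ i ∈ Finset.range n, incl i (proj i m) = m

/-- The twist by `σ` of the left action of a bimodule. -/
def sigmaTwist (σ : A ≃ₐ[k] A) (B : BimoduleStr k A N) : BimoduleStr k A N :=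
  B.twist (σ : A →ₐ[k] A) (AlgHom.id k A)

theorem isHom_sigmaTwist (σ : A ≃ₐ[k] A) {B₀ : BimoduleStr k A N₀} {B : BimoduleStr k A N}
    {φ : N₀ →ₗ[k] N} (h : B₀.IsHom B φ) : (sigmaTwist σ B₀).IsHom (sigmaTwist σ B) φ :=
  h.twist _ _

variable {B₀ : BimoduleStr k A N₀} {B : BimoduleStr k A N}

/-- Twisting of decompositions. -/
def Decomp.twist (D : Decomp B₀ B) (σ : A ≃ₐ[k] A) :
    Decomp (sigmaTwist σ B₀) (sigmaTwist σ B) where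
  __ := D
  incl_isHom i := isHom_sigmaTwist σ (D.incl_isHom i)
  proj_isHom i := isHom_sigmaTwist σ (D.proj_isHom i)

theorem Decomp.push_proj_incl_self (D : Decomp B₀ B) (i n : ℕ) (f : Cochain k A N₀ n) :
    push k A (D.proj i) n (push k A (D.incl i) n f) = f := by
  ext v
  exact D.proj_incl_self i _

theorem Decomp.push_proj_incl_of_ne (D : Decomp B₀ B) {i j : ℕ} (h : i ≠ j) (n : ℕ)
    (f : Cochain k A N₀ n) : push k A (D.proj j) n (push k A (D.incl i) n f) = 0 := by
  ext v
  exact D.proj_incl_of_ne i j _ h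

/-- The partial sums ∑ `incl i ∘ proj i` are bimodule endomorphisms that exhaust B, so the
finiteness of universal cocycles applies: up to coboundaries a cocycle has finitely many components.
-/
theorem Decomp.exists_sub_sum_mem (hproj : Module.Projective k A)
    (hres : HasFGProjectiveResolution k A) (D : Decomp B₀ B) {d : ℕ} {f : Cochain k A N d}
    (hf : f ∈ cocycles B d) : ∃ n, f - ∑ i ∈ Finset.range n,
      push k A (D.incl i) d (push k A (D.proj i) d f) ∈ coboundaries B d := by
  have hP : ∀ n, B.IsHom B (∑ i ∈ Finset.range n, D.incl i ∘ₗ D.proj i) := by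
    intro n
    refine ⟨fun s m => ?_, fun s m => ?_⟩
    · simp only [LinearMap.sum_apply, map_sum]
      exact Finset.sum_congr rfl fun i _ => ((D.incl_isHom i).comp (D.proj_isHom i)).1 s m
    · simp only [LinearMap.sum_apply, map_sum]
      exact Finset.sum_congr rfl fun i _ => ((D.incl_isHom i).comp (D.proj_isHom i)).2 s m
  obtain ⟨n, hn⟩ := exists_sub_push_mem_coboundaries hproj hres
    (fun n => ∑ i ∈ Finset.range n, D.incl i ∘ₗ D.proj i) hP
    (fun m => by
      obtain ⟨n₀, h⟩ := D.exhaustive m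
      refine ⟨n₀, fun n hn => ?_⟩
      rw [LinearMap.sum_apply]
      exact h n hn) hf
  refine ⟨n, ?_⟩
  convert hn using 2
  ext v
  simp

theorem Decomp.cocycles_le (hproj : Module.Projective k A)
    (hres : HasFGProjectiveResolution k A) (D : Decomp B₀ B) {d : ℕ}
    (h : cocycles B₀ d ≤ coboundaries B₀ d) : cocycles B d ≤ coboundaries B d := by
  intro f hf
  obtain ⟨n, hn⟩ := D.exists_sub_sum_mem hproj hres hf
  refine (Submodule.sub_mem_iff_left _ (Submodule.sum_mem _ fun i _ => ?_)).1 hn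
  exact push_mem_coboundaries (D.incl_isHom i) (h (push_mem_cocycles (D.proj_isHom i) hf))

end Decomposition

section TensorHom

variable {k S M M' N N' : Type*} [CommRing k] [Ring S] [Algebra k S]
  [AddCommGroup M] [Module k M] [AddCommGroup N] [Module k N]
  [AddCommGroup M'] [Module k M'] [AddCommGroup N'] [Module k N']

theorem BimoduleStr.regular_twist_left {T : Type*} [Ring T] [Algebra k T] (ν τ : T →ₐ[k] S)
    (t : T) (s : S) : ((BimoduleStr.regular k S).twist ν τ).left t s = ν t * s := rfl

theorem BimoduleStr.regular_twist_right {T : Type*} [Ring T] [Algebra k T] (ν τ : T →ₐ[k] S)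
    (t : Tᵐᵒᵖ) (s : S) : ((BimoduleStr.regular k S).twist ν τ).right t s = s * τ t.unop := rfl

theorem isHom_outer_rTensor (B : BimoduleStr k S M) (B' : BimoduleStr k S M')
    (B'' : BimoduleStr k S N) {φ : M →ₗ[k] M'} (h : ∀ s m, φ (B.left s m) = B'.left s (φ m)) :
    (B.outer B'').IsHom (B'.outer B'') (LinearMap.rTensor N φ) := by
  refine ⟨fun s m => ?_, fun s m => ?_⟩
  · induction m with
    | zero => simp only [map_zero]
    | add x y hx hy => simp only [map_add, hx, hy]
    | tmul x y =>
      rw [BimoduleStr.outer_left_tmul, LinearMap.rTensor_tmul, LinearMap.rTensor_tmul,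
        BimoduleStr.outer_left_tmul, h]
  · induction m with
    | zero => simp only [map_zero]
    | add x y hx hy => simp only [map_add, hx, hy]
    | tmul x y => rfl

theorem isHom_outer_lTensor (B : BimoduleStr k S M) (B' : BimoduleStr k S N)
    (B'' : BimoduleStr k S N') {φ : N →ₗ[k] N'} (h : ∀ s m, φ (B'.right s m) = B''.right s (φ m)) :
    (B.outer B').IsHom (B.outer B'') (LinearMap.lTensor M φ) := by
  refine ⟨fun s m => ?_, fun s m => ?_⟩
  · induction m with
    | zero => simp only [map_zero]
    | add x y hx hy => simp only [map_add, hx, hy]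
    | tmul x y => rfl
  · induction m with
    | zero => simp only [map_zero]
    | add x y hx hy => simp only [map_add, hx, hy]
    | tmul x y =>
      rw [BimoduleStr.outer_right_tmul, LinearMap.lTensor_tmul, LinearMap.lTensor_tmul,
        BimoduleStr.outer_right_tmul, h]

theorem exhaustive_rTensor (ι : ℕ → M' →ₗ[k] M) (p : ℕ → M →ₗ[k] M')
    (h : ∀ m, ∃ n₀, ∀ n, n₀ ≤ n → ∑ i ∈ Finset.range n, ι i (p i m) = m) (t : M ⊗[k] N) :
    ∃ n₀, ∀ n, n₀ ≤ n →
      ∑ i ∈ Finset.range n, LinearMap.rTensor N (ι i) (LinearMap.rTensor N (p i) t) = t := by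
  induction t with
  | zero => exact ⟨0, fun n _ => by simp⟩
  | add x y hx hy =>
    obtain ⟨a, ha⟩ := hx
    obtain ⟨b, hb⟩ := hy
    refine ⟨max a b, fun n hn => ?_⟩
    simp only [map_add, Finset.sum_add_distrib]
    rw [ha n (le_of_max_le_left hn), hb n (le_of_max_le_right hn)]
  | tmul x y =>
    obtain ⟨a, ha⟩ := h x
    refine ⟨a, fun n hn => ?_⟩
    simp only [LinearMap.rTensor_tmul]
    rw [← TensorProduct.sum_tmul, ha n hn]

theorem exhaustive_lTensor (ι : ℕ → N' →ₗ[k] N) (p : ℕ → N →ₗ[k] N')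
    (h : ∀ m, ∃ n₀, ∀ n, n₀ ≤ n → ∑ i ∈ Finset.range n, ι i (p i m) = m) (t : M ⊗[k] N) :
    ∃ n₀, ∀ n, n₀ ≤ n →
      ∑ i ∈ Finset.range n, LinearMap.lTensor M (ι i) (LinearMap.lTensor M (p i) t) = t := by
  induction t with
  | zero => exact ⟨0, fun n _ => by simp⟩
  | add x y hx hy =>
    obtain ⟨a, ha⟩ := hx
    obtain ⟨b, hb⟩ := hy
    refine ⟨max a b, fun n hn => ?_⟩
    simp only [map_add, Finset.sum_add_distrib]
    rw [ha n (le_of_max_le_left hn), hb n (le_of_max_le_right hn)]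
  | tmul x y =>
    obtain ⟨a, ha⟩ := h y
    refine ⟨a, fun n hn => ?_⟩
    simp only [LinearMap.lTensor_tmul]
    rw [← TensorProduct.tmul_sum, ha n hn]

end TensorHom

/-! ### The decompositions of E ⊗ E by powers of x on each side. -/

namespace OreExtension

section Tensor

universe u v

variable {k : Type u} {A : Type v} [CommRing k] [Ring A] [Algebra k A] (σ : A ≃ₐ[k] A)
  (δ : SkewDerivation σ)

/-- The map `a ↦ a xⁱ`. -/
def leftMono (i : ℕ) : A →ₗ[k] OreExtension σ δ :=
  LinearMap.mulRight k (X σ δ ^ i) ∘ₗ (C σ δ).toLinearMap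

theorem leftMono_apply (i : ℕ) (a : A) : leftMono σ δ i a = C σ δ a * X σ δ ^ i := rfl

/-- The coefficient `aᵢ` of `∑ aᵢ xⁱ`. -/
def leftCoeff (i : ℕ) : OreExtension σ δ →ₗ[k] A := (Finsupp.lapply i : (ℕ →₀ A) →ₗ[k] A)

theorem leftCoeff_C_mul_X_pow (i j : ℕ) (a : A) :
    leftCoeff σ δ j (C σ δ a * X σ δ ^ i) = if i = j then a else 0 := by
  rw [C_mul_X_pow]
  exact Finsupp.single_apply

theorem leftCoeff_C_mul (j : ℕ) (a : A) (e : OreExtension σ δ) :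
    leftCoeff σ δ j (C σ δ a * e) = a * leftCoeff σ δ j e := by
  induction e using induction_left with
  | hadd e e' h h' => rw [mul_add, map_add, map_add, h, h', mul_add]
  | h b i =>
    rw [← mul_assoc, ← map_mul, leftCoeff_C_mul_X_pow, leftCoeff_C_mul_X_pow]
    split_ifs <;> simp

theorem exhaustive_leftCoeff (e : OreExtension σ δ) : ∃ n₀, ∀ n, n₀ ≤ n →
    ∑ i ∈ Finset.range n, leftMono σ δ i (leftCoeff σ δ i e) = e := by
  induction e using induction_left with
  | hadd e e' h h' =>
    obtain ⟨a, ha⟩ := h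
    obtain ⟨b, hb⟩ := h'
    refine ⟨max a b, fun n hn => ?_⟩
    simp only [map_add, Finset.sum_add_distrib]
    rw [ha n (le_of_max_le_left hn), hb n (le_of_max_le_right hn)]
  | h a i =>
    refine ⟨i + 1, fun n hn => ?_⟩
    rw [Finset.sum_eq_single i]
    · rw [leftCoeff_C_mul_X_pow, if_pos rfl, leftMono_apply]
    · intro j _ hj
      rw [leftCoeff_C_mul_X_pow, if_neg hj.symm, map_zero]
    · intro hi
      exact absurd (Finset.mem_range.2 hn) hi

/-- The map `b ↦ xʲ b`. -/
def rightMono (j : ℕ) : A →ₗ[k] OreExtension σ δ :=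
  LinearMap.mulLeft k (X σ δ ^ j) ∘ₗ (C σ δ).toLinearMap

theorem rightMono_apply (j : ℕ) (b : A) : rightMono σ δ j b = X σ δ ^ j * C σ δ b := rfl

theorem rightMono_mul (j : ℕ) (b c : A) :
    rightMono σ δ j (b * c) = rightMono σ δ j b * C σ δ c := by
  rw [rightMono_apply, rightMono_apply, map_mul, mul_assoc]

/-- The coefficient `bⱼ` of `∑ xʲ bⱼ`. -/
def rightCoeffAt (j : ℕ) : OreExtension σ δ →ₗ[k] A := Finsupp.lapply j ∘ₗ rightCoeff σ δ

theorem rightCoeffAt_X_pow_mul_C (i j : ℕ) (b : A) :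
    rightCoeffAt σ δ j (X σ δ ^ i * C σ δ b) = if i = j then b else 0 := by
  rw [rightCoeffAt, LinearMap.comp_apply, rightCoeff_X_pow_mul_C]
  exact Finsupp.single_apply

theorem rightCoeffAt_mul_C (j : ℕ) (a : A) (e : OreExtension σ δ) :
    rightCoeffAt σ δ j (e * C σ δ a) = rightCoeffAt σ δ j e * a := by
  rw [rightCoeffAt, LinearMap.comp_apply, rightCoeff_mul_C]
  simp

theorem exhaustive_rightCoeff (e : OreExtension σ δ) : ∃ n₀, ∀ n, n₀ ≤ n →
    ∑ i ∈ Finset.range n, rightMono σ δ i (rightCoeffAt σ δ i e) = e := by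
  induction e using induction_right with
  | hadd e e' h h' =>
    obtain ⟨a, ha⟩ := h
    obtain ⟨b, hb⟩ := h'
    refine ⟨max a b, fun n hn => ?_⟩
    simp only [map_add, Finset.sum_add_distrib]
    rw [ha n (le_of_max_le_left hn), hb n (le_of_max_le_right hn)]
  | h a i =>
    refine ⟨i + 1, fun n hn => ?_⟩
    rw [Finset.sum_eq_single i]
    · rw [rightCoeffAt_X_pow_mul_C, if_pos rfl, rightMono_apply]
    · intro j _ hj
      rw [rightCoeffAt_X_pow_mul_C, if_neg hj.symm, map_zero]
    · intro hi
      exact absurd (Finset.mem_range.2 hn) hi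

/-- The bimodule `E ⊗ E` for `E = A[x; σ, δ]`. -/
abbrev outerE : BimoduleStr k (OreExtension σ δ) (OreExtension σ δ ⊗[k] OreExtension σ δ) :=
  outerTwisted k (AlgHom.id k (OreExtension σ δ))

/-- The `A`-bimodule `A ⊗ E` for `E = A[x; σ, δ]`. -/
def outerMid : BimoduleStr k A (A ⊗[k] OreExtension σ δ) :=
  (BimoduleStr.regular k A).outer
    ((BimoduleStr.regular k (OreExtension σ δ)).twist (C σ δ) (C σ δ))

/-- The decomposition `E ⊗ E = ⨁ A xⁱ ⊗ E`. -/
def decompLeft : Decomp (outerMid σ δ) (res (outerE σ δ)) where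
  incl i := LinearMap.rTensor _ (leftMono σ δ i)
  proj i := LinearMap.rTensor _ (leftCoeff σ δ i)
  incl_isHom i := isHom_outer_rTensor (BimoduleStr.regular k A)
    ((BimoduleStr.regular k (OreExtension σ δ)).twist (C σ δ) (C σ δ))
    ((BimoduleStr.regular k (OreExtension σ δ)).twist (C σ δ) (C σ δ)) (fun s m => by
      rw [BimoduleStr.regular_twist_left, leftMono_apply, leftMono_apply, ← mul_assoc, ← map_mul]
      rfl)
  proj_isHom i := isHom_outer_rTensor
    ((BimoduleStr.regular k (OreExtension σ δ)).twist (C σ δ) (C σ δ)) (BimoduleStr.regular k A)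
    ((BimoduleStr.regular k (OreExtension σ δ)).twist (C σ δ) (C σ δ)) (leftCoeff_C_mul σ δ i)
  proj_incl_self i m := by
    rw [← LinearMap.comp_apply, ← LinearMap.rTensor_comp]
    have : leftCoeff σ δ i ∘ₗ leftMono σ δ i = LinearMap.id := by
      ext a
      simp [leftMono_apply, leftCoeff_C_mul_X_pow]
    rw [this, LinearMap.rTensor_id, LinearMap.id_apply]
  proj_incl_of_ne i j m h := by
    rw [← LinearMap.comp_apply, ← LinearMap.rTensor_comp]
    have : leftCoeff σ δ j ∘ₗ leftMono σ δ i = 0 := by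
      ext a
      simp [leftMono_apply, leftCoeff_C_mul_X_pow, h]
    rw [this, LinearMap.rTensor_zero, LinearMap.zero_apply]
  exhaustive := exhaustive_rTensor _ _ (exhaustive_leftCoeff σ δ)

/-- The decomposition of `E ⊗ E` after twisting. -/
def decompLeftTwist : Decomp (sigmaTwist σ (outerMid σ δ)) (resTwist (outerE σ δ)) :=
  (decompLeft σ δ).twist σ

/-- The decomposition `A ⊗ E = ⨁ A ⊗ xʲ A`. -/
def decompRight : Decomp (outerTwisted k (AlgHom.id k A)) (outerMid σ δ) where
  incl i := LinearMap.lTensor _ (rightMono σ δ i)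
  proj i := LinearMap.lTensor _ (rightCoeffAt σ δ i)
  incl_isHom i := isHom_outer_lTensor (BimoduleStr.regular k A)
    ((BimoduleStr.regular k A).twist (AlgHom.id k A) (AlgHom.id k A))
    ((BimoduleStr.regular k (OreExtension σ δ)).twist (C σ δ) (C σ δ)) (fun s m => by
      rw [BimoduleStr.regular_twist_right, BimoduleStr.regular_twist_right, AlgHom.id_apply,
        rightMono_mul])
  proj_isHom i := isHom_outer_lTensor (BimoduleStr.regular k A)
    ((BimoduleStr.regular k (OreExtension σ δ)).twist (C σ δ) (C σ δ))
    ((BimoduleStr.regular k A).twist (AlgHom.id k A) (AlgHom.id k A))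
    (fun s m => by
      rw [BimoduleStr.regular_twist_right, BimoduleStr.regular_twist_right, AlgHom.id_apply,
        rightCoeffAt_mul_C])
  proj_incl_self i m := by
    rw [← LinearMap.comp_apply, ← LinearMap.lTensor_comp]
    have : rightCoeffAt σ δ i ∘ₗ rightMono σ δ i = LinearMap.id := by
      ext a
      simp [rightMono_apply, rightCoeffAt_X_pow_mul_C]
    rw [this, LinearMap.lTensor_id, LinearMap.id_apply]
  proj_incl_of_ne i j m h := by
    rw [← LinearMap.comp_apply, ← LinearMap.lTensor_comp]
    have : rightCoeffAt σ δ j ∘ₗ rightMono σ δ i = 0 := by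
      ext a
      simp [rightMono_apply, rightCoeffAt_X_pow_mul_C, h]
    rw [this, LinearMap.lTensor_zero, LinearMap.zero_apply]
  exhaustive := exhaustive_lTensor _ _ (exhaustive_rightCoeff σ δ)

end Tensor

end OreExtension

/-! ### The maps q^n_i and the commutation of A with powers of x. -/

section QMap

variable {k A : Type*} [CommRing k] [Ring A] [Algebra k A] (σ : A ≃ₐ[k] A) (δ : SkewDerivation σ)

/-- Subsets are sorted by whether they contain 0; this is what separates the compositions in `qMap`
by their leftmost factor. -/
theorem sum_powersetCard_fin_succ {R : Type*} [AddCommMonoid R] (n i : ℕ)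
    (F : Finset (Fin (n + 1)) → R) :
    ∑ T ∈ Finset.powersetCard (i + 1) (Finset.univ : Finset (Fin (n + 1))), F T
      = ∑ T ∈ Finset.powersetCard (i + 1) (Finset.univ : Finset (Fin n)),
          F (T.map (Fin.succEmb n))
        + ∑ T ∈ Finset.powersetCard i (Finset.univ : Finset (Fin n)),
          F (insert 0 (T.map (Fin.succEmb n))) := by
  have h0 : (0 : Fin (n + 1)) ∉ Finset.map (Fin.succEmb n) Finset.univ := by
    simp
  have hu : (Finset.univ : Finset (Fin (n + 1)))
      = insert 0 (Finset.map (Fin.succEmb n) Finset.univ) := by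
    rw [Fin.univ_succ, Finset.cons_eq_insert]
    rfl
  rw [hu, Finset.powersetCard_succ_insert h0, Finset.sum_union, Finset.sum_image,
    Finset.powersetCard_map, Finset.powersetCard_map, Finset.sum_map, Finset.sum_map]
  · rfl
  · intro T hT T' hT' h
    have hT0 : (0 : Fin (n + 1)) ∉ T := fun h => h0 ((Finset.mem_powersetCard.1 hT).1 h)
    have hT0' : (0 : Fin (n + 1)) ∉ T' := fun h => h0 ((Finset.mem_powersetCard.1 hT').1 h)
    rw [← Finset.erase_insert hT0, h, Finset.erase_insert hT0']
  · rw [Finset.disjoint_left]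
    intro T hT hT'
    obtain ⟨T', _, rfl⟩ := Finset.mem_image.1 hT'
    exact h0 ((Finset.mem_powersetCard.1 hT).1 (Finset.mem_insert_self _ _))

theorem qMap_zero_zero : qMap σ δ 0 0 = 1 := by
  simp [qMap]

theorem qMap_of_lt {n i : ℕ} (h : n < i) : qMap σ δ n i = 0 := by
  rw [qMap, Finset.powersetCard_eq_empty.2 (by simpa using h), Finset.sum_empty]

theorem qMap_succ_zero (n : ℕ) : qMap σ δ (n + 1) 0 = -deltaSigmaInv σ δ * qMap σ δ n 0 := by
  simp [qMap, List.ofFn_succ]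

theorem qMap_succ_succ (n i : ℕ) : qMap σ δ (n + 1) (i + 1)
    = (σ.symm.toLinearMap : Module.End k A) * qMap σ δ n i
      + -deltaSigmaInv σ δ * qMap σ δ n (i + 1) := by
  rw [qMap, sum_powersetCard_fin_succ, add_comm, qMap, qMap, Finset.mul_sum, Finset.mul_sum]
  refine congrArg₂ (· + ·) (Finset.sum_congr rfl fun T _ => ?_) (Finset.sum_congr rfl fun T _ => ?_)
  · rw [List.ofFn_succ, List.prod_cons, if_pos (Finset.mem_insert_self _ _)]
    congr 3
    funext j
    have : j.succ ∈ insert (0 : Fin (n + 1)) (T.map (Fin.succEmb n)) ↔ j ∈ T := by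
      simp [Fin.succ_ne_zero]
    simp only [this]
  · have h0 : (0 : Fin (n + 1)) ∉ T.map (Fin.succEmb n) := by simp
    rw [List.ofFn_succ, List.prod_cons, if_neg h0]
    congr 3
    funext j
    have : j.succ ∈ T.map (Fin.succEmb n) ↔ j ∈ T := by simp
    simp only [this]

/-- The commutation rule `a xⁿ = ∑ xⁱ qⁿᵢ(a)`. -/
theorem OreExtension.C_mul_X_pow_eq_sum (n : ℕ) (a : A) :
    OreExtension.C σ δ a * OreExtension.X σ δ ^ n = ∑ i ∈ Finset.range (n + 1),
      OreExtension.X σ δ ^ i * OreExtension.C σ δ (qMap σ δ n i a) := by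
  induction n with
  | zero => simp [qMap_zero_zero]
  | succ n ih =>
    have h : ∀ i, OreExtension.X σ δ ^ i * OreExtension.C σ δ (qMap σ δ n i a)
        * OreExtension.X σ δ
      = OreExtension.X σ δ ^ (i + 1) * OreExtension.C σ δ (σ.symm (qMap σ δ n i a))
        + OreExtension.X σ δ ^ i * OreExtension.C σ δ ((-deltaSigmaInv σ δ * qMap σ δ n i) a) := by
      intro i
      rw [mul_assoc, OreExtension.C_mul_X, mul_sub, pow_succ, mul_assoc, sub_eq_add_neg]
      congr 1
      rw [Module.End.mul_apply, LinearMap.neg_apply, map_neg, mul_neg]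
      rfl
    rw [pow_succ, ← mul_assoc, ih, Finset.sum_mul, Finset.sum_congr rfl fun i _ => h i,
      Finset.sum_add_distrib, Finset.sum_range_succ' _ (n + 1)]
    -- Shifting the index would bring in a term with i = n+1, but q^n_{n+1} = 0, so the range stays
    -- the same.
    have h2 : ∑ i ∈ Finset.range (n + 1), OreExtension.X σ δ ^ i
          * OreExtension.C σ δ ((-deltaSigmaInv σ δ * qMap σ δ n i) a)
        = ∑ i ∈ Finset.range (n + 1), OreExtension.X σ δ ^ (i + 1)
          * OreExtension.C σ δ ((-deltaSigmaInv σ δ * qMap σ δ n (i + 1)) a)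
          + OreExtension.X σ δ ^ 0 * OreExtension.C σ δ ((-deltaSigmaInv σ δ * qMap σ δ n 0) a) := by
      rw [← Finset.sum_range_succ' (fun i => OreExtension.X σ δ ^ i
        * OreExtension.C σ δ ((-deltaSigmaInv σ δ * qMap σ δ n i) a)), Finset.sum_range_succ _ (n + 1),
        qMap_of_lt σ δ (Nat.lt_succ_self n)]
      simp
    rw [h2, ← add_assoc, ← Finset.sum_add_distrib, qMap_succ_zero]
    refine congrArg₂ (· + ·) (Finset.sum_congr rfl fun i _ => ?_) rfl
    rw [qMap_succ_succ, ← mul_add, ← map_add]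
    rfl

end QMap

end

end OreHochschild

namespace OreHochschild

noncomputable section

/-! ### Removing the σ-twist when the left factor is A. -/

section SigmaTwist

universe u v

variable {k : Type u} {A N : Type v} [CommRing k] [Ring A] [Algebra k A] [AddCommGroup N] [Module k N]
  (σ : A ≃ₐ[k] A) (B : BimoduleStr k A N)

/-- Since σ(sx) = σ(s)σ(x), the map σ ⊗ id is an isomorphism from A ⊗ N to its twist; vanishing of
cohomology passes from one to the other. -/
theorem isHom_rTensor_sigma : ((BimoduleStr.regular k A).outer B).IsHom
    (sigmaTwist σ ((BimoduleStr.regular k A).outer B)) (LinearMap.rTensor N σ.toLinearMap) := by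
  refine ⟨fun s m => ?_, fun s m => ?_⟩
  · induction m with
    | zero => simp only [map_zero]
    | add x y hx hy => simp only [map_add, hx, hy]
    | tmul x y => exact congrArg (· ⊗ₜ[k] y) (map_mul σ s x)
  · induction m with
    | zero => simp only [map_zero]
    | add x y hx hy => simp only [map_add, hx, hy]
    | tmul x y => rfl

theorem isHom_rTensor_sigma_symm : (sigmaTwist σ ((BimoduleStr.regular k A).outer B)).IsHom
    ((BimoduleStr.regular k A).outer B) (LinearMap.rTensor N σ.symm.toLinearMap) := by
  refine ⟨fun s m => ?_, fun s m => ?_⟩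
  · induction m with
    | zero => simp only [map_zero]
    | add x y hx hy => simp only [map_add, hx, hy]
    | tmul x y =>
      refine congrArg (· ⊗ₜ[k] y) ((map_mul σ.symm (σ s) x).trans ?_)
      rw [AlgEquiv.symm_apply_apply]
      rfl
  · induction m with
    | zero => simp only [map_zero]
    | add x y hx hy => simp only [map_add, hx, hy]
    | tmul x y => rfl

variable (A) in
theorem push_sigma_push_sigma_symm (n : ℕ) (f : Cochain k A (A ⊗[k] N) n) :
    push k A (LinearMap.rTensor N σ.toLinearMap) n
      (push k A (LinearMap.rTensor N σ.symm.toLinearMap) n f) = f := by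
  rw [push_push, ← LinearMap.rTensor_comp]
  have : σ.toLinearMap ∘ₗ σ.symm.toLinearMap = LinearMap.id := by ext; simp
  rw [this, LinearMap.rTensor_id]
  rfl

variable (A) in
theorem push_sigma_symm_push_sigma (n : ℕ) (f : Cochain k A (A ⊗[k] N) n) :
    push k A (LinearMap.rTensor N σ.symm.toLinearMap) n
      (push k A (LinearMap.rTensor N σ.toLinearMap) n f) = f := by
  rw [push_push, ← LinearMap.rTensor_comp]
  have : σ.symm.toLinearMap ∘ₗ σ.toLinearMap = LinearMap.id := by ext; simp
  rw [this, LinearMap.rTensor_id]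
  rfl

variable {σ B}

theorem push_sigma_mem_coboundaries_iff {n : ℕ} {f : Cochain k A (A ⊗[k] N) n} :
    push k A (LinearMap.rTensor N σ.toLinearMap) n f
        ∈ coboundaries (sigmaTwist σ ((BimoduleStr.regular k A).outer B)) n
      ↔ f ∈ coboundaries ((BimoduleStr.regular k A).outer B) n := by
  refine ⟨fun h => ?_, push_mem_coboundaries (isHom_rTensor_sigma σ B)⟩
  rw [← push_sigma_symm_push_sigma A σ n f]
  exact push_mem_coboundaries (isHom_rTensor_sigma_symm σ B) h

theorem cocycles_sigmaTwist_le {n : ℕ}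
    (h : cocycles ((BimoduleStr.regular k A).outer B) n
      ≤ coboundaries ((BimoduleStr.regular k A).outer B) n) :
    cocycles (sigmaTwist σ ((BimoduleStr.regular k A).outer B)) n
      ≤ coboundaries (sigmaTwist σ ((BimoduleStr.regular k A).outer B)) n := by
  intro f hf
  rw [← push_sigma_push_sigma_symm A σ n f]
  exact push_mem_coboundaries (isHom_rTensor_sigma σ B)
    (h (push_mem_cocycles (isHom_rTensor_sigma_symm σ B) hf))

end SigmaTwist

/-! ### Injectivity of the skew commutator on E ⊗ E and the vanishing statement. -/

namespace OreExtension

universe u v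

variable {k : Type u} {A : Type v} [CommRing k] [Ring A] [Algebra k A] (σ : A ≃ₐ[k] A)
  (δ : SkewDerivation σ)

/-- Right multiplication by `x` on `A ⊗ E`. -/
def rxMid : Module.End k (A ⊗[k] OreExtension σ δ) :=
  LinearMap.lTensor A (LinearMap.mulRight k (X σ δ))

/-- The part of the skew commutator with `x` on `A ⊗ E` which preserves the degree. -/
def commMid (n : ℕ) :
    Cochain k A (A ⊗[k] OreExtension σ δ) n →ₗ[k] Cochain k A (A ⊗[k] OreExtension σ δ) n :=
  skewCommutator σ δ (LinearMap.rTensor _ δ.toLin) (rxMid σ δ) n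

theorem outerE_left_tmul (e u v : OreExtension σ δ) :
    (outerE σ δ).left e (u ⊗ₜ[k] v) = (e * u) ⊗ₜ[k] v := rfl

theorem left_X_incl (i : ℕ) (m : A ⊗[k] OreExtension σ δ) :
    (outerE σ δ).left (X σ δ) ((decompLeft σ δ).incl i m)
      = (decompLeft σ δ).incl (i + 1) (LinearMap.rTensor _ σ.toLinearMap m)
        + (decompLeft σ δ).incl i (LinearMap.rTensor _ δ.toLin m) := by
  induction m with
  | zero => simp only [map_zero, add_zero]
  | add x y hx hy =>
    simp only [map_add, hx, hy]
    abel
  | tmul a e =>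
    change (outerE σ δ).left (X σ δ) ((C σ δ a * X σ δ ^ i) ⊗ₜ[k] e)
      = (C σ δ (σ a) * X σ δ ^ (i + 1)) ⊗ₜ[k] e + (C σ δ (δ.toLin a) * X σ δ ^ i) ⊗ₜ[k] e
    rw [outerE_left_tmul, ← TensorProduct.add_tmul, ← mul_assoc, X_mul_C, add_mul, pow_succ',
      mul_assoc]

theorem right_X_incl (i : ℕ) (m : A ⊗[k] OreExtension σ δ) :
    (outerE σ δ).right (MulOpposite.op (X σ δ)) ((decompLeft σ δ).incl i m)
      = (decompLeft σ δ).incl i (rxMid σ δ m) := by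
  induction m with
  | zero => simp only [map_zero]
  | add x y hx hy => simp only [map_add, hx, hy]
  | tmul a e => rfl

/-- From x a x^i = σ(a) x^{i+1} + δ(a) x^i: the leading term is the isomorphism σ ⊗ id into the next
summand, while everything else, including the right action of x, stays in the summand i. -/
theorem commX_incl (i n : ℕ) (f : Cochain k A (A ⊗[k] OreExtension σ δ) n) :
    commX (outerE σ δ) n (push k A ((decompLeft σ δ).incl i) n f)
      = push k A ((decompLeft σ δ).incl (i + 1)) n
          (push k A (LinearMap.rTensor _ σ.toLinearMap) n f)
        + push k A ((decompLeft σ δ).incl i) n (commMid σ δ n f) := by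
  rw [commX, skewCommutator_apply, skewRight_push σ δ (fun m => (right_X_incl σ δ i m).symm),
    commMid, skewCommutator_apply, map_sub (push k A ((decompLeft σ δ).incl i) n),
    ← add_sub_assoc]
  refine congrArg₂ (· - ·) ?_ rfl
  ext v
  rw [add_apply]
  exact left_X_incl σ δ i (f v)

/-- It is the component of index 0 of `commX` applied to f placed in the summand 0, and projection
to a summand preserves cocycles. -/
theorem commMid_mem_cocycles {n : ℕ} {f : Cochain k A (A ⊗[k] OreExtension σ δ) n}
    (hf : f ∈ cocycles (outerMid σ δ) n) :
    commMid σ δ n f ∈ cocycles (sigmaTwist σ (outerMid σ δ)) n := by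
  have h := push_mem_cocycles ((decompLeftTwist σ δ).proj_isHom 0)
    (commX_mem_cocycles (outerE σ δ) (push_mem_cocycles ((decompLeft σ δ).incl_isHom 0) hf))
  rw [commX_incl, map_add] at h
  have h1 := (decompLeft σ δ).push_proj_incl_of_ne (i := 1) (j := 0) one_ne_zero n
    (push k A (LinearMap.rTensor _ σ.toLinearMap) n f)
  have h2 := (decompLeft σ δ).push_proj_incl_self 0 n (commMid σ δ n f)
  change push k A ((decompLeft σ δ).proj 0) n _ + push k A ((decompLeft σ δ).proj 0) n _ ∈ _ at h
  rw [h1, h2, zero_add] at h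
  exact h

/-- Leading-term argument. With w = 0 it is the injectivity of the skew commutator on cohomology;
with general w it says that the summand 0 meets the image of the commutator trivially. -/
theorem mem_coboundaries_of_sum_commX (n : ℕ) (g : ℕ → Cochain k A (A ⊗[k] OreExtension σ δ) n)
    (w : Cochain k A (A ⊗[k] OreExtension σ δ) n)
    (N : ℕ) (h : push k A ((decompLeft σ δ).incl 0) n w + ∑ i ∈ Finset.range N,
        commX (outerE σ δ) n (push k A ((decompLeft σ δ).incl i) n (g i))
      ∈ coboundaries (resTwist (outerE σ δ)) n) :
    w ∈ coboundaries (sigmaTwist σ (outerMid σ δ)) n ∧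
      ∀ i < N, g i ∈ coboundaries (outerMid σ δ) n := by
  induction N with
  | zero =>
    rw [Finset.sum_range_zero, add_zero] at h
    refine ⟨?_, fun i hi => absurd hi (Nat.not_lt_zero i)⟩
    have h' := push_mem_coboundaries ((decompLeftTwist σ δ).proj_isHom 0) h
    rwa [show push k A ((decompLeftTwist σ δ).proj 0) n (push k A ((decompLeft σ δ).incl 0) n w) = w
      from (decompLeft σ δ).push_proj_incl_self 0 n w] at h'
  | succ N ih =>
    -- The component of index N+1 is σ applied to g N alone: all other terms, including w, have
    -- smaller index.
    have hN : g N ∈ coboundaries (outerMid σ δ) n := by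
      have h' := push_mem_coboundaries ((decompLeftTwist σ δ).proj_isHom (N + 1)) h
      change push k A ((decompLeft σ δ).proj (N + 1)) n _ ∈ _ at h'
      have hlt : ∀ i < N + 1, ∀ f,
          push k A ((decompLeft σ δ).proj (N + 1)) n (push k A ((decompLeft σ δ).incl i) n f) = 0 :=
        fun i hi f => (decompLeft σ δ).push_proj_incl_of_ne hi.ne n f
      rw [map_add, hlt 0 N.succ_pos, zero_add, map_sum, Finset.sum_range_succ,
        Finset.sum_eq_zero, zero_add, commX_incl, map_add, hlt N N.lt_succ_self, add_zero,
        (decompLeft σ δ).push_proj_incl_self] at h'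
      · exact push_sigma_mem_coboundaries_iff.1 h'
      · intro i hi
        have hi' := Finset.mem_range.1 hi
        rw [commX_incl, map_add, hlt i (by omega), hlt (i + 1) (by omega), add_zero]
    rw [Finset.sum_range_succ, ← add_assoc] at h
    have h3 := (Submodule.add_mem_iff_left _ (commX_mem_coboundaries (outerE σ δ)
      (push_mem_coboundaries ((decompLeft σ δ).incl_isHom N) hN))).1 h
    obtain ⟨h4, h5⟩ := ih h3
    refine ⟨h4, fun i hi => ?_⟩
    rcases (Nat.lt_succ_iff_lt_or_eq.1 hi) with h | rfl
    · exact h5 i h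
    · exact hN

variable {σ δ}

theorem mem_coboundaries_of_commX (hproj : Module.Projective k A)
    (hres : HasFGProjectiveResolution k A) {n : ℕ}
    {f : Cochain k A (OreExtension σ δ ⊗[k] OreExtension σ δ) n}
    (hf : f ∈ cocycles (res (outerE σ δ)) n)
    (h : commX (outerE σ δ) n f ∈ coboundaries (resTwist (outerE σ δ)) n) :
    f ∈ coboundaries (res (outerE σ δ)) n := by
  obtain ⟨N, hN⟩ := (decompLeft σ δ).exists_sub_sum_mem hproj hres hf
  have h1 := commX_mem_coboundaries (outerE σ δ) hN
  rw [map_sub, map_sum] at h1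
  have h2 := (Submodule.sub_mem_iff_right _ h).1 h1
  obtain ⟨-, h3⟩ := mem_coboundaries_of_sum_commX σ δ n
    (fun i => push k A ((decompLeft σ δ).proj i) n f) 0 N
    (by rwa [map_zero, zero_add])
  refine (Submodule.sub_mem_iff_left _ (Submodule.sum_mem _ fun i hi => ?_)).1 hN
  exact push_mem_coboundaries ((decompLeft σ δ).incl_isHom i) (h3 i (Finset.mem_range.1 hi))

theorem cocycles_outerMid_le (hproj : Module.Projective k A)
    (hres : HasFGProjectiveResolution k A) {n : ℕ} (h : Subsingleton (HHEnv k A n)) :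
    cocycles (outerMid σ δ) n ≤ coboundaries (outerMid σ δ) n :=
  (decompRight σ δ).cocycles_le hproj hres ((subsingleton_HH_iff _ _).1 h)

theorem cocycles_res_outerE_le (hproj : Module.Projective k A)
    (hres : HasFGProjectiveResolution k A) {n : ℕ} (h : Subsingleton (HHEnv k A n)) :
    cocycles (res (outerE σ δ)) n ≤ coboundaries (res (outerE σ δ)) n :=
  (decompLeft σ δ).cocycles_le hproj hres (cocycles_outerMid_le hproj hres h)

theorem cocycles_resTwist_outerE_le (hproj : Module.Projective k A)
    (hres : HasFGProjectiveResolution k A) {n : ℕ} (h : Subsingleton (HHEnv k A n)) :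
    cocycles (resTwist (outerE σ δ)) n ≤ coboundaries (resTwist (outerE σ δ)) n :=
  (decompLeftTwist σ δ).cocycles_le hproj hres
    (cocycles_sigmaTwist_le (cocycles_outerMid_le hproj hres h))

/-- The homotopy formula on cocycles: restrictions from E lie in the kernel of the skew commutator
on cohomology. -/
theorem commX_pullC_eq {M : Type*} [AddCommGroup M] [Module k M]
    (B : BimoduleStr k (OreExtension σ δ) M) {n : ℕ} {F : Cochain k (OreExtension σ δ) M (n + 1)}
    (hF : F ∈ cocycles B (n + 1)) : commX B (n + 1) (pullC σ δ M (n + 1) F)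
      = differential (resTwist B) n (insertC σ δ M n F) := by
  rw [← insertC_differential, mem_cocycles.1 hF, map_zero, zero_add]

theorem sub_mem_cocycles {M : Type*} [AddCommGroup M] [Module k M]
    (B : BimoduleStr k (OreExtension σ δ) M) {n : ℕ} {F : Cochain k (OreExtension σ δ) M (n + 1)}
    (hF : F ∈ cocycles B (n + 1)) {g : Cochain k A M n}
    (hg : pullC σ δ M (n + 1) F = differential (res B) n g) :
    insertC σ δ M n F - commX B n g ∈ cocycles (resTwist B) n := by
  rw [mem_cocycles, map_sub, differential_commX, ← hg, commX_pullC_eq B hF, sub_self]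

theorem pullC_mem_cocycles {M : Type*} [AddCommGroup M] [Module k M]
    (B : BimoduleStr k (OreExtension σ δ) M) {n : ℕ} {F : Cochain k (OreExtension σ δ) M n}
    (hF : F ∈ cocycles B n) : pullC σ δ M n F ∈ cocycles (res B) n := by
  rw [mem_cocycles, differential_pullC, mem_cocycles.1 hF, map_zero]

/-- Restriction to A is zero on cohomology in positive degrees, so every class of E comes from
twisted cohomology of A one degree lower. -/
theorem exists_pullC_eq (hproj : Module.Projective k A) (hres : HasFGProjectiveResolution k A)
    {d : ℕ} (hd : ∀ i : ℕ, i ≠ d → Subsingleton (HHEnv k A i)) {n : ℕ}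
    {F : Cochain k (OreExtension σ δ) (OreExtension σ δ ⊗[k] OreExtension σ δ) (n + 1)}
    (hF : F ∈ cocycles (outerE σ δ) (n + 1)) :
    ∃ g, pullC σ δ _ (n + 1) F = differential (res (outerE σ δ)) n g := by
  have h : pullC σ δ _ (n + 1) F ∈ coboundaries (res (outerE σ δ)) (n + 1) := by
    -- In degree d the cohomology over A need not vanish, but the restricted class is killed by the
    -- skew commutator, which is injective.
    by_cases hn : n + 1 = d
    · refine mem_coboundaries_of_commX hproj hres (pullC_mem_cocycles _ hF) ?_
      rw [commX_pullC_eq _ hF]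
      exact differential_mem_coboundaries _ _ _
    · exact cocycles_res_outerE_le hproj hres (hd _ hn) (pullC_mem_cocycles _ hF)
  obtain ⟨g, hg⟩ := h
  exact ⟨g, hg.symm⟩

theorem cocycles_outerE_le (hproj : Module.Projective k A) (hres : HasFGProjectiveResolution k A)
    {d : ℕ} (hd : ∀ i : ℕ, i ≠ d → Subsingleton (HHEnv k A i)) {i : ℕ} (hi : i ≠ d + 1) :
    cocycles (outerE σ δ) i ≤ coboundaries (outerE σ δ) i := by
  intro F hF
  cases i with
  | zero =>
    have h1 : pullC σ δ _ 0 F ∈ coboundaries (res (outerE σ δ)) 0 := by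
      refine mem_coboundaries_of_commX hproj hres (pullC_mem_cocycles _ hF) ?_
      rw [← insertC_differential_zero, mem_cocycles.1 hF, map_zero]
      exact zero_mem _
    -- Coboundaries of degree 0 are zero, and a 0-cochain is determined by its restriction.
    have h2 : pullC σ δ _ 0 F = 0 := h1
    change F = 0
    ext v
    have h3 := congrArg (fun f : Cochain k A _ 0 => f Fin.elim0) h2
    rw [Subsingleton.elim v fun i => (C σ δ) ((Fin.elim0 : Fin 0 → A) i)]
    exact h3
  | succ n =>
    obtain ⟨g, hg⟩ := exists_pullC_eq hproj hres hd hF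
    exact mem_coboundaries_of_insertC n _ _ F hF g hg
      (cocycles_resTwist_outerE_le hproj hres (hd n (by omega)) (sub_mem_cocycles _ hF hg))

end OreExtension

end

end OreHochschild

namespace OreHochschild

noncomputable section

/-! ### Cohomology of E as the cokernel of the skew commutator. -/

section Quotient

variable {R T P Q : Type*} [Ring R] [AddCommGroup T] [Module R T] [AddCommGroup P] [Module R P]
  [AddCommGroup Q] [Module R Q]

/-- Two quotients of a module with the same kernel are isomorphic. -/
def equivOfKerEq (p : T →ₗ[R] P) (q : T →ₗ[R] Q) (hp : Function.Surjective p)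
    (hq : Function.Surjective q) (h : LinearMap.ker p = LinearMap.ker q) : P ≃ₗ[R] Q :=
  (p.quotKerEquivOfSurjective hp).symm ≪≫ₗ Submodule.quotEquivOfEq _ _ h ≪≫ₗ
    q.quotKerEquivOfSurjective hq

theorem equivOfKerEq_apply (p : T →ₗ[R] P) (q : T →ₗ[R] Q) (hp : Function.Surjective p)
    (hq : Function.Surjective q) (h : LinearMap.ker p = LinearMap.ker q) (t : T) :
    equivOfKerEq p q hp hq h (p t) = q t := by
  have : (p.quotKerEquivOfSurjective hp).symm (p t) = Submodule.Quotient.mk t := by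
    rw [LinearEquiv.symm_apply_eq]
    rfl
  rw [equivOfKerEq, LinearEquiv.trans_apply, LinearEquiv.trans_apply, this]
  rfl

end Quotient

namespace OreExtension

universe u v

variable {k : Type u} {A : Type v} [CommRing k] [Ring A] [Algebra k A] {σ : A ≃ₐ[k] A}
  {δ : SkewDerivation σ} {M : Type v} [AddCommGroup M] [Module k M]
  (B : BimoduleStr k (OreExtension σ δ) M) (n : ℕ)

/-- The coboundaries and the skew commutators of `x` with cocycles. -/
def commBoundaries : Submodule k (Cochain k A M n) :=
  coboundaries (resTwist B) n ⊔ (cocycles (res B) n).map (commX B n)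

/-- The cokernel of the skew commutator with `x` on cohomology. -/
abbrev CommCoker : Type _ :=
  cocycles (resTwist B) n ⧸ (commBoundaries B n).comap (cocycles (resTwist B) n).subtype

/-- The class of a cocycle. -/
def CommCoker.mk : cocycles (resTwist B) n →ₗ[k] CommCoker B n := Submodule.mkQ _

theorem CommCoker.mk_surjective : Function.Surjective (CommCoker.mk B n) :=
  Submodule.mkQ_surjective _

theorem CommCoker.mk_eq_zero_iff (y : cocycles (resTwist B) n) :
    CommCoker.mk B n y = 0 ↔ y.1 ∈ commBoundaries B n :=
  (Submodule.Quotient.mk_eq_zero _).trans Iff.rfl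

theorem CommCoker.mk_eq_mk_iff (y z : cocycles (resTwist B) n) :
    CommCoker.mk B n y = CommCoker.mk B n z ↔ y.1 - z.1 ∈ commBoundaries B n := by
  rw [← sub_eq_zero, ← map_sub, CommCoker.mk_eq_zero_iff]
  rfl

theorem push_mem_commBoundaries {φ : M →ₗ[k] M} (hφ : B.IsHom B φ) {y : Cochain k A M n}
    (hy : y ∈ commBoundaries B n) : push k A φ n y ∈ commBoundaries B n := by
  obtain ⟨b, hb, _, ⟨z, hz, rfl⟩, rfl⟩ := Submodule.mem_sup.1 hy
  rw [map_add, ← commX_push hφ]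
  exact Submodule.add_mem_sup (push_mem_coboundaries (isHom_resTwist hφ) hb)
    ⟨_, push_mem_cocycles (isHom_res hφ) hz, rfl⟩

/-- Cocycles on `A[x; σ, δ]` with a trivialisation of their restrictions to `A`. -/
def trivialized : Submodule k (Cochain k (OreExtension σ δ) M (n + 1) × Cochain k A M n) where
  carrier := {x | x.1 ∈ cocycles B (n + 1) ∧ pullC σ δ M (n + 1) x.1 = differential (res B) n x.2}
  add_mem' := fun {x y} hx hy => ⟨add_mem hx.1 hy.1, by
    rw [Prod.fst_add, Prod.snd_add, map_add, map_add, hx.2, hy.2]⟩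
  zero_mem' := ⟨zero_mem _, by rw [Prod.fst_zero, Prod.snd_zero, map_zero, map_zero]⟩
  smul_mem' := fun c x hx => ⟨Submodule.smul_mem _ c hx.1, by
    rw [Prod.smul_fst, Prod.smul_snd, map_smul, map_smul, hx.2]⟩

/-- The class of a cocycle with trivialisation on `A[x; σ, δ]`. -/
def trivializedToHH : trivialized B n →ₗ[k] HH B (n + 1) :=
  HH.mk B (n + 1) ∘ₗ LinearMap.codRestrict _
    (LinearMap.fst k _ _ ∘ₗ (trivialized B n).subtype) fun t => t.2.1

/-- The cocycle on `A` attached to a cocycle on `A[x; σ, δ]` with trivialisation. -/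
def trivializedToCocycles : trivialized B n →ₗ[k] cocycles (resTwist B) n where
  toFun t := ⟨insertC σ δ M n t.1.1 - commX B n t.1.2, sub_mem_cocycles B t.2.1 t.2.2⟩
  map_add' s t := Subtype.ext <|
    (congrArg₂ (· - ·) (map_add (insertC σ δ M n) s.1.1 t.1.1)
      (map_add (commX B n) s.1.2 t.1.2)).trans (add_sub_add_comm _ _ _ _)
  map_smul' c t := Subtype.ext <|
    (congrArg₂ (· - ·) (map_smul (insertC σ δ M n) c t.1.1)
      (map_smul (commX B n) c t.1.2)).trans (smul_sub _ _ _).symm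

/-- The class of a cocycle with trivialisation in the cokernel of the skew commutator. -/
def trivializedToCoker : trivialized B n →ₗ[k] CommCoker B n :=
  CommCoker.mk B n ∘ₗ trivializedToCocycles B n

theorem trivializedToHH_apply (t : trivialized B n) :
    trivializedToHH B n t = HH.mk B (n + 1) ⟨t.1.1, t.2.1⟩ := rfl

theorem trivializedToCoker_apply (t : trivialized B n) :
    trivializedToCoker B n t = CommCoker.mk B n
      ⟨insertC σ δ M n t.1.1 - commX B n t.1.2, sub_mem_cocycles B t.2.1 t.2.2⟩ := rfl

theorem trivializedToCoker_surjective : Function.Surjective (trivializedToCoker B n) := by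
  intro κ
  obtain ⟨y, rfl⟩ := CommCoker.mk_surjective B n κ
  obtain ⟨F, hF, g, h1, h2⟩ := exists_insertC n M B y.1 y.2
  refine ⟨⟨(F, g), hF, h1⟩, ?_⟩
  rw [trivializedToCoker_apply, CommCoker.mk_eq_mk_iff]
  exact Submodule.mem_sup_left h2

theorem insertC_differential_sub_mem (G : Cochain k (OreExtension σ δ) M n) :
    insertC σ δ M n (differential B n G) - commX B n (pullC σ δ M n G)
      ∈ coboundaries (resTwist B) n := by
  cases n with
  | zero =>
    rw [insertC_differential_zero, sub_self]
    exact zero_mem _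
  | succ n =>
    rw [← insertC_differential, sub_add_cancel_left]
    exact neg_mem (differential_mem_coboundaries _ _ _)

/-- Well-definedness and injectivity of the comparison at once. Two trivialisations of the same
restriction differ by a cocycle z, which changes the attached cocycle by `commX` of z, and this is
exactly what the cokernel ignores. -/
theorem ker_trivialized_eq :
    LinearMap.ker (trivializedToHH B n) = LinearMap.ker (trivializedToCoker B n) := by
  ext ⟨⟨F, g⟩, hF, hg⟩
  rw [LinearMap.mem_ker, LinearMap.mem_ker, trivializedToHH_apply, trivializedToCoker_apply,
    HH.mk_eq_zero_iff, CommCoker.mk_eq_zero_iff]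
  constructor
  · rintro ⟨G, rfl⟩
    change pullC σ δ M (n + 1) (differential B n G) = differential (res B) n g at hg
    change insertC σ δ M n (differential B n G) - commX B n g ∈ _
    have h1 : pullC σ δ M n G - g ∈ cocycles (res B) n := by
      rw [mem_cocycles, map_sub, differential_pullC, hg, sub_self]
    have h2 := Submodule.add_mem_sup (insertC_differential_sub_mem B n G)
      (Submodule.mem_map_of_mem (f := commX B n) h1)
    rwa [map_sub, sub_add_sub_cancel] at h2
  · intro h
    obtain ⟨b, hb, _, ⟨z, hz, rfl⟩, h1⟩ := Submodule.mem_sup.1 h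
    -- Changing the trivialisation by z absorbs the commutator, and only a coboundary remains.
    refine mem_coboundaries_of_insertC n M B F hF (g + z) ?_ ?_
    · rw [map_add, mem_cocycles.1 hz, add_zero]
      exact hg
    · rw [map_add, ← sub_sub]
      change b + commX B n z = insertC σ δ M n F - commX B n g at h1
      rwa [← h1, add_sub_cancel_right]

variable {B n}

theorem trivializedToHH_surjective
    (hB : ∀ F ∈ cocycles B (n + 1), ∃ g, pullC σ δ M (n + 1) F = differential (res B) n g) :
    Function.Surjective (trivializedToHH B n) := by
  intro ξ
  obtain ⟨F, rfl⟩ := Submodule.mkQ_surjective _ ξ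
  obtain ⟨g, hg⟩ := hB F.1 F.2
  exact ⟨⟨(F.1, g), F.2, hg⟩, rfl⟩

/-- If all cocycles on `A[x; σ, δ]` are trivial on `A`, the cohomology of `A[x; σ, δ]` is the
cokernel of the skew commutator with `x` on the cohomology of `A` in degree one less. -/
def cohomologyEquivCoker
    (hB : ∀ F ∈ cocycles B (n + 1), ∃ g, pullC σ δ M (n + 1) F = differential (res B) n g) :
    HH B (n + 1) ≃ₗ[k] CommCoker B n :=
  equivOfKerEq (trivializedToHH B n) (trivializedToCoker B n) (trivializedToHH_surjective hB)
    (trivializedToCoker_surjective B n) (ker_trivialized_eq B n)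

/-- Naturality in the coefficients: a bimodule endomorphism acts on a cocycle and its trivialisation
together, and restriction, insertion and the skew commutator all commute with it. -/
theorem cohomologyEquivCoker_cohomologyMap
    (hB : ∀ F ∈ cocycles B (n + 1), ∃ g, pullC σ δ M (n + 1) F = differential (res B) n g)
    (φ : B.endo) (ξ : HH B (n + 1)) (y : cocycles (resTwist B) n)
    (h : cohomologyEquivCoker hB ξ = CommCoker.mk B n y) :
    cohomologyEquivCoker hB (cohomologyMap B (n + 1) φ ξ) = CommCoker.mk B n
      ⟨push k A φ.1 n y.1,
        push_mem_cocycles (isHom_resTwist (BimoduleStr.mem_endo.1 φ.2)) y.2⟩ := by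
  have hφ := BimoduleStr.mem_endo.1 φ.2
  obtain ⟨⟨⟨F, g⟩, hF, hg⟩, rfl⟩ := trivializedToHH_surjective hB ξ
  have hF' : push k (OreExtension σ δ) φ.1 (n + 1) F ∈ cocycles B (n + 1) :=
    push_mem_cocycles hφ hF
  have hg' : pullC σ δ M (n + 1) (push k (OreExtension σ δ) φ.1 (n + 1) F)
      = differential (res B) n (push k A φ.1 n g) := by
    rw [differential_push (isHom_res hφ), pullC_push]
    exact congrArg _ hg
  have h1 : cohomologyMap B (n + 1) φ (trivializedToHH B n ⟨(F, g), hF, hg⟩)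
      = trivializedToHH B n ⟨(push k (OreExtension σ δ) φ.1 (n + 1) F, push k A φ.1 n g),
        hF', hg'⟩ := rfl
  rw [h1]
  rw [cohomologyEquivCoker, equivOfKerEq_apply, trivializedToCoker_apply,
    CommCoker.mk_eq_mk_iff] at h ⊢
  have h2 := push_mem_commBoundaries B n hφ h
  rw [map_sub, map_sub, ← commX_push hφ, ← insertX_push] at h2
  exact h2

end OreExtension

end

end OreHochschild

namespace OreHochschild

noncomputable section

universe u v

/-! ### The cokernel as ω' ⊗ k[x]. -/

section Restriction

variable {k : Type u} {A : Type v} [CommRing k] [Ring A] [Algebra k A] (σ : A ≃ₐ[k] A)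

/-- Precomposition with σ trades the twist by σ⁻¹ on the right for the twist by σ on the left; this
is where ω' enters. -/
theorem isRestriction_sigma : IsRestriction (sigmaTwist σ (outerTwisted k (AlgHom.id k A)))
    (outerTwisted k (sigmaInv σ)) (σ : A →ₐ[k] A) := by
  refine ⟨fun t => rfl, fun t => TensorProduct.ext' fun x y => ?_⟩
  exact congrArg (fun z => x ⊗ₜ[k] (y * z)) (σ.symm_apply_apply t).symm

theorem isRestriction_sigmaInv : IsRestriction (outerTwisted k (sigmaInv σ))
    (sigmaTwist σ (outerTwisted k (AlgHom.id k A))) (sigmaInv σ) := by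
  refine ⟨fun t => TensorProduct.ext' fun x y => ?_, fun t => rfl⟩
  exact congrArg (fun z => (z * x) ⊗ₜ[k] y) (σ.apply_symm_apply t).symm

theorem pull_sigma_pull_sigmaInv {M : Type*} [AddCommGroup M] [Module k M] (n : ℕ)
    (f : Cochain k A M n) : pull M (σ : A →ₐ[k] A).toLinearMap n
      (pull M (sigmaInv σ).toLinearMap n f) = f := by
  ext v
  rw [pull_apply, pull_apply]
  exact congrArg f (funext fun i => σ.symm_apply_apply (v i))

theorem pull_sigmaInv_pull_sigma {M : Type*} [AddCommGroup M] [Module k M] (n : ℕ)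
    (f : Cochain k A M n) : pull M (sigmaInv σ).toLinearMap n
      (pull M (σ : A →ₐ[k] A).toLinearMap n f) = f := by
  ext v
  rw [pull_apply, pull_apply]
  exact congrArg f (funext fun i => σ.apply_symm_apply (v i))

variable {σ}

theorem pull_sigma_mem_coboundaries_iff {n : ℕ} {f : Cochain k A (A ⊗[k] A) n} :
    pull _ (σ : A →ₐ[k] A).toLinearMap n f
        ∈ coboundaries (sigmaTwist σ (outerTwisted k (AlgHom.id k A))) n
      ↔ f ∈ coboundaries (outerTwisted k (sigmaInv σ)) n := by
  refine ⟨fun h => ?_, pull_mem_coboundaries (isRestriction_sigma σ)⟩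
  rw [← pull_sigmaInv_pull_sigma σ n f]
  exact pull_mem_coboundaries (isRestriction_sigmaInv σ) h

theorem pull_sigma_mem_cocycles_iff {n : ℕ} {f : Cochain k A (A ⊗[k] A) n} :
    pull _ (σ : A →ₐ[k] A).toLinearMap n f
        ∈ cocycles (sigmaTwist σ (outerTwisted k (AlgHom.id k A))) n
      ↔ f ∈ cocycles (outerTwisted k (sigmaInv σ)) n := by
  refine ⟨fun h => ?_, pull_mem_cocycles (isRestriction_sigma σ)⟩
  rw [← pull_sigmaInv_pull_sigma σ n f]
  exact pull_mem_cocycles (isRestriction_sigmaInv σ) h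

end Restriction

theorem exists_eq_sum_tmul_X_pow {k W : Type*} [CommRing k] [AddCommGroup W] [Module k W]
    (t : W ⊗[k] k[X]) : ∃ (c : ℕ → W) (N : ℕ),
      t = ∑ n ∈ Finset.range N, c n ⊗ₜ[k] (Polynomial.X ^ n : k[X]) := by
  induction t with
  | zero => exact ⟨0, 0, rfl⟩
  | tmul w p =>
    refine ⟨fun n => p.coeff n • w, p.natDegree + 1, ?_⟩
    conv_lhs => rw [p.as_sum_range_C_mul_X_pow]
    rw [TensorProduct.tmul_sum]
    refine Finset.sum_congr rfl fun n _ => ?_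
    rw [TensorProduct.smul_tmul, Polynomial.smul_eq_C_mul]
  | add x y hx hy =>
    obtain ⟨c, N, rfl⟩ := hx
    obtain ⟨c', N', rfl⟩ := hy
    refine ⟨fun n => (if n < N then c n else 0) + (if n < N' then c' n else 0), max N N', ?_⟩
    have h : ∀ (e : ℕ → W) (L : ℕ), L ≤ max N N' →
        ∑ n ∈ Finset.range L, e n ⊗ₜ[k] (Polynomial.X ^ n : k[X])
          = ∑ n ∈ Finset.range (max N N'),
            (if n < L then e n else 0) ⊗ₜ[k] (Polynomial.X ^ n : k[X]) := by
      intro e L hL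
      rw [← Finset.sum_subset (Finset.range_subset_range.2 hL)]
      · exact Finset.sum_congr rfl fun n hn => by rw [if_pos (Finset.mem_range.1 hn)]
      · intro n _ hn
        rw [if_neg (fun h => hn (Finset.mem_range.2 h)), TensorProduct.zero_tmul]
    rw [h c N (le_max_left _ _), h c' N' (le_max_right _ _), ← Finset.sum_add_distrib]
    exact Finset.sum_congr rfl fun n _ => (TensorProduct.add_tmul _ _ _).symm

namespace OreExtension

variable {k : Type u} {A : Type v} [CommRing k] [Ring A] [Algebra k A] (σ : A ≃ₐ[k] A)
  (δ : SkewDerivation σ)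

theorem commBoundaries_le_cocycles {M : Type v} [AddCommGroup M] [Module k M]
    (B : BimoduleStr k (OreExtension σ δ) M) (n : ℕ) :
    commBoundaries B n ≤ cocycles (resTwist B) n := by
  refine sup_le (coboundaries_le_cocycles _ _) ?_
  rintro _ ⟨z, hz, rfl⟩
  exact commX_mem_cocycles B hz

theorem push_incl_mem_commBoundaries (i : ℕ) {n : ℕ} {w : Cochain k A (A ⊗[k] OreExtension σ δ) n}
    (hw : w ∈ coboundaries (sigmaTwist σ (outerMid σ δ)) n) :
    push k A ((decompLeft σ δ).incl i) n w ∈ commBoundaries (outerE σ δ) n :=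
  Submodule.mem_sup_left (push_mem_coboundaries ((decompLeftTwist σ δ).incl_isHom i) hw)

-- Injectivity of the summand 0 into the cokernel: z is replaced, up to coboundaries, by the finite
-- sum of its components, and the leading-term argument applies with these components negated.
variable {σ δ} in
theorem mem_coboundaries_of_push_incl_mem (hproj : Module.Projective k A)
    (hres : HasFGProjectiveResolution k A) {n : ℕ} {w : Cochain k A (A ⊗[k] OreExtension σ δ) n}
    (h : push k A ((decompLeft σ δ).incl 0) n w ∈ commBoundaries (outerE σ δ) n) :
    w ∈ coboundaries (sigmaTwist σ (outerMid σ δ)) n := by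
  obtain ⟨b, hb, _, ⟨z, hz, rfl⟩, h1⟩ := Submodule.mem_sup.1 h
  obtain ⟨N, hN⟩ := (decompLeft σ δ).exists_sub_sum_mem hproj hres hz
  refine (mem_coboundaries_of_sum_commX σ δ n (fun i => -push k A ((decompLeft σ δ).proj i) n z)
    w N ?_).1
  have h2 := add_mem hb (commX_mem_coboundaries (outerE σ δ) hN)
  rw [map_sub, map_sum, ← add_sub_assoc] at h2
  rw [← h1]
  have h3 : ∀ i, commX (outerE σ δ) n (push k A ((decompLeft σ δ).incl i) n
        (-push k A ((decompLeft σ δ).proj i) n z))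
      = -commX (outerE σ δ) n (push k A ((decompLeft σ δ).incl i) n
        (push k A ((decompLeft σ δ).proj i) n z)) := fun i => by
    rw [map_neg (push k A ((decompLeft σ δ).incl i) n), map_neg]
  rw [Finset.sum_congr rfl fun i _ => h3 i, Finset.sum_neg_distrib, ← sub_eq_add_neg]
  exact h2

/-- The map `f ↦ (1 ⊗ xⁿ) (f ∘ σ^{⊗ d})` on cochains. -/
def monoCochain (n d : ℕ) :
    Cochain k A (A ⊗[k] A) d →ₗ[k] Cochain k A (OreExtension σ δ ⊗[k] OreExtension σ δ) d :=
  push k A ((decompLeft σ δ).incl 0) d ∘ₗ push k A ((decompRight σ δ).incl n) d ∘ₗ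
    pull _ (σ : A →ₐ[k] A).toLinearMap d

theorem monoCochain_apply (n d : ℕ) (f : Cochain k A (A ⊗[k] A) d) :
    monoCochain σ δ n d f = push k A ((decompLeft σ δ).incl 0) d
      (push k A ((decompRight σ δ).incl n) d (pull _ (σ : A →ₐ[k] A).toLinearMap d f)) := rfl

variable {d : ℕ}

theorem monoCochain_mem_cocycles (n : ℕ) {f : Cochain k A (A ⊗[k] A) d}
    (hf : f ∈ cocycles (outerTwisted k (sigmaInv σ)) d) :
    monoCochain σ δ n d f ∈ cocycles (resTwist (outerE σ δ)) d :=
  push_mem_cocycles ((decompLeftTwist σ δ).incl_isHom 0)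
    (push_mem_cocycles (((decompRight σ δ).twist σ).incl_isHom n)
      (pull_mem_cocycles (isRestriction_sigma σ) hf))

theorem monoCochain_mem_coboundaries (n : ℕ) {f : Cochain k A (A ⊗[k] A) d}
    (hf : f ∈ coboundaries (outerTwisted k (sigmaInv σ)) d) :
    monoCochain σ δ n d f ∈ coboundaries (resTwist (outerE σ δ)) d :=
  push_mem_coboundaries ((decompLeftTwist σ δ).incl_isHom 0)
    (push_mem_coboundaries (((decompRight σ δ).twist σ).incl_isHom n)
      (pull_mem_coboundaries (isRestriction_sigma σ) hf))

variable (d)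

/-- The map induced by `monoCochain` on cocycles. -/
def monoCocycle (n : ℕ) : cocycles (outerTwisted k (sigmaInv σ)) d →ₗ[k]
    cocycles (resTwist (outerE σ δ)) d where
  toFun f := ⟨monoCochain σ δ n d f.1, monoCochain_mem_cocycles σ δ n f.2⟩
  map_add' f g := Subtype.ext (map_add (monoCochain σ δ n d) f.1 g.1)
  map_smul' c f := Subtype.ext (map_smul (monoCochain σ δ n d) c f.1)

/-- The map induced by `monoCochain` on cohomology. -/
def monoHH (n : ℕ) : HHTwisted k (sigmaInv σ) d →ₗ[k] CommCoker (outerE σ δ) d :=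
  Submodule.mapQ _ _ (monoCocycle σ δ d n) fun _ hf =>
    Submodule.mem_sup_left (monoCochain_mem_coboundaries σ δ n hf)

theorem monoHH_mk (n : ℕ) (f : cocycles (outerTwisted k (sigmaInv σ)) d) :
    monoHH σ δ d n (HH.mk _ d f) = CommCoker.mk _ d (monoCocycle σ δ d n f) := rfl

/-- The map `[f] ⊗ xⁿ ↦ [(1 ⊗ xⁿ) (f ∘ σ^{⊗ d})]`. -/
def tensorToCoker : HHTwisted k (sigmaInv σ) d ⊗[k] k[X] →ₗ[k] CommCoker (outerE σ δ) d :=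
  TensorProduct.lift ((Polynomial.basisMonomials k).constr k (monoHH σ δ d)).flip

theorem tensorToCoker_tmul (w : HHTwisted k (sigmaInv σ) d) (n : ℕ) :
    tensorToCoker σ δ d (w ⊗ₜ[k] (Polynomial.X ^ n : k[X])) = monoHH σ δ d n w := by
  rw [tensorToCoker, TensorProduct.lift.tmul, LinearMap.flip_apply, Polynomial.X_pow_eq_monomial]
  have h := (Polynomial.basisMonomials k).constr_basis k (monoHH σ δ d) n
  rw [Polynomial.coe_basisMonomials] at h
  exact LinearMap.congr_fun h w

/-- The cocycles whose class is in the range of `tensorToCoker`. -/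
def tensorRange : Submodule k (Cochain k A (OreExtension σ δ ⊗[k] OreExtension σ δ) d) :=
  ((LinearMap.range (tensorToCoker σ δ d)).comap (CommCoker.mk _ d)).map (Submodule.subtype _)

theorem commBoundaries_le_tensorRange :
    commBoundaries (outerE σ δ) d ≤ tensorRange σ δ d := by
  intro y hy
  refine ⟨⟨y, commBoundaries_le_cocycles σ δ _ _ hy⟩, ?_, rfl⟩
  refine Submodule.mem_comap.2 ?_
  rw [(CommCoker.mk_eq_zero_iff _ d _).2 hy]
  exact zero_mem _

theorem monoCochain_mem_tensorRange (n : ℕ) {f : Cochain k A (A ⊗[k] A) d}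
    (hf : f ∈ cocycles (outerTwisted k (sigmaInv σ)) d) :
    monoCochain σ δ n d f ∈ tensorRange σ δ d :=
  ⟨monoCocycle σ δ d n ⟨f, hf⟩,
    ⟨HH.mk _ d ⟨f, hf⟩ ⊗ₜ[k] (Polynomial.X ^ n : k[X]), tensorToCoker_tmul σ δ d _ n⟩, rfl⟩

variable {σ δ d}

/-- Lowering the power of x in the left factor: modulo skew commutators, a cocycle w in the summand
i+1 is the negative of `commMid` of σ⁻¹ w in the summand i. In the summand 0, w splits into finitely
many components along the right factor. -/
theorem push_incl_mem_tensorRange (hproj : Module.Projective k A)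
    (hres : HasFGProjectiveResolution k A) (i : ℕ) :
    ∀ {w : Cochain k A (A ⊗[k] OreExtension σ δ) d},
      w ∈ cocycles (sigmaTwist σ (outerMid σ δ)) d →
      push k A ((decompLeft σ δ).incl i) d w ∈ tensorRange σ δ d := by
  induction i with
  | zero =>
    intro w hw
    obtain ⟨n, hn⟩ := ((decompRight σ δ).twist σ).exists_sub_sum_mem hproj hres hw
    have h1 := commBoundaries_le_tensorRange σ δ d (push_incl_mem_commBoundaries σ δ 0 hn)
    rw [map_sub (push k A ((decompLeft σ δ).incl 0) d),
      map_sum (push k A ((decompLeft σ δ).incl 0) d)] at h1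
    refine (Submodule.sub_mem_iff_left _ (Submodule.sum_mem _ fun i _ => ?_)).1 h1
    have h2 := push_mem_cocycles (((decompRight σ δ).twist σ).proj_isHom i) hw
    have h3 := monoCochain_mem_tensorRange σ δ d i (pull_mem_cocycles (isRestriction_sigmaInv σ) h2)
    rw [monoCochain_apply, pull_sigma_pull_sigmaInv] at h3
    exact h3
  | succ i ih =>
    intro w hw
    have hg := push_mem_cocycles (isHom_rTensor_sigma_symm σ
      ((BimoduleStr.regular k (OreExtension σ δ)).twist (C σ δ) (C σ δ))) hw
    have h1 : commX (outerE σ δ) d (push k A ((decompLeft σ δ).incl i) d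
        (push k A (LinearMap.rTensor _ σ.symm.toLinearMap) d w)) ∈ commBoundaries (outerE σ δ) d :=
      Submodule.mem_sup_right ⟨_, push_mem_cocycles ((decompLeft σ δ).incl_isHom i) hg, rfl⟩
    rw [commX_incl, push_sigma_push_sigma_symm] at h1
    exact (Submodule.add_mem_iff_left _ (ih (commMid_mem_cocycles σ δ hg))).1
      (commBoundaries_le_tensorRange σ δ d h1)

theorem tensorToCoker_surjective (hproj : Module.Projective k A)
    (hres : HasFGProjectiveResolution k A) : Function.Surjective (tensorToCoker σ δ d) := by
  intro κ
  obtain ⟨y, rfl⟩ := CommCoker.mk_surjective _ d κ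
  obtain ⟨n, hn⟩ := (decompLeftTwist σ δ).exists_sub_sum_mem hproj hres y.2
  have h1 := commBoundaries_le_tensorRange σ δ d (Submodule.mem_sup_left hn)
  have h2 : y.1 ∈ tensorRange σ δ d :=
    (Submodule.sub_mem_iff_left _ (Submodule.sum_mem _ fun i _ => push_incl_mem_tensorRange
      hproj hres i (push_mem_cocycles ((decompLeftTwist σ δ).proj_isHom i) y.2))).1 h1
  obtain ⟨z, hz, h3⟩ := h2
  obtain rfl : z = y := Subtype.ext h3
  exact hz

theorem tensorToCoker_injective (hproj : Module.Projective k A)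
    (hres : HasFGProjectiveResolution k A) : Function.Injective (tensorToCoker σ δ d) := by
  rw [injective_iff_map_eq_zero]
  intro t ht
  obtain ⟨c, N, rfl⟩ := exists_eq_sum_tmul_X_pow t
  choose g hg using fun n => Submodule.mkQ_surjective _ (c n)
  have h1 : CommCoker.mk (outerE σ δ) d (∑ n ∈ Finset.range N, monoCocycle σ δ d n (g n)) = 0 := by
    rw [← ht, map_sum, map_sum]
    refine Finset.sum_congr rfl fun n _ => ?_
    rw [tensorToCoker_tmul, ← monoHH_mk]
    exact congrArg _ (hg n)
  rw [CommCoker.mk_eq_zero_iff] at h1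
  have h2 : push k A ((decompLeft σ δ).incl 0) d (∑ n ∈ Finset.range N,
      push k A ((decompRight σ δ).incl n) d (pull _ (σ : A →ₐ[k] A).toLinearMap d (g n).1))
        ∈ commBoundaries (outerE σ δ) d := by
    rw [map_sum]
    rwa [AddSubmonoidClass.coe_finsetSum] at h1
  have h3 := mem_coboundaries_of_push_incl_mem hproj hres h2
  refine Finset.sum_eq_zero fun n hn => ?_
  have h4 := push_mem_coboundaries (((decompRight σ δ).twist σ).proj_isHom n) h3
  change push k A ((decompRight σ δ).proj n) d _ ∈ _ at h4
  -- Different powers of x in the right factor are independent, so each coefficient is a coboundary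
  -- on its own.
  rw [map_sum, Finset.sum_eq_single n (fun j _ hj =>
      (decompRight σ δ).push_proj_incl_of_ne hj d _) (fun h => absurd hn h),
    (decompRight σ δ).push_proj_incl_self] at h4
  have h6 : c n = 0 := by
    rw [← hg n]
    exact (HH.mk_eq_zero_iff _ d (g n)).2 (pull_sigma_mem_coboundaries_iff.1 h4)
  rw [h6, TensorProduct.zero_tmul]

/-- The isomorphism `ω' ⊗ k[x] ≅ coker`. -/
def tensorEquivCoker (hproj : Module.Projective k A) (hres : HasFGProjectiveResolution k A) :
    HHTwisted k (sigmaInv σ) d ⊗[k] k[X] ≃ₗ[k] CommCoker (outerE σ δ) d :=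
  LinearEquiv.ofBijective (tensorToCoker σ δ d)
    ⟨tensorToCoker_injective hproj hres, tensorToCoker_surjective hproj hres⟩

end OreExtension

end

end OreHochschild

namespace OreHochschild

noncomputable section

universe u v

/-! ### Transport of structure, and the inner actions on cochains. -/

section Transport

variable {k S M N : Type*} [CommRing k] [Ring S] [Algebra k S] [AddCommGroup M] [Module k M]
  [AddCommGroup N] [Module k N]

/-- Transport of a bimodule structure along a linear isomorphism. -/
def BimoduleStr.transport (B : BimoduleStr k S M) (Φ : M ≃ₗ[k] N) : BimoduleStr k S N where
  left := (Φ.conjAlgEquiv k).toAlgHom.comp B.left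
  right := (Φ.conjAlgEquiv k).toAlgHom.comp B.right
  comm a b := (B.comm a b).map (Φ.conjAlgEquiv k).toAlgHom

theorem BimoduleStr.isHom_transport (B : BimoduleStr k S M) (Φ : M ≃ₗ[k] N) :
    B.IsHom (B.transport Φ) Φ.toLinearMap := by
  refine ⟨fun s m => ?_, fun s m => ?_⟩
  · change Φ (B.left s m) = Φ (B.left s (Φ.symm (Φ m)))
    rw [Φ.symm_apply_apply]
  · change Φ (B.right s m) = Φ (B.right s (Φ.symm (Φ m)))
    rw [Φ.symm_apply_apply]

end Transport

namespace OreExtension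

section Formulas

variable {k : Type u} {A : Type v} [CommRing k] [Ring A] [Algebra k A] (σ : A ≃ₐ[k] A)
  (δ : SkewDerivation σ)

theorem innerE_left_incl (e : OreExtension σ δ) (u : A) (w : OreExtension σ δ) :
    (innerTwisted k (AlgHom.id k (OreExtension σ δ))).left e
      ((decompLeft σ δ).incl 0 (u ⊗ₜ[k] w)) = (decompLeft σ δ).incl 0 (u ⊗ₜ[k] (e * w)) := rfl

theorem decompRight_incl_tmul (n : ℕ) (u w : A) :
    (decompRight σ δ).incl n (u ⊗ₜ[k] w) = u ⊗ₜ[k] (X σ δ ^ n * C σ δ w) := rfl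

theorem innerE_left_C (a : A) (n : ℕ) (m : A ⊗[k] A) :
    (innerTwisted k (AlgHom.id k (OreExtension σ δ))).left (C σ δ a)
      ((decompLeft σ δ).incl 0 ((decompRight σ δ).incl n m))
    = ∑ i ∈ Finset.range (n + 1), (decompLeft σ δ).incl 0 ((decompRight σ δ).incl i
        ((innerTwisted k (sigmaInv σ)).left (qMap σ δ n i a) m)) := by
  induction m with
  | zero => simp only [map_zero, Finset.sum_const_zero]
  | add x y hx hy => simp only [map_add, hx, hy, Finset.sum_add_distrib]
  | tmul u w =>
    have h : ∀ i, (decompRight σ δ).incl i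
        ((innerTwisted k (sigmaInv σ)).left (qMap σ δ n i a) (u ⊗ₜ[k] w))
        = u ⊗ₜ[k] (X σ δ ^ i * C σ δ (qMap σ δ n i a) * C σ δ w) := by
      intro i
      rw [mul_assoc, ← map_mul]
      rfl
    rw [decompRight_incl_tmul, innerE_left_incl, ← mul_assoc, C_mul_X_pow_eq_sum, Finset.sum_mul,
      TensorProduct.tmul_sum, map_sum]
    exact Finset.sum_congr rfl fun i _ => by rw [h]

theorem innerE_left_X (n : ℕ) (m : A ⊗[k] A) :
    (innerTwisted k (AlgHom.id k (OreExtension σ δ))).left (X σ δ)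
      ((decompLeft σ δ).incl 0 ((decompRight σ δ).incl n m))
    = (decompLeft σ δ).incl 0 ((decompRight σ δ).incl (n + 1) m) := by
  induction m with
  | zero => simp only [map_zero]
  | add x y hx hy => simp only [map_add, hx, hy]
  | tmul u w =>
    rw [decompRight_incl_tmul, innerE_left_incl, decompRight_incl_tmul, pow_succ', mul_assoc]

theorem innerE_right_C (a : A) (n : ℕ) (m : A ⊗[k] A) :
    (innerTwisted k (AlgHom.id k (OreExtension σ δ))).right (MulOpposite.op (C σ δ a))
      ((decompLeft σ δ).incl 0 ((decompRight σ δ).incl n m))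
    = (decompLeft σ δ).incl 0 ((decompRight σ δ).incl n
        ((innerTwisted k (sigmaInv σ)).right (MulOpposite.op a) m)) := by
  induction m with
  | zero => simp only [map_zero]
  | add x y hx hy => simp only [map_add, hx, hy]
  | tmul u w =>
    change (C σ δ u * X σ δ ^ 0 * C σ δ a) ⊗ₜ[k] (X σ δ ^ n * C σ δ w)
      = (C σ δ (u * a) * X σ δ ^ 0) ⊗ₜ[k] (X σ δ ^ n * C σ δ w)
    rw [pow_zero, mul_one, mul_one, map_mul]

theorem innerE_right_X (m : A ⊗[k] OreExtension σ δ) :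
    (innerTwisted k (AlgHom.id k (OreExtension σ δ))).right (MulOpposite.op (X σ δ))
      ((decompLeft σ δ).incl 0 m) = (decompLeft σ δ).incl 1 m := by
  induction m with
  | zero => simp only [map_zero]
  | add x y hx hy => simp only [map_add, hx, hy]
  | tmul u w =>
    change (C σ δ u * X σ δ ^ 0 * X σ δ) ⊗ₜ[k] w = (C σ δ u * X σ δ ^ 1) ⊗ₜ[k] w
    rw [pow_zero, mul_one, pow_one]

/-- The relation bx = xσ⁻¹(b) − δσ⁻¹(b) in the right factor; its two terms account for f₂ and for
the middle term of f₃. -/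
theorem rxMid_incl (n : ℕ) (m : A ⊗[k] A) :
    rxMid σ δ ((decompRight σ δ).incl n m)
      = (decompRight σ δ).incl (n + 1) (LinearMap.lTensor A σ.symm.toLinearMap m)
        - (decompRight σ δ).incl n (LinearMap.lTensor A (deltaSigmaInv σ δ) m) := by
  induction m with
  | zero => simp only [map_zero, sub_zero]
  | add x y hx hy =>
    simp only [map_add, hx, hy]
    abel
  | tmul u w =>
    change u ⊗ₜ[k] (X σ δ ^ n * C σ δ w * X σ δ)
      = u ⊗ₜ[k] (X σ δ ^ (n + 1) * C σ δ (σ.symm w))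
        - u ⊗ₜ[k] (X σ δ ^ n * C σ δ (δ.toLin (σ.symm w)))
    rw [mul_assoc, C_mul_X, mul_sub, TensorProduct.tmul_sub, pow_succ, mul_assoc]

theorem f₃_sigma_apply {d : ℕ} (f : Cochain k A (A ⊗[k] A) d) (v : Fin d → A) :
    f₃ σ δ f (fun i => σ (v i)) = LinearMap.rTensor A δ.toLin (f v)
      + LinearMap.lTensor A (deltaSigmaInv σ δ) (f fun i => σ (v i))
      - ∑ j : Fin d, f fun i =>
          if i < j then σ (v i) else if i = j then δ.toLin (v i) else v i := by
  have h : ∀ w : A, σ.symm.toLinearMap (σ w) = w := σ.symm_apply_apply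
  have h' : ∀ w : A, deltaSigmaInv σ δ (σ w) = δ.toLin w := fun w =>
    congrArg δ.toLin (σ.symm_apply_apply w)
  simp only [f₃, sub_apply, add_apply, sum_apply, LinearMap.compMultilinearMap_apply,
    MultilinearMap.compLinearMap_apply, h]
  refine congrArg₂ (· - ·) rfl (Finset.sum_congr rfl fun j _ => congrArg f (funext fun i => ?_))
  split_ifs
  · rfl
  · exact h' _
  · exact h _

/-- Collects the degree-preserving part of the commutator by powers of x in the right factor: right
multiplication by x raises the power and gives f₂, all terms that contain δ give f₃. -/
theorem commMid_incl (n : ℕ) {d : ℕ} (f : Cochain k A (A ⊗[k] A) d) :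
    commMid σ δ d (push k A ((decompRight σ δ).incl n) d f)
      = push k A ((decompRight σ δ).incl n) d
          (pull _ (σ : A →ₐ[k] A).toLinearMap d (f₃ σ δ f))
        - push k A ((decompRight σ δ).incl (n + 1)) d
          (pull _ (σ : A →ₐ[k] A).toLinearMap d (f₂ σ f)) := by
  have h : ∀ m : A ⊗[k] A, LinearMap.rTensor _ δ.toLin ((decompRight σ δ).incl n m)
      = (decompRight σ δ).incl n (LinearMap.rTensor A δ.toLin m) := fun m =>
    LinearMap.congr_fun ((LinearMap.rTensor_comp_lTensor A δ.toLin (rightMono σ δ n)).trans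
      (LinearMap.lTensor_comp_rTensor A δ.toLin (rightMono σ δ n)).symm) m
  ext v
  have h3 : pull _ (σ : A →ₐ[k] A).toLinearMap d (f₃ σ δ f) v = _ := f₃_sigma_apply σ δ f v
  have h2 : pull _ (σ : A →ₐ[k] A).toLinearMap d (f₂ σ f) v
    = LinearMap.lTensor A σ.symm.toLinearMap (f fun i => σ (v i)) := rfl
  rw [commMid, skewCommutator_apply, sub_apply, sub_apply, skewRight_eq, push_apply, push_apply,
    push_apply, push_apply, push_apply, h3, h2, map_sub ((decompRight σ δ).incl n),
    map_add ((decompRight σ δ).incl n), map_sum ((decompRight σ δ).incl n), h, rxMid_incl]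
  simp only [push_apply]
  abel

end Formulas

end OreExtension

end

end OreHochschild

namespace OreHochschild

noncomputable section

universe u v

/-! ### The right action of x and the isomorphism for Ω. -/

namespace OreExtension

variable {k : Type u} {A : Type v} [CommRing k] [Ring A] [Algebra k A] (σ : A ≃ₐ[k] A)
  (δ : SkewDerivation σ) {d : ℕ}

theorem untwist_mem_cocycles {f : Cochain k A (A ⊗[k] A) d}
    (hf : f ∈ cocycles (outerTwisted k (sigmaInv σ)) d) :
    untwist σ f ∈ cocycles (outerTwisted k (AlgHom.id k A)) d :=
  push_mem_cocycles (isHom_rTensor_sigma_symm σ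
    ((BimoduleStr.regular k A).twist (AlgHom.id k A) (AlgHom.id k A)))
    (pull_mem_cocycles (isRestriction_sigma σ) hf)

/-- The factor σ⁻¹ in `untwist` is chosen to cancel the σ in the leading term of `commX_incl`. -/
theorem push_sigma_push_untwist (n : ℕ) (f : Cochain k A (A ⊗[k] A) d) :
    push k A (LinearMap.rTensor _ σ.toLinearMap) d
        (push k A ((decompRight σ δ).incl n) d (untwist σ f))
      = push k A ((decompRight σ δ).incl n) d (pull _ (σ : A →ₐ[k] A).toLinearMap d f) := by
  have h : ∀ m : A ⊗[k] A, LinearMap.rTensor _ σ.toLinearMap ((decompRight σ δ).incl n m)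
      = (decompRight σ δ).incl n (LinearMap.rTensor A σ.toLinearMap m) := fun m =>
    LinearMap.congr_fun
      ((LinearMap.rTensor_comp_lTensor A σ.toLinearMap (rightMono σ δ n)).trans
        (LinearMap.lTensor_comp_rTensor A σ.toLinearMap (rightMono σ δ n)).symm) m
  rw [← push_sigma_push_sigma_symm A σ d (pull _ (σ : A →ₐ[k] A).toLinearMap d f)]
  ext v
  exact h _

/-- Moving `x` across the first tensor factor. -/
theorem push_incl_one_sub_mem (n : ℕ) {f : Cochain k A (A ⊗[k] A) d}
    (hf : f ∈ cocycles (outerTwisted k (sigmaInv σ)) d) :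
    push k A ((decompLeft σ δ).incl 1) d (push k A ((decompRight σ δ).incl n) d
        (pull _ (σ : A →ₐ[k] A).toLinearMap d f))
      - (monoCochain σ δ (n + 1) d (f₂ σ (untwist σ f))
        - monoCochain σ δ n d (f₃ σ δ (untwist σ f))) ∈ commBoundaries (outerE σ δ) d := by
  have h : commX (outerE σ δ) d (push k A ((decompLeft σ δ).incl 0) d
      (push k A ((decompRight σ δ).incl n) d (untwist σ f))) ∈ commBoundaries (outerE σ δ) d :=
    Submodule.mem_sup_right ⟨_, push_mem_cocycles ((decompLeft σ δ).incl_isHom 0)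
      (push_mem_cocycles ((decompRight σ δ).incl_isHom n) (untwist_mem_cocycles σ hf)), rfl⟩
  rw [commX_incl, push_sigma_push_untwist, commMid_incl,
    map_sub (push k A ((decompLeft σ δ).incl 0) d)] at h
  rwa [sub_sub_eq_add_sub, add_sub_assoc]

/-- The operator `commMid` preserves cocycles, and for n = 0 the cochains f₂ and f₃ are, up to sign
and σ, the components of its value in the distinct summands 1 and 0. -/
theorem f₂_f₃_mem_cocycles {f : Cochain k A (A ⊗[k] A) d}
    (hf : f ∈ cocycles (outerTwisted k (sigmaInv σ)) d) :
    f₂ σ (untwist σ f) ∈ cocycles (outerTwisted k (sigmaInv σ)) d ∧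
      f₃ σ δ (untwist σ f) ∈ cocycles (outerTwisted k (sigmaInv σ)) d := by
  have h := commMid_mem_cocycles σ δ
    (push_mem_cocycles ((decompRight σ δ).incl_isHom 0) (untwist_mem_cocycles σ hf))
  rw [commMid_incl, zero_add] at h
  constructor
  · have h1 := push_mem_cocycles (((decompRight σ δ).twist σ).proj_isHom 1) h
    change push k A ((decompRight σ δ).proj 1) d _ ∈ _ at h1
    rw [map_sub (push k A ((decompRight σ δ).proj 1) d),
      (decompRight σ δ).push_proj_incl_of_ne zero_ne_one, (decompRight σ δ).push_proj_incl_self,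
      zero_sub, neg_mem_iff] at h1
    exact pull_sigma_mem_cocycles_iff.1 h1
  · have h1 := push_mem_cocycles (((decompRight σ δ).twist σ).proj_isHom 0) h
    change push k A ((decompRight σ δ).proj 0) d _ ∈ _ at h1
    rw [map_sub (push k A ((decompRight σ δ).proj 0) d),
      (decompRight σ δ).push_proj_incl_of_ne one_ne_zero, (decompRight σ δ).push_proj_incl_self,
      sub_zero] at h1
    exact pull_sigma_mem_cocycles_iff.1 h1

variable {σ δ} (hproj : Module.Projective k A) (hres : HasFGProjectiveResolution k A)
  (hd : ∀ i : ℕ, i ≠ d → Subsingleton (HHEnv k A i))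

/-- The isomorphism `Ω ≅ ω' ⊗ k[x]`. -/
def dualizingEquiv : HHEnv k (OreExtension σ δ) (d + 1) ≃ₗ[k]
    HHTwisted k (sigmaInv σ) d ⊗[k] k[X] :=
  (cohomologyEquivCoker (B := outerE σ δ) (n := d)
    fun _ hF => exists_pullC_eq hproj hres hd hF).trans (tensorEquivCoker hproj hres).symm

/-- Reduces each formula for the transported actions to a congruence of cochains modulo coboundaries
and skew commutators. -/
theorem dualizingEquiv_cohomologyMap (φ : (outerE σ δ).endo)
    (f : cocycles (outerTwisted k (sigmaInv σ)) d) (n : ℕ)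
    (t : HHTwisted k (sigmaInv σ) d ⊗[k] k[X]) (y : cocycles (resTwist (outerE σ δ)) d)
    (ht : tensorToCoker σ δ d t = CommCoker.mk _ d y)
    (h : push k A φ.1 d (monoCochain σ δ n d f.1) - y.1 ∈ commBoundaries (outerE σ δ) d) :
    dualizingEquiv hproj hres hd (cohomologyMap (outerE σ δ) (d + 1) φ
      ((dualizingEquiv hproj hres hd).symm
        (HH.mk _ d f ⊗ₜ[k] (Polynomial.X ^ n : k[X])))) = t := by
  rw [dualizingEquiv, LinearEquiv.trans_apply, LinearEquiv.symm_apply_eq]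
  refine Eq.trans ?_ ht.symm
  rw [cohomologyEquivCoker_cohomologyMap _ φ _ (monoCocycle σ δ d n f),
    CommCoker.mk_eq_mk_iff]
  · exact h
  · rw [LinearEquiv.symm_trans_apply, LinearEquiv.symm_symm, LinearEquiv.apply_symm_apply]
    exact tensorToCoker_tmul σ δ d (HH.mk _ d f) n

end OreExtension

end

end OreHochschild

/-! ### Assembly. -/

open OreHochschild in
theorem mainTheorem3 {k : Type*} {A : Type*} [CommRing k] [Ring A] [Algebra k A]
    (hproj : Module.Projective k A) (σ : A ≃ₐ[k] A) (δ : SkewDerivation σ)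
    (hres : HasFGProjectiveResolution k A) (d : ℕ)
    (hd : ∀ i : ℕ, i ≠ d → Subsingleton (HHEnv k A i)) :
    (∀ i : ℕ, i ≠ d + 1 → Subsingleton (HHEnv k (OreExtension σ δ) i)) ∧
    ∃ (B : BimoduleStr k (OreExtension σ δ) (HHTwisted k (sigmaInv σ) d ⊗[k] k[X]))
      (Φ : HHEnv k (OreExtension σ δ) (d + 1) ≃ₗ[k] HHTwisted k (sigmaInv σ) d ⊗[k] k[X]),
      (bimodHHEnv k (OreExtension σ δ) (d + 1)).IsHom B Φ.toLinearMap ∧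
      (∀ (a : A) (w : HHTwisted k (sigmaInv σ) d) (n : ℕ),
        B.left (OreExtension.C σ δ a) (w ⊗ₜ[k] (Polynomial.X ^ n : k[X])) =
          ∑ i ∈ Finset.range (n + 1),
            (bimodHHTwisted k (sigmaInv σ) d).left (qMap σ δ n i a) w ⊗ₜ[k]
              (Polynomial.X ^ i : k[X])) ∧
      (∀ (w : HHTwisted k (sigmaInv σ) d) (n : ℕ),
        B.left (OreExtension.X σ δ) (w ⊗ₜ[k] (Polynomial.X ^ n : k[X])) =
          w ⊗ₜ[k] (Polynomial.X ^ (n + 1) : k[X])) ∧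
      (∀ (a : A) (w : HHTwisted k (sigmaInv σ) d) (n : ℕ),
        B.right (MulOpposite.op (OreExtension.C σ δ a)) (w ⊗ₜ[k] (Polynomial.X ^ n : k[X])) =
          (bimodHHTwisted k (sigmaInv σ) d).right (MulOpposite.op a) w ⊗ₜ[k]
            (Polynomial.X ^ n : k[X])) ∧
      (∀ g : cocycles (outerTwisted k (sigmaInv σ)) d,
        ∃ (h₂ : f₂ σ (untwist σ g.1) ∈ cocycles (outerTwisted k (sigmaInv σ)) d)
          (h₃ : f₃ σ δ (untwist σ g.1) ∈ cocycles (outerTwisted k (sigmaInv σ)) d),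
          ∀ n : ℕ,
            B.right (MulOpposite.op (OreExtension.X σ δ))
                (HH.mk (outerTwisted k (sigmaInv σ)) d g ⊗ₜ[k] (Polynomial.X ^ n : k[X])) =
              HH.mk (outerTwisted k (sigmaInv σ)) d ⟨_, h₂⟩ ⊗ₜ[k]
                  (Polynomial.X ^ (n + 1) : k[X]) -
                HH.mk (outerTwisted k (sigmaInv σ)) d ⟨_, h₃⟩ ⊗ₜ[k]
                  (Polynomial.X ^ n : k[X])) := by
  have hl := fun e => innerTwisted_left_mem k (AlgHom.id k (OreExtension σ δ)) e
  have hr := fun e => innerTwisted_right_mem k (AlgHom.id k (OreExtension σ δ)) e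
  refine ⟨fun i hi => (subsingleton_HH_iff _ _).2
    (OreExtension.cocycles_outerE_le hproj hres hd hi),
    -- The structure on ω' ⊗ k[x] is transported from Ω, so equivariance is automatic and the
    -- content lies in the four formulas.
    (bimodHHEnv k (OreExtension σ δ) (d + 1)).transport
      (OreExtension.dualizingEquiv hproj hres hd),
    OreExtension.dualizingEquiv hproj hres hd, BimoduleStr.isHom_transport _ _, ?_, ?_, ?_, ?_⟩
  · intro a w n
    obtain ⟨f, rfl⟩ := Submodule.mkQ_surjective _ w
    refine OreExtension.dualizingEquiv_cohomologyMap hproj hres hd ⟨_, hl (OreExtension.C σ δ a)⟩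
      f n _ (∑ i ∈ Finset.range (n + 1), OreExtension.monoCocycle σ δ d i
        ⟨postcomp k A _ d ((innerTwisted k (sigmaInv σ)).left (qMap σ δ n i a)) f.1,
          postcomp_mem_cocycles _ d (innerTwisted_left_mem k _ _) f.2⟩) ?_ ?_
    · rw [map_sum, map_sum]
      refine Finset.sum_congr rfl fun i _ => ?_
      rw [OreExtension.tensorToCoker_tmul]
      rfl
    -- The two cochains agree exactly, by a x^n = ∑ x^i q^n_i(a); the same holds for the left action
    -- of x and the right action of A.
    · refine Set.mem_of_eq_of_mem (sub_eq_zero.2 ?_) (Submodule.zero_mem _)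
      rw [AddSubmonoidClass.coe_finsetSum]
      ext v
      rw [sum_apply]
      exact OreExtension.innerE_left_C σ δ a n _
  · intro w n
    obtain ⟨f, rfl⟩ := Submodule.mkQ_surjective _ w
    refine OreExtension.dualizingEquiv_cohomologyMap hproj hres hd ⟨_, hl (OreExtension.X σ δ)⟩
      f n _ (OreExtension.monoCocycle σ δ d (n + 1) f) ?_ ?_
    · rw [OreExtension.tensorToCoker_tmul]
      rfl
    · refine Set.mem_of_eq_of_mem (sub_eq_zero.2 ?_) (Submodule.zero_mem _)
      ext v
      exact OreExtension.innerE_left_X σ δ n _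
  · intro a w n
    obtain ⟨f, rfl⟩ := Submodule.mkQ_surjective _ w
    refine OreExtension.dualizingEquiv_cohomologyMap hproj hres hd
      ⟨_, hr (MulOpposite.op (OreExtension.C σ δ a))⟩ f n _ (OreExtension.monoCocycle σ δ d n
        ⟨postcomp k A _ d ((innerTwisted k (sigmaInv σ)).right (MulOpposite.op a)) f.1,
          postcomp_mem_cocycles _ d (innerTwisted_right_mem k _ _) f.2⟩) ?_ ?_
    · rw [OreExtension.tensorToCoker_tmul]
      rfl
    · refine Set.mem_of_eq_of_mem (sub_eq_zero.2 ?_) (Submodule.zero_mem _)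
      ext v
      exact OreExtension.innerE_right_C σ δ a n _
  · intro g
    obtain ⟨h₂, h₃⟩ := OreExtension.f₂_f₃_mem_cocycles σ δ g.2
    refine ⟨h₂, h₃, fun n => ?_⟩
    refine OreExtension.dualizingEquiv_cohomologyMap hproj hres hd
      ⟨_, hr (MulOpposite.op (OreExtension.X σ δ))⟩ g n _
      (OreExtension.monoCocycle σ δ d (n + 1) ⟨_, h₂⟩ - OreExtension.monoCocycle σ δ d n ⟨_, h₃⟩)
      ?_ ?_
    · rw [map_sub, map_sub (OreExtension.CommCoker.mk (OreExtension.outerE σ δ) d),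
        OreExtension.tensorToCoker_tmul, OreExtension.tensorToCoker_tmul]
      rfl
    -- Only here is a skew commutator needed: right multiplication by x leaves the summand 0 and has
    -- to be brought back.
    · refine Set.mem_of_eq_of_mem (congrArg₂ (· - ·) ?_ rfl)
        (OreExtension.push_incl_one_sub_mem σ δ n g.2)
      ext v
      exact OreExtension.innerE_right_X σ δ _
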